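/- Let $R$ be an associative ring with identity, $\mathrm{Mod}R$ the category of left $R$-modules and $\mathrm{D}(R)$ the derived category of unbounded cochain complexes of $R$-modules. Let $\mathsf{A}$ and $\mathsf{B}$ be classes of $R$-modules, each closed under isomorphisms and direct summands. Definitions. (a) $(\mathsf{A},\mathsf{B})$ is a complete hereditary cotorsion pair in $\mathrm{Mod}R$ if $\mathsf{B}=\{M \mid \mathrm{Ext}^1_R(A,M)=0\ \text{for all}\ A\in\mathsf{A}\}$ and $\mathsf{A}=\{N \mid \mathrm{Ext}^1_R(N,B)=0\ \text{for all}\ B\in\mathsf{B}\}$ (cotorsion pair); every module $M$ has exact sequences $0\to B\to A\to M\to 0$ and $0\to M\to B'\to A'\to 0$ with $A,A'\in\mathsf{A}$ and $B,B'\in\mathsf{B}$ (complete); and $\mathsf{A}$ is closed under kernels of epimorphisms between its objects and $\mathsf{B}$ under cokernels of monomorphisms between its objects (hereditary). (b) A complex $P$ is semi-projective if $\mathrm{Hom}_R(P,\beta)$ is a surjective quasi-isomorphism for every surjective quasi-isomorphism $\beta$; a complex $I$ is semi-injective if $\mathrm{Hom}_R(\alpha,I)$ is a surjective quasi-isomorphism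 for every injective quasi-isomorphism $\alpha$. A semi-projective (semi-injective) resolution of $X$ is a quasi-isomorphism $P\to X$ ($X\to I$) with $P$ semi-projective ($I$ semi-injective). Let $\mathcal{A}_{\mathsf{P}}\subseteq\mathrm{D}(R)$ be the class of complexes that have some semi-projective resolution $P$ with $\mathrm{coker}(P^{s-1}\to P^s)\in\mathsf{A}$ for all $s\in\mathbb{Z}$, and $\mathcal{B}_{\mathsf{I}}\subseteq\mathrm{D}(R)$ the class of complexes that have some semi-injective resolution $I$ with $\ker(I^{s}\to I^{s+1})\in\mathsf{B}$ for all $s\in\mathbb{Z}$. (c) Let $\langle\mathsf{P}\rangle_1$ be the class of retracts in $\mathrm{D}(R)$ of coproducts of shifts of projective $R$-modules, and let $\xi$ be the class of cohomologically ghost triangles, i.e. of the exact triangles $X\to Y\to Z\to X[1]$ in $\mathrm{D}(R)$ such that $0\to\mathrm{Hom}(P,X)\to\mathrm{Hom}(P,Y)\to\mathrm{Hom}(P,Z)\to 0$ is exact for all $P\in\langle\mathsf{P}\rangle_1$. An object $P$ is $\xi$-projective if this sequence is exact for all triangles in $\xi$. A $\xi$-projective resolution of $X$ consists of triangles $K_{n+1}\to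 P_n\to K_n\to K_{n+1}[1]$ in $\xi$ $(n\ge 0)$ with all $P_n$ $\xi$-projective and $K_0\cong X$; with the composites $P_{n+1}\to K_{n+1}\to P_n$ as differentials, $\xi xt^n_\xi(X,Y)$ is the $n$-th cohomology of the complex $\mathrm{Hom}_{\mathrm{D}(R)}(P_\bullet,Y)$ (the $n$-th right $\xi$-derived functor of $\mathrm{Hom}_{\mathrm{D}(R)}(-,Y)$; it does not depend on the resolution). (d) A pair $(\mathcal{A},\mathcal{B})$ of classes of objects of $\mathrm{D}(R)$ is a complete hereditary cotorsion pair with respect to $\xi$ if $\mathcal{B}=\{U\mid \xi xt^1_\xi(A,U)=0\ \text{for all}\ A\in\mathcal{A}\}$ and $\mathcal{A}=\{V\mid \xi xt^1_\xi(V,B)=0\ \text{for all}\ B\in\mathcal{B}\}$; for every $X\in\mathrm{D}(R)$ there are triangles $B\to A\to X\to B[1]$ and $X\to B'\to A'\to X[1]$ in $\xi$ with $A,A'\in\mathcal{A}$ and $B,B'\in\mathcal{B}$; and for all triangles $A_1\to A_2\to A_3\to A_1[1]$ and $B_1\to B_2\to B_3\to B_1[1]$ in $\xi$ with $A_2,A_3\in\mathcal{A}$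 and $B_1,B_2\in\mathcal{B}$ one has $A_1\in\mathcal{A}$ and $B_3\in\mathcal{B}$. Theorem. The following are equivalent: (1) $(\mathsf{A},\mathsf{B})$ is a complete hereditary cotorsion pair in $\mathrm{Mod}R$; (2) $(\mathcal{A}_{\mathsf{P}},\mathcal{B}_{\mathsf{I}})$ is a complete hereditary cotorsion pair in $\mathrm{D}(R)$ with respect to $\xi$. -/

import Mathlib

open CategoryTheory Limits Pretriangulated

universe w u

noncomputable section

/-! ### Complete hereditary cotorsion pairs in a module category -/

section ModuleCotorsion

variable {R : Type u} [Ring R]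

/-- `A^⊥ = {M | Ext¹(N, M) = 0 for all N ∈ A}`. -/
def rightPerp (A : ObjectProperty (ModuleCat.{u} R)) : ObjectProperty (ModuleCat.{u} R) :=
  fun M => ∀ N, A N → Subsingleton (Abelian.Ext N M 1)

/-- `^⊥B = {N | Ext¹(N, M) = 0 for all M ∈ B}`. -/
def leftPerp (B : ObjectProperty (ModuleCat.{u} R)) : ObjectProperty (ModuleCat.{u} R) :=
  fun N => ∀ M, B M → Subsingleton (Abelian.Ext N M 1)

/-- `(A, B)` is a complete hereditary cotorsion pair in `Mod R`. -/
structure IsCompleteHereditaryCotorsionPair (A B : ObjectProperty (ModuleCat.{u} R)) : Prop where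
  rightPerp_eq : rightPerp A = B
  leftPerp_eq : leftPerp B = A
  /-- exact sequences `0 ⟶ B ⟶ A ⟶ M ⟶ 0` -/
  enough_left (M : ModuleCat.{u} R) : ∃ (Y X : ModuleCat.{u} R) (i : Y ⟶ X) (p : X ⟶ M)
    (h : i ≫ p = 0), (ShortComplex.mk i p h).ShortExact ∧ A X ∧ B Y
  /-- exact sequences `0 ⟶ M ⟶ B' ⟶ A' ⟶ 0` -/
  enough_right (M : ModuleCat.{u} R) : ∃ (Y X : ModuleCat.{u} R) (i : M ⟶ Y) (p : Y ⟶ X)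
    (h : i ≫ p = 0), (ShortComplex.mk i p h).ShortExact ∧ A X ∧ B Y
  /-- `A` is closed under kernels of epimorphisms -/
  hereditary_left (S : ShortComplex (ModuleCat.{u} R)) :
    S.ShortExact → A S.X₂ → A S.X₃ → A S.X₁
  /-- `B` is closed under cokernels of monomorphisms -/
  hereditary_right (S : ShortComplex (ModuleCat.{u} R)) :
    S.ShortExact → B S.X₁ → B S.X₂ → B S.X₃

end ModuleCotorsion

/-! ### Homological algebra relative to a class `ξ` of triangles -/

section Relative

variable {T : Type*} [Category* T] [Preadditive T] [HasZeroObject T] [HasShift T ℤ]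
  [∀ n : ℤ, (shiftFunctor T n).Additive] [Pretriangulated T]

/-- `0 ⟶ Hom(P, X) ⟶ Hom(P, Y) ⟶ Hom(P, Z) ⟶ 0` is exact for the triangle
`X ⟶ Y ⟶ Z ⟶ X⟦1⟧`. -/
def HomShortExact (P : T) (t : Triangle T) : Prop :=
  Function.Injective (fun f : P ⟶ t.obj₁ => f ≫ t.mor₁) ∧
  Function.Exact (fun f : P ⟶ t.obj₁ => f ≫ t.mor₁) (fun f : P ⟶ t.obj₂ => f ≫ t.mor₂) ∧
  Function.Surjective (fun f : P ⟶ t.obj₂ => f ≫ t.mor₂)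

/-- `ξ(𝒬)`: the exact triangles on which `Hom(P, -)` is short exact for all `P ∈ 𝒬`. -/
def triangleClass (𝒬 : ObjectProperty T) : ObjectProperty (Triangle T) :=
  fun t => t ∈ distTriang T ∧ ∀ P, 𝒬 P → HomShortExact P t

/-- The `ξ`-projective objects. -/
def xiProjective (ξ : ObjectProperty (Triangle T)) : ObjectProperty T :=
  fun P => ∀ t, ξ t → HomShortExact P t

/-- A `ξ`-projective resolution of `X`: triangles `K (n+1) ⟶ P n ⟶ K n ⟶ (K (n+1))⟦1⟧` in `ξ`
with `P n` a `ξ`-projective object, and `K 0 ≅ X`. -/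
structure XiProjectiveResolution (ξ : ObjectProperty (Triangle T)) (X : T) where
  K : ℕ → T
  P : ℕ → T
  ι (n : ℕ) : K (n + 1) ⟶ P n
  π (n : ℕ) : P n ⟶ K n
  ν (n : ℕ) : K n ⟶ (K (n + 1))⟦(1 : ℤ)⟧
  mem (n : ℕ) : ξ (Triangle.mk (ι n) (π n) (ν n))
  projective (n : ℕ) : xiProjective ξ (P n)
  augmentation : K 0 ≅ X

namespace XiProjectiveResolution

variable {ξ : ObjectProperty (Triangle T)} {X : T} (ρ : XiProjectiveResolution ξ X)

/-- The differential `P (n+1) ⟶ K (n+1) ⟶ P n` of the resolution. -/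
def d (n : ℕ) : ρ.P (n + 1) ⟶ ρ.P n := ρ.π (n + 1) ≫ ρ.ι n

/-- The differential `Hom(P n, Y) ⟶ Hom(P (n+1), Y)` of the complex `Hom(P, Y)`. -/
def homD (Y : T) (n : ℕ) : (ρ.P n ⟶ Y) →+ (ρ.P (n + 1) ⟶ Y) :=
  Preadditive.leftComp Y (ρ.d n)

/-- The cohomology in degree `n + 1` of the complex `Hom(P, Y)`, i.e. the group
`ξxt^{n+1}(X, Y)`, the value at `X` of the right `ξ`-derived functor of `Hom(-, Y)`,
computed with the resolution `ρ`. -/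
abbrev XiExtSucc (Y : T) (n : ℕ) : Type _ :=
  (ρ.homD Y (n + 1)).ker ⧸ ((ρ.homD Y n).range.addSubgroupOf (ρ.homD Y (n + 1)).ker)

end XiProjectiveResolution

/-- `ξxt¹(X, Y) = 0`. By the comparison theorem the group does not depend on the
`ξ`-projective resolution of `X` that computes it. -/
def XiExtOneVanishes (ξ : ObjectProperty (Triangle T)) (X Y : T) : Prop :=
  ∃ ρ : XiProjectiveResolution ξ X, Subsingleton (ρ.XiExtSucc Y 0)

/-- `𝒜^{⊥_ξ}` -/
def xiRightPerp (ξ : ObjectProperty (Triangle T)) (𝒜 : ObjectProperty T) : ObjectProperty T :=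
  fun U => ∀ X, 𝒜 X → XiExtOneVanishes ξ X U

/-- `^{⊥_ξ}ℬ` -/
def xiLeftPerp (ξ : ObjectProperty (Triangle T)) (ℬ : ObjectProperty T) : ObjectProperty T :=
  fun V => ∀ Y, ℬ Y → XiExtOneVanishes ξ V Y

/-- `(𝒜, ℬ)` is a complete hereditary cotorsion pair with respect to `ξ`. -/
structure IsXiCompleteHereditaryCotorsionPair (ξ : ObjectProperty (Triangle T))
    (𝒜 ℬ : ObjectProperty T) : Prop where
  rightPerp_eq : xiRightPerp ξ 𝒜 = ℬ
  leftPerp_eq : xiLeftPerp ξ ℬ = 𝒜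
  /-- triangles `B ⟶ A ⟶ X ⟶ B⟦1⟧` in `ξ` -/
  enough_left (X : T) : ∃ (B A : T) (f : B ⟶ A) (g : A ⟶ X) (h : X ⟶ B⟦(1 : ℤ)⟧),
    ξ (Triangle.mk f g h) ∧ 𝒜 A ∧ ℬ B
  /-- triangles `X ⟶ B' ⟶ A' ⟶ X⟦1⟧` in `ξ` -/
  enough_right (X : T) : ∃ (B A : T) (f : X ⟶ B) (g : B ⟶ A) (h : A ⟶ X⟦(1 : ℤ)⟧),
    ξ (Triangle.mk f g h) ∧ 𝒜 A ∧ ℬ B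
  hereditary_left (t : Triangle T) : ξ t → 𝒜 t.obj₂ → 𝒜 t.obj₃ → 𝒜 t.obj₁
  hereditary_right (t : Triangle T) : ξ t → ℬ t.obj₁ → ℬ t.obj₂ → ℬ t.obj₃

end Relative

/-! ### Semi-projective and semi-injective complexes -/

section Semi

open CochainComplex HomComplex

variable {C : Type*} [Category* C] [Preadditive C]

/-- The map of complexes `Hom(P, β) : Hom(P, M) ⟶ Hom(P, N)`. -/
def homComplexPostcomp (P : CochainComplex C ℤ) {M N : CochainComplex C ℤ} (β : M ⟶ N) :
    HomComplex P M ⟶ HomComplex P N where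
  f n := AddCommGrpCat.ofHom
    { toFun := fun z : Cochain P M n => z.comp (Cochain.ofHom β) (add_zero n)
      map_zero' := Cochain.zero_comp _ _
      map_add' := fun _ _ => Cochain.add_comp _ _ _ _ }
  comm' i j _ := by
    ext z
    exact δ_comp_ofHom (z : Cochain P M i) β j

/-- The map of complexes `Hom(α, I) : Hom(N, I) ⟶ Hom(M, I)`. -/
def homComplexPrecomp {M N : CochainComplex C ℤ} (α : M ⟶ N) (I : CochainComplex C ℤ) :
    HomComplex N I ⟶ HomComplex M I where
  f n := AddCommGrpCat.ofHom
    { toFun := fun z : Cochain N I n => (Cochain.ofHom α).comp z (zero_add n)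
      map_zero' := Cochain.comp_zero _ _
      map_add' := fun _ _ => Cochain.comp_add _ _ _ _ }
  comm' i j _ := by
    ext z
    exact δ_ofHom_comp α (z : Cochain N I i) j

/-- A morphism of complexes of abelian groups is a surjective quasi-isomorphism. -/
def IsSurjQuasiIso {K L : CochainComplex AddCommGrpCat ℤ} (φ : K ⟶ L) : Prop :=
  (∀ n, Function.Surjective (φ.f n)) ∧ QuasiIso φ

variable {R : Type u} [Ring R]

/-- `Hom(P, β)` is a surjective quasi-isomorphism for all surjective quasi-isomorphisms `β`. -/
def IsSemiProjective (P : CochainComplex (ModuleCat.{u} R) ℤ) : Prop :=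
  ∀ ⦃M N : CochainComplex (ModuleCat.{u} R) ℤ⦄ (β : M ⟶ N),
    (∀ n, Function.Surjective (β.f n)) → QuasiIso β → IsSurjQuasiIso (homComplexPostcomp P β)

/-- `Hom(α, I)` is a surjective quasi-isomorphism for all injective quasi-isomorphisms `α`. -/
def IsSemiInjective (I : CochainComplex (ModuleCat.{u} R) ℤ) : Prop :=
  ∀ ⦃M N : CochainComplex (ModuleCat.{u} R) ℤ⦄ (α : M ⟶ N),
    (∀ n, Function.Injective (α.f n)) → QuasiIso α → IsSurjQuasiIso (homComplexPrecomp α I)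

end Semi

/-! ### The classes in the derived category -/

section Derived

variable {R : Type u} [Ring R] [HasDerivedCategory.{w} (ModuleCat.{u} R)]

/-- `⟨𝖷⟩₁`: the retracts of coproducts of shifts of modules in `𝖷`. -/
def retractsOfCoproductsOfShifts (X : ObjectProperty (ModuleCat.{u} R)) :
    ObjectProperty (DerivedCategory (ModuleCat.{u} R)) :=
  fun Y => ∃ (J : Type u) (M : J → ModuleCat.{u} R) (n : J → ℤ)
    (c : Cofan (fun j =>
      ((DerivedCategory.singleFunctor (ModuleCat.{u} R) 0).obj (M j))⟦n j⟧)),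
    (∀ j, X (M j)) ∧ Nonempty (IsColimit c) ∧ Nonempty (Retract Y c.pt)

variable (R) in
/-- The class `ξ` of cohomologically ghost triangles in `D(R)`. -/
def ghostTriangles : ObjectProperty (Triangle (DerivedCategory (ModuleCat.{u} R))) :=
  triangleClass (retractsOfCoproductsOfShifts (isProjective (ModuleCat.{u} R)))

/-- `𝒳_P`: the complexes that have a semi-projective resolution `P` with
`coker (P^{s-1} ⟶ P^s)` in `𝖷` for all `s`. -/
def projClass (X : ObjectProperty (ModuleCat.{u} R)) :
    ObjectProperty (DerivedCategory (ModuleCat.{u} R)) :=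
  fun Y => ∃ (K P : CochainComplex (ModuleCat.{u} R) ℤ) (f : P ⟶ K),
    Nonempty (DerivedCategory.Q.obj K ≅ Y) ∧ IsSemiProjective P ∧ QuasiIso f ∧
    ∀ s : ℤ, X (cokernel (P.d (s - 1) s))

/-- `𝒳_I`: the complexes that have a semi-injective resolution `I` with
`ker (I^s ⟶ I^{s+1})` in `𝖷` for all `s`. -/
def injClass (X : ObjectProperty (ModuleCat.{u} R)) :
    ObjectProperty (DerivedCategory (ModuleCat.{u} R)) :=
  fun Y => ∃ (K I : CochainComplex (ModuleCat.{u} R) ℤ) (f : K ⟶ I),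
    Nonempty (DerivedCategory.Q.obj K ≅ Y) ∧ IsSemiInjective I ∧ QuasiIso f ∧
    ∀ s : ℤ, X (kernel (I.d s (s + 1)))

end Derived

end

/-! Everything is reduced to homology modules. Testing a triangle on the objects $R[-s]$ shows that
the triangles in $\xi$ are exactly the distinguished ones that induce short exact sequences in
homology (`ghostTriangles_iff`). The $\xi$-projectives are objects with projective homology out of
which morphisms in $\mathrm{D}(R)$ are the same as graded maps on homology, and complexes of
projectives with zero differential supply enough of them. Applying homology to a $\xi$-projective
resolution therefore gives a projective resolution in each degree, so $\xi xt^1_\xi(X,Y)=0$ if and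
only if $\mathrm{Ext}^1_R(H^sX,H^sY)=0$ for all $s$ (`xiExtOneVanishes_iff`).

From modules to $\mathrm{D}(R)$, the main point is that $\mathcal{A}_{\mathsf P}$ and
$\mathcal{B}_{\mathsf I}$ are the classes of objects with all homology in $\mathsf A$, respectively
in $\mathsf B$ (`projClass_iff`, `injClass_iff`). One inclusion is the hereditary property. The
other uses resolutions, built as homotopy limits and colimits of towers (`hasInjectiveModel`,
`hasProjectiveModel`), and a vanishing theorem, `eq_zero_of_homology`: if $X$ has homology in
$\mathsf A$ and $Y$ in $\mathsf B$, a morphism $X\to Y$ that is zero on homology is zero. Such a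
morphism lifts along an infinite tower of maps that are zero on homology, and the homotopy limit of
such a tower vanishes. For a semi-projective $P$ this makes every map from the coboundaries $B^s(P)$
to a module in $\mathsf B$ extend to $P^s$, which puts the cokernels in $\mathsf A$. Orthogonality
and heredity are then checked degree by degree. Completeness requires realizing approximations of
homology by a morphism of complexes: cocycles and coboundaries are enlarged separately and glued
(`exists_right_approximation`), and the other approximation follows by Salce's argument.

From $\mathrm{D}(R)$ to modules, $\mathcal{A}_{\mathsf P}$ is stable under shifts, so the
$\mathrm{Ext}^1$ conditions hold between homology modules in arbitrary degrees. Membership of an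
object in either class is then decided by the stalk complexes of its homology, and the modules whose
stalk lies in the classes form a complete hereditary cotorsion pair. These modules are those of
$\mathsf A$ and $\mathsf B$: one inclusion is a retract argument, the other uses two-term complexes
of projectives or injectives. -/

/-! ### Homology of complexes by explicit cocycles. -/

section HomologyClasses

variable {R : Type u} [Ring R]

/-- The class of a cocycle of a complex of modules. -/
noncomputable def homologyClass (K : CochainComplex (ModuleCat.{u} R) ℤ) (s : ℤ) :
    LinearMap.ker (K.d s (s + 1)).hom →ₗ[R] K.homology s :=
  (K.liftCycles (ModuleCat.ofHom (LinearMap.ker (K.d s (s + 1)).hom).subtype) (s + 1) (by simp)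
    (by ext x; exact x.2) ≫ K.homologyπ s).hom

lemma homologyClass_surjective (K : CochainComplex (ModuleCat.{u} R) ℤ) (s : ℤ) :
    Function.Surjective (homologyClass K s) := by
  intro h
  obtain ⟨c, rfl⟩ := (ModuleCat.epi_iff_surjective (K.homologyπ s)).1 inferInstance h
  have hc : K.d s (s + 1) (K.iCycles s c) = 0 := by
    rw [← ConcreteCategory.comp_apply, K.iCycles_d]; rfl
  refine ⟨⟨K.iCycles s c, hc⟩, ?_⟩
  change K.homologyπ s (K.liftCycles _ _ _ _ _) = _
  congr 1
  apply (ModuleCat.mono_iff_injective (K.iCycles s)).1 inferInstance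
  rw [← ConcreteCategory.comp_apply, HomologicalComplex.liftCycles_i]
  rfl

lemma homologyClass_eq_zero_iff (K : CochainComplex (ModuleCat.{u} R) ℤ) (s : ℤ)
    (z : LinearMap.ker (K.d s (s + 1)).hom) :
    homologyClass K s z = 0 ↔ ∃ w : K.X (s - 1), K.d (s - 1) s w = z.1 := by
  have hex : (ShortComplex.mk _ _ (K.toCycles_comp_homologyπ (s - 1) s)).Exact :=
    ShortComplex.exact_of_g_is_cokernel _ (K.homologyIsCokernel (s - 1) s (by simp))
  rw [ShortComplex.ShortExact.moduleCat_exact_iff_function_exact] at hex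
  refine (hex _).trans (exists_congr fun w => ?_)
  rw [← ((ModuleCat.mono_iff_injective (K.iCycles s)).1 inferInstance).eq_iff]
  have h₁ := congr($(K.toCycles_i (s - 1) s) w)
  have h₂ := congr($(K.liftCycles_i (ModuleCat.ofHom (LinearMap.ker (K.d s (s + 1)).hom).subtype)
    (s + 1) (by simp) (by ext x; exact x.2)) z)
  exact ⟨fun h => h₁.symm.trans (h.trans h₂), fun h => h₁.trans (h.trans h₂.symm)⟩

/-- The image of a cocycle under a morphism of complexes. -/
def mapCocycle {K L : CochainComplex (ModuleCat.{u} R) ℤ} (f : K ⟶ L) (s : ℤ) :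
    LinearMap.ker (K.d s (s + 1)).hom →ₗ[R] LinearMap.ker (L.d s (s + 1)).hom :=
  (f.f s).hom.restrict fun x hx => by
    have := congr($(f.comm s (s + 1)) x)
    change L.d s (s + 1) (f.f s x) = f.f (s + 1) (K.d s (s + 1) x) at this
    change L.d s (s + 1) (f.f s x) = 0
    rw [this, show K.d s (s + 1) x = 0 from hx, map_zero]

@[simp]
lemma mapCocycle_coe {K L : CochainComplex (ModuleCat.{u} R) ℤ} (f : K ⟶ L) (s : ℤ)
    (z : LinearMap.ker (K.d s (s + 1)).hom) : (mapCocycle f s z).1 = f.f s z.1 := rfl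

lemma homologyMap_homologyClass {K L : CochainComplex (ModuleCat.{u} R) ℤ} (f : K ⟶ L) (s : ℤ)
    (z : LinearMap.ker (K.d s (s + 1)).hom) :
    HomologicalComplex.homologyMap f s (homologyClass K s z) =
      homologyClass L s (mapCocycle f s z) := by
  have : ModuleCat.ofHom (homologyClass K s) ≫ HomologicalComplex.homologyMap f s =
      ModuleCat.ofHom (mapCocycle f s) ≫ ModuleCat.ofHom (homologyClass L s) := by
    change (_ ≫ _) ≫ _ = _ ≫ (_ ≫ _)
    simp only [Category.assoc, HomologicalComplex.homologyπ_naturality]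
    rw [← Category.assoc, ← Category.assoc]
    congr 1
    rw [← cancel_mono (L.iCycles s)]
    simp only [Category.assoc, HomologicalComplex.cyclesMap_i,
      HomologicalComplex.liftCycles_i, HomologicalComplex.liftCycles_i_assoc]
    rfl
  exact congr($this z)

end HomologyClasses

section AbComplexes

/-- The class of a cocycle of a complex of abelian groups. -/
noncomputable def abHomologyClass (K : CochainComplex AddCommGrpCat.{w} ℤ) (s : ℤ) :
    (K.d s (s + 1)).hom.ker →+ K.homology s :=
  (K.liftCycles (AddCommGrpCat.ofHom (K.d s (s + 1)).hom.ker.subtype) (s + 1) (by simp)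
    (by ext x; exact x.2) ≫ K.homologyπ s).hom

lemma abHomologyClass_surjective (K : CochainComplex AddCommGrpCat.{w} ℤ) (s : ℤ) :
    Function.Surjective (abHomologyClass K s) := by
  intro h
  obtain ⟨c, rfl⟩ := (AddCommGrpCat.epi_iff_surjective (K.homologyπ s)).1 inferInstance h
  have hc : K.d s (s + 1) (K.iCycles s c) = 0 := by
    rw [← ConcreteCategory.comp_apply, K.iCycles_d]; rfl
  refine ⟨⟨K.iCycles s c, hc⟩, ?_⟩
  change K.homologyπ s (K.liftCycles _ _ _ _ _) = _
  congr 1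
  apply (AddCommGrpCat.mono_iff_injective (K.iCycles s)).1 inferInstance
  rw [← ConcreteCategory.comp_apply, HomologicalComplex.liftCycles_i]
  rfl

lemma abHomologyClass_eq_zero_iff (K : CochainComplex AddCommGrpCat.{w} ℤ) (s : ℤ)
    (z : (K.d s (s + 1)).hom.ker) :
    abHomologyClass K s z = 0 ↔ ∃ w : K.X (s - 1), K.d (s - 1) s w = z.1 := by
  have hex : (ShortComplex.mk _ _ (K.toCycles_comp_homologyπ (s - 1) s)).Exact :=
    ShortComplex.exact_of_g_is_cokernel _ (K.homologyIsCokernel (s - 1) s (by simp))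
  rw [ShortComplex.ab_exact_iff_function_exact] at hex
  refine (hex _).trans (exists_congr fun w => ?_)
  rw [← ((AddCommGrpCat.mono_iff_injective (K.iCycles s)).1 inferInstance).eq_iff]
  have h₁ := congr($(K.toCycles_i (s - 1) s) w)
  have h₂ := congr($(K.liftCycles_i (AddCommGrpCat.ofHom (K.d s (s + 1)).hom.ker.subtype)
    (s + 1) (by simp) (by ext x; exact x.2)) z)
  exact ⟨fun h => h₁.symm.trans (h.trans h₂), fun h => h₁.trans (h.trans h₂.symm)⟩

lemma homologyMap_abHomologyClass {K L : CochainComplex AddCommGrpCat.{w} ℤ} (f : K ⟶ L) (s : ℤ)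
    (z : (K.d s (s + 1)).hom.ker) (z' : (L.d s (s + 1)).hom.ker) (h : f.f s z.1 = z'.1) :
    HomologicalComplex.homologyMap f s (abHomologyClass K s z) = abHomologyClass L s z' := by
  have h₁ := congr($(HomologicalComplex.homologyπ_naturality f s)
    (K.liftCycles (AddCommGrpCat.ofHom (K.d s (s + 1)).hom.ker.subtype) (s + 1) (by simp)
    (by ext x; exact x.2) z))
  refine h₁.trans ?_
  change L.homologyπ s _ = L.homologyπ s _
  congr 1
  apply (AddCommGrpCat.mono_iff_injective (L.iCycles s)).1 inferInstance
  have h₂ := congr($(HomologicalComplex.cyclesMap_i f s)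
    (K.liftCycles (AddCommGrpCat.ofHom (K.d s (s + 1)).hom.ker.subtype) (s + 1) (by simp)
    (by ext x; exact x.2) z))
  have h₃ := congr($(K.liftCycles_i (AddCommGrpCat.ofHom (K.d s (s + 1)).hom.ker.subtype)
    (s + 1) (by simp) (by ext x; exact x.2)) z)
  have h₄ := congr($(L.liftCycles_i (AddCommGrpCat.ofHom (L.d s (s + 1)).hom.ker.subtype)
    (s + 1) (by simp) (by ext x; exact x.2)) z')
  exact h₂.trans ((congrArg (f.f s) h₃).trans (h.trans h₄.symm))

/-- A morphism of complexes of abelian groups is a quasi-isomorphism if it is surjective,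
cocycles lift to cocycles, and cocycles in its kernel are coboundaries. -/
lemma quasiIso_of_lift_cocycles {K L : CochainComplex AddCommGrpCat.{w} ℤ} (φ : K ⟶ L)
    (h₁ : ∀ n, Function.Surjective (φ.f n))
    (h₂ : ∀ n (y : L.X n), L.d n (n + 1) y = 0 → ∃ x : K.X n, K.d n (n + 1) x = 0 ∧ φ.f n x = y)
    (h₃ : ∀ n (x : K.X n), K.d n (n + 1) x = 0 → φ.f n x = 0 →
      ∃ w : K.X (n - 1), K.d (n - 1) n w = x) : QuasiIso φ := by
  rw [quasiIso_iff]
  intro n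
  rw [quasiIsoAt_iff_isIso_homologyMap, ConcreteCategory.isIso_iff_bijective]
  constructor
  · rw [injective_iff_map_eq_zero]
    intro a ha
    obtain ⟨⟨x, hx⟩, rfl⟩ := abHomologyClass_surjective K n a
    have hx' : L.d n (n + 1) (φ.f n x) = 0 := by
      have := congr($(φ.comm n (n + 1)) x)
      change L.d n (n + 1) (φ.f n x) = φ.f (n + 1) (K.d n (n + 1) x) at this
      rw [this, show K.d n (n + 1) x = 0 from hx, map_zero]
    rw [homologyMap_abHomologyClass φ n ⟨x, hx⟩ ⟨φ.f n x, hx'⟩ rfl,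
      abHomologyClass_eq_zero_iff] at ha
    obtain ⟨y, hy⟩ := ha
    obtain ⟨w, rfl⟩ := h₁ _ y
    have hw := congr($(φ.comm (n - 1) n) w)
    change L.d (n - 1) n (φ.f (n - 1) w) = φ.f n (K.d (n - 1) n w) at hw
    have hdd := congr($(K.d_comp_d (n - 1) n (n + 1)) w)
    change K.d n (n + 1) (K.d (n - 1) n w) = 0 at hdd
    obtain ⟨v, hv⟩ := h₃ n (x - K.d (n - 1) n w)
      (by rw [map_sub, hdd, show K.d n (n + 1) x = 0 from hx, sub_zero])
      (by rw [map_sub, ← hw, hy, sub_self])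
    rw [abHomologyClass_eq_zero_iff]
    exact ⟨v + w, by rw [map_add, hv, sub_add_cancel]⟩
  · intro a
    obtain ⟨⟨y, hy⟩, rfl⟩ := abHomologyClass_surjective L n a
    obtain ⟨x, hx, hxy⟩ := h₂ n y hy
    exact ⟨abHomologyClass K n ⟨x, hx⟩, homologyMap_abHomologyClass φ n _ _ hxy⟩

end AbComplexes

/-! ### Semi-projective versus K-projective complexes, and their duals. -/

section KProjective

open CochainComplex HomComplex

variable {C : Type*} [Category* C] [Abelian C]

/-- After shifting the target, a cocycle of degree $n$ becomes a morphism of complexes into an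
acyclic complex. Its null-homotopy, shifted back, is the primitive. -/
lemma CochainComplex.IsKProjective.exists_δ_eq {K L : CochainComplex C ℤ} [K.IsKProjective]
    (hL : L.Acyclic) {n : ℤ} (z : Cochain K L n) (hz : δ n (n + 1) z = 0) (m : ℤ)
    (hm : m + 1 = n) : ∃ α : Cochain K L m, δ m n α = z := by
  obtain ⟨f, hf⟩ := (Cocycle.equivHom ..).surjective
    ((Cocycle.mk z _ rfl hz).leftShift (-n) 0 (by simp))
  obtain ⟨h⟩ := IsKProjective.nonempty_homotopy_zero f hL
  obtain ⟨g, hg⟩ := Cochain.equivHomotopy _ _ h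
  have hf' : Cochain.ofHom f = z.leftShift (-n) 0 (by simp) := congrArg Subtype.val hf
  rw [Cochain.ofHom_zero, add_zero, hf'] at hg
  -- The sign cancels the one that appears when `δ` is moved past the shift.
  refine ⟨(-n).negOnePow • g.leftUnshift m (by lia), ?_⟩
  rw [δ_units_smul, Cochain.δ_leftUnshift _ _ _ n 0 (by simp), ← hg,
    Cochain.leftUnshift_leftShift, smul_smul]
  simp

lemma CochainComplex.IsKInjective.exists_δ_eq {K L : CochainComplex C ℤ} [L.IsKInjective]
    (hK : K.Acyclic) {n : ℤ} (z : Cochain K L n) (hz : δ n (n + 1) z = 0) (m : ℤ)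
    (hm : m + 1 = n) : ∃ α : Cochain K L m, δ m n α = z :=
  IsKInjective.eq_δ_of_cocycle (Cocycle.mk z _ rfl hz) hK m hm

/-- A cochain annihilated by a degreewise epimorphism factors through its kernel. -/
lemma exists_cochain_comp_eq {S : ShortComplex (CochainComplex C ℤ)} (hS : S.ShortExact)
    (P : CochainComplex C ℤ) {k : ℤ} (w : Cochain P S.X₂ k)
    (hw : w.comp (Cochain.ofHom S.g) (add_zero k) = 0) :
    ∃ v : Cochain P S.X₁ k, v.comp (Cochain.ofHom S.f) (add_zero k) = w := by
  have hS' (q : ℤ) := hS.map_of_exact (HomologicalComplex.eval C (.up ℤ) q)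
  have hw' (p q : ℤ) (h : p + k = q) : w.v p q h ≫ S.g.f q = 0 := by
    simpa using Cochain.congr_v hw p q h
  have := fun q => (hS' q).mono_f
  refine ⟨Cochain.mk fun p q h => (hS' q).exact.lift (w.v p q h) (hw' p q h), ?_⟩
  ext p q h
  simpa using! (hS' q).exact.lift_f (w.v p q h) (hw' p q h)

/-- A cochain annihilated by a degreewise monomorphism factors through its cokernel. -/
lemma exists_comp_cochain_eq {S : ShortComplex (CochainComplex C ℤ)} (hS : S.ShortExact)
    (I : CochainComplex C ℤ) {k : ℤ} (w : Cochain S.X₂ I k)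
    (hw : (Cochain.ofHom S.f).comp w (zero_add k) = 0) :
    ∃ v : Cochain S.X₃ I k, (Cochain.ofHom S.g).comp v (zero_add k) = w := by
  have hS' (q : ℤ) := hS.map_of_exact (HomologicalComplex.eval C (.up ℤ) q)
  have hw' (p q : ℤ) (h : p + k = q) : S.f.f p ≫ w.v p q h = 0 := by
    simpa using Cochain.congr_v hw p q h
  have := fun q => (hS' q).epi_g
  refine ⟨Cochain.mk fun p q h => (hS' p).exact.desc (w.v p q h) (hw' p q h), ?_⟩
  ext p q h
  simpa using! (hS' p).exact.g_desc (w.v p q h) (hw' p q h)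

lemma cochain_comp_ofHom_injective {M N : CochainComplex C ℤ} (f : M ⟶ N) [∀ n, Mono (f.f n)]
    (P : CochainComplex C ℤ) {k : ℤ} (v w : Cochain P M k)
    (h : v.comp (Cochain.ofHom f) (add_zero k) = w.comp (Cochain.ofHom f) (add_zero k)) :
    v = w := by
  ext p q hpq
  rw [← cancel_mono (f.f q)]
  simpa using Cochain.congr_v h p q hpq

lemma ofHom_comp_cochain_injective {M N : CochainComplex C ℤ} (f : M ⟶ N) [∀ n, Epi (f.f n)]
    (I : CochainComplex C ℤ) {k : ℤ} (v w : Cochain N I k)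
    (h : (Cochain.ofHom f).comp v (zero_add k) = (Cochain.ofHom f).comp w (zero_add k)) :
    v = w := by
  ext p q hpq
  rw [← cancel_epi (f.f p)]
  simpa using Cochain.congr_v h p q hpq

end KProjective

section SemiProjective

open CochainComplex HomComplex

variable {R : Type u} [Ring R]

/-- Projectivity of the terms lifts cochains degree by degree. The kernel of $\beta$ is acyclic, so
K-projectivity makes every cocycle with values in that kernel a coboundary of a cochain with values
there. -/
lemma isSemiProjective_of_isKProjective (P : CochainComplex (ModuleCat.{u} R) ℤ) [P.IsKProjective]
    [∀ n, Projective (P.X n)] : IsSemiProjective P := by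
  intro M N β hβ hq
  have hepi : ∀ n, Epi (β.f n) := fun n => (ModuleCat.epi_iff_surjective _).2 (hβ n)
  have : Epi β := HomologicalComplex.epi_of_epi_f β inferInstance
  have hS : (ShortComplex.mk (kernel.ι β) β (kernel.condition β)).ShortExact :=
    { exact := ShortComplex.exact_of_f_is_kernel _ (kernelIsKernel β) }
  have hac : (kernel β).Acyclic := hS.acyclic_X₁ hq
  have hsurj (n : ℤ) (y : Cochain P N n) :
      ∃ x : Cochain P M n, x.comp (Cochain.ofHom β) (add_zero n) = y := by
    refine ⟨Cochain.mk fun p q h => Projective.factorThru (y.v p q h) (β.f q), ?_⟩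
    ext p q h : 3
    simp
  have hker (n : ℤ) (x : Cochain P M n) (hx : δ n (n + 1) x = 0)
      (hx' : x.comp (Cochain.ofHom β) (add_zero n) = 0) (m : ℤ) (hm : m + 1 = n) :
      ∃ w : Cochain P M m, δ m n w = x ∧ w.comp (Cochain.ofHom β) (add_zero m) = 0 := by
    obtain ⟨v, rfl⟩ := exists_cochain_comp_eq hS P x hx'
    have hv : δ n (n + 1) v = 0 :=
      cochain_comp_ofHom_injective (kernel.ι β) P _ _ (by
        rw [← δ_comp_ofHom, Cochain.zero_comp]; exact hx)
    obtain ⟨α, hα⟩ := IsKProjective.exists_δ_eq hac v hv m hm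
    refine ⟨α.comp (Cochain.ofHom (kernel.ι β)) (add_zero m), ?_, ?_⟩
    · rw [δ_comp_ofHom, hα]
    · rw [Cochain.comp_assoc_of_second_is_zero_cochain, ← Cochain.ofHom_comp]
      simp
  refine ⟨hsurj, quasiIso_of_lift_cocycles _ hsurj ?_ ?_⟩
  · have key (n : ℤ) (y : Cochain P N n) (hy : δ n (n + 1) y = 0) :
        ∃ x : Cochain P M n, δ n (n + 1) x = 0 ∧ x.comp (Cochain.ofHom β) (add_zero n) = y := by
      -- A cochain lift $x$ of the cocycle $y$ need not be a cocycle, but $\delta x$ has values in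
      -- $\ker\beta$. It is $\delta w$ with $w$ in $\ker\beta$, and $x-w$ is the required lift.
      obtain ⟨x, hx⟩ := hsurj n y
      obtain ⟨w, hw, hw'⟩ := hker (n + 1) (δ n (n + 1) x) (by rw [δ_δ])
        (by rw [← δ_comp_ofHom, hx, hy]) n rfl
      exact ⟨x - w, by rw [δ_sub, hw, sub_self], by rw [Cochain.sub_comp, hx, hw', sub_zero]⟩
    exact key
  · intro n x hx hx'
    obtain ⟨w, hw, -⟩ := hker n x hx hx' (n - 1) (by simp)
    exact ⟨w, hw⟩

lemma isSemiInjective_of_isKInjective (I : CochainComplex (ModuleCat.{u} R) ℤ) [I.IsKInjective]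
    [∀ n, Injective (I.X n)] : IsSemiInjective I := by
  intro M N α hα hq
  have hmono : ∀ n, Mono (α.f n) := fun n => (ModuleCat.mono_iff_injective _).2 (hα n)
  have : Mono α := HomologicalComplex.mono_of_mono_f α inferInstance
  have hS : (ShortComplex.mk α (cokernel.π α) (cokernel.condition α)).ShortExact :=
    { exact := ShortComplex.exact_of_g_is_cokernel _ (cokernelIsCokernel α) }
  have hac : (cokernel α).Acyclic := hS.acyclic_X₃ hq
  have hsurj (n : ℤ) (y : Cochain M I n) :
      ∃ x : Cochain N I n, (Cochain.ofHom α).comp x (zero_add n) = y := by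
    refine ⟨Cochain.mk fun p q h => Injective.factorThru (y.v p q h) (α.f p), ?_⟩
    ext p q h : 3
    simp
  have hker (n : ℤ) (x : Cochain N I n) (hx : δ n (n + 1) x = 0)
      (hx' : (Cochain.ofHom α).comp x (zero_add n) = 0) (m : ℤ) (hm : m + 1 = n) :
      ∃ w : Cochain N I m, δ m n w = x ∧ (Cochain.ofHom α).comp w (zero_add m) = 0 := by
    obtain ⟨v, rfl⟩ := exists_comp_cochain_eq hS I x hx'
    have hv : δ n (n + 1) v = 0 :=
      ofHom_comp_cochain_injective (cokernel.π α) I _ _ (by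
        rw [← δ_ofHom_comp, Cochain.comp_zero]; exact hx)
    obtain ⟨γ, hγ⟩ := IsKInjective.exists_δ_eq hac v hv m hm
    refine ⟨(Cochain.ofHom (cokernel.π α)).comp γ (zero_add m), ?_, ?_⟩
    · rw [δ_ofHom_comp, hγ]
    · rw [← Cochain.comp_assoc_of_first_is_zero_cochain, ← Cochain.ofHom_comp]
      simp
  refine ⟨hsurj, quasiIso_of_lift_cocycles _ hsurj ?_ ?_⟩
  · have key (n : ℤ) (y : Cochain M I n) (hy : δ n (n + 1) y = 0) :
        ∃ x : Cochain N I n, δ n (n + 1) x = 0 ∧ (Cochain.ofHom α).comp x (zero_add n) = y := by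
      obtain ⟨x, hx⟩ := hsurj n y
      obtain ⟨w, hw, hw'⟩ := hker (n + 1) (δ n (n + 1) x) (by rw [δ_δ])
        (by rw [← δ_ofHom_comp, hx, hy]) n rfl
      exact ⟨x - w, by rw [δ_sub, hw, sub_self], by rw [Cochain.comp_sub, hx, hw', sub_zero]⟩
    exact key
  · intro n x hx hx'
    obtain ⟨w, hw, -⟩ := hker n x hx hx' (n - 1) (by simp)
    exact ⟨w, hw⟩

lemma quasiIso_zero_of_acyclic {K L : CochainComplex (ModuleCat.{u} R) ℤ}
    (f : K ⟶ L) (hK : K.Acyclic) (hL : L.Acyclic) : QuasiIso f := by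
  rw [quasiIso_iff]
  intro n
  rw [quasiIsoAt_iff_isIso_homologyMap]
  have h₁ := (K.exactAt_iff_isZero_homology n).1 (hK n)
  have h₂ := (L.exactAt_iff_isZero_homology n).1 (hL n)
  exact ⟨0, h₁.eq_of_src _ _, h₂.eq_of_src _ _⟩

lemma acyclic_of_isZero {K : CochainComplex (ModuleCat.{u} R) ℤ} (h : IsZero K) : K.Acyclic := by
  intro n
  rw [HomologicalComplex.exactAt_iff_isZero_homology]
  exact (HomologicalComplex.homologyFunctor _ _ n).map_isZero h

lemma acyclic_mappingCone_id (K : CochainComplex (ModuleCat.{u} R) ℤ) :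
    (mappingCone (𝟙 K)).Acyclic := by
  intro n
  rw [HomologicalComplex.exactAt_iff_isZero_homology, IsZero.iff_id_eq_zero,
    ← HomologicalComplex.homologyMap_id,
    (mappingCone.homotopyToZeroOfId K).homologyMap_eq n, HomologicalComplex.homologyMap_zero]

-- The test map is $L\to 0$ for $L$ acyclic. A morphism $f : P\to L$ is a cocycle of degree zero in
-- $\mathrm{Hom}(P,L)$ whose class dies in $\mathrm{Hom}(P,0)$; a primitive of it is a
-- null-homotopy.
open scoped ZeroObject in
lemma IsSemiProjective.isKProjective {P : CochainComplex (ModuleCat.{u} R) ℤ}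
    (hP : IsSemiProjective P) : P.IsKProjective where
  nonempty_homotopy_zero {L} f hL := by
    have hz := isZero_zero (CochainComplex (ModuleCat.{u} R) ℤ)
    have h := hP (0 : L ⟶ 0) (fun n y => ⟨0, by
      have : Subsingleton ((0 : CochainComplex (ModuleCat.{u} R) ℤ).X n) :=
        ModuleCat.subsingleton_of_isZero
          ((HomologicalComplex.eval (ModuleCat.{u} R) (.up ℤ) n).map_isZero hz)
      exact Subsingleton.elim _ _⟩) (quasiIso_zero_of_acyclic _ hL (acyclic_of_isZero hz))
    have hq := h.2
    rw [quasiIso_iff] at hq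
    have hq' := hq 0
    rw [quasiIsoAt_iff_isIso_homologyMap, ConcreteCategory.isIso_iff_bijective] at hq'
    have h₀ : abHomologyClass (HomComplex P L) 0 ⟨Cochain.ofHom f, δ_ofHom f⟩ = 0 := by
      apply hq'.1
      rw [map_zero, homologyMap_abHomologyClass (homComplexPostcomp P (0 : L ⟶ 0)) 0
        ⟨Cochain.ofHom f, δ_ofHom f⟩ 0, map_zero]
      change (Cochain.ofHom f).comp (Cochain.ofHom 0) (add_zero 0) = 0
      rw [Cochain.ofHom_zero, Cochain.comp_zero]
    rw [abHomologyClass_eq_zero_iff] at h₀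
    obtain ⟨w, hw⟩ := h₀
    refine ⟨(Cochain.equivHomotopy f 0).symm ⟨w, ?_⟩⟩
    rw [Cochain.ofHom_zero, add_zero]
    exact hw.symm

open scoped ZeroObject in
lemma IsSemiInjective.isKInjective {I : CochainComplex (ModuleCat.{u} R) ℤ}
    (hI : IsSemiInjective I) : I.IsKInjective where
  nonempty_homotopy_zero {L} f hL := by
    have hz := isZero_zero (CochainComplex (ModuleCat.{u} R) ℤ)
    have h := hI (0 : 0 ⟶ L) (fun n => by
      have : Subsingleton ((0 : CochainComplex (ModuleCat.{u} R) ℤ).X n) :=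
        ModuleCat.subsingleton_of_isZero
          ((HomologicalComplex.eval (ModuleCat.{u} R) (.up ℤ) n).map_isZero hz)
      exact fun x y _ => Subsingleton.elim x y)
      (quasiIso_zero_of_acyclic _ (acyclic_of_isZero hz) hL)
    have hq := h.2
    rw [quasiIso_iff] at hq
    have hq' := hq 0
    rw [quasiIsoAt_iff_isIso_homologyMap, ConcreteCategory.isIso_iff_bijective] at hq'
    have h₀ : abHomologyClass (HomComplex L I) 0 ⟨Cochain.ofHom f, δ_ofHom f⟩ = 0 := by
      apply hq'.1
      rw [map_zero, homologyMap_abHomologyClass (homComplexPrecomp (0 : 0 ⟶ L) I) 0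
        ⟨Cochain.ofHom f, δ_ofHom f⟩ 0, map_zero]
      change (Cochain.ofHom 0).comp (Cochain.ofHom f) (zero_add 0) = 0
      rw [Cochain.ofHom_zero, Cochain.zero_comp]
    rw [abHomologyClass_eq_zero_iff] at h₀
    obtain ⟨w, hw⟩ := h₀
    refine ⟨(Cochain.equivHomotopy f 0).symm ⟨w, ?_⟩⟩
    rw [Cochain.ofHom_zero, add_zero]
    exact hw.symm

/-- The morphism induced by `f` on cones of identities. -/
noncomputable def coneIdMap {K L : CochainComplex (ModuleCat.{u} R) ℤ} (f : K ⟶ L) :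
    mappingCone (𝟙 K) ⟶ mappingCone (𝟙 L) :=
  mappingCone.map (𝟙 K) (𝟙 L) f f (by simp)

instance {K L : CochainComplex (ModuleCat.{u} R) ℤ} (f : K ⟶ L) [∀ i, Epi (f.f i)] (i : ℤ) :
    Epi ((coneIdMap f).f i) where
  left_cancellation u v huv := by
    have h₁ := (mappingCone.inl (𝟙 K)).v (i + 1) i (by lia) ≫= huv
    have h₂ := (mappingCone.inr (𝟙 K)).f i ≫= huv
    rw [mappingCone.ext_from_iff _ (i + 1) i rfl]
    simpa [coneIdMap, mappingCone.map, cancel_epi] using And.intro h₁ h₂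

lemma coneIdMap_f_fst_v {K L : CochainComplex (ModuleCat.{u} R) ℤ} (f : K ⟶ L) (i j : ℤ)
    (h : i + 1 = j) : (coneIdMap f).f i ≫ (mappingCone.fst (𝟙 L)).1.v i j h =
      (mappingCone.fst (𝟙 K)).1.v i j h ≫ f.f j := by
  simp [mappingCone.ext_from_iff _ j i h, coneIdMap, mappingCone.map]

lemma coneIdMap_f_snd_v {K L : CochainComplex (ModuleCat.{u} R) ℤ} (f : K ⟶ L) (i : ℤ) :
    (coneIdMap f).f i ≫ (mappingCone.snd (𝟙 L)).v i i (add_zero i) =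
      (mappingCone.snd (𝟙 K)).v i i (add_zero i) ≫ f.f i := by
  simp [mappingCone.ext_from_iff _ (i + 1) i rfl, coneIdMap, mappingCone.map]

lemma inr_f_coneIdMap_f {K L : CochainComplex (ModuleCat.{u} R) ℤ} (f : K ⟶ L) (i : ℤ) :
    (mappingCone.inr (𝟙 K)).f i ≫ (coneIdMap f).f i = f.f i ≫ (mappingCone.inr (𝟙 L)).f i := by
  simp [coneIdMap, mappingCone.map]

instance {K L : CochainComplex (ModuleCat.{u} R) ℤ} (f : K ⟶ L) [∀ i, Mono (f.f i)] (i : ℤ) :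
    Mono ((coneIdMap f).f i) where
  right_cancellation u v huv := by
    have h₁ := huv =≫ (mappingCone.fst (𝟙 L)).1.v i (i + 1) rfl
    have h₂ := huv =≫ (mappingCone.snd (𝟙 L)).v i i (add_zero i)
    rw [mappingCone.ext_to_iff _ i (i + 1) rfl]
    simp only [Category.assoc, coneIdMap_f_fst_v, coneIdMap_f_snd_v] at h₁ h₂
    simp only [← Category.assoc, cancel_mono] at h₁ h₂
    exact ⟨h₁, h₂⟩

/-- The test map goes between the cones of the identities of $E$ and $X$, placed in degree $n$. Both
cones are contractible, so it is a surjective quasi-isomorphism. Only surjectivity on cochains of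
degree zero is used, so the map to be lifted need not commute with differentials. -/
lemma IsSemiProjective.projective {P : CochainComplex (ModuleCat.{u} R) ℤ}
    (hP : IsSemiProjective P) (n : ℤ) : Projective (P.X n) where
  factors {E X} g e _ := by
    let F := HomologicalComplex.single (ModuleCat.{u} R) (.up ℤ) n
    have (i : ℤ) : Epi ((F.map e).f i) := inferInstance
    have h := hP (coneIdMap (F.map e)) (fun i => (ModuleCat.epi_iff_surjective _).1 inferInstance)
      (quasiIso_zero_of_acyclic _ (acyclic_mappingCone_id _) (acyclic_mappingCone_id _))
    obtain ⟨x, hx⟩ : ∃ x : Cochain P (mappingCone (𝟙 (F.obj E))) 0,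
      x.comp (Cochain.ofHom (coneIdMap (F.map e))) (add_zero 0) =
        (Cochain.single (g ≫ (HomologicalComplex.singleObjXSelf (.up ℤ) n X).inv) 0).comp
          (Cochain.ofHom (mappingCone.inr (𝟙 (F.obj X)))) (add_zero 0) := h.1 0 _
    have hx' := Cochain.congr_v hx n n (add_zero n) =≫ (mappingCone.snd _).v n n (add_zero n)
    simp only [Cochain.comp_zero_cochain_v, Cochain.ofHom_v, Category.assoc, coneIdMap_f_snd_v,
      mappingCone.inr_f_snd_v, Category.comp_id, Cochain.single_v] at hx'
    refine ⟨x.v n n (add_zero n) ≫ (mappingCone.snd _).v n n (add_zero n) ≫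
      (HomologicalComplex.singleObjXSelf (.up ℤ) n E).hom, ?_⟩
    rw [HomologicalComplex.single_map_f_self] at hx'
    rw [← cancel_mono (HomologicalComplex.singleObjXSelf (.up ℤ) n X).inv]
    simpa only [Category.assoc] using hx'

lemma IsSemiInjective.injective {I : CochainComplex (ModuleCat.{u} R) ℤ}
    (hI : IsSemiInjective I) (n : ℤ) : Injective (I.X n) where
  factors {X Y} g m _ := by
    let F := HomologicalComplex.single (ModuleCat.{u} R) (.up ℤ) n
    have (i : ℤ) : Mono ((F.map m).f i) := inferInstance
    have h := hI (coneIdMap (F.map m)) (fun i => (ModuleCat.mono_iff_injective _).1 inferInstance)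
      (quasiIso_zero_of_acyclic _ (acyclic_mappingCone_id _) (acyclic_mappingCone_id _))
    obtain ⟨x, hx⟩ : ∃ x : Cochain (mappingCone (𝟙 (F.obj Y))) I 0,
      (Cochain.ofHom (coneIdMap (F.map m))).comp x (zero_add 0) =
        (mappingCone.snd (𝟙 (F.obj X))).comp
          (Cochain.single ((HomologicalComplex.singleObjXSelf (.up ℤ) n X).hom ≫ g) 0)
          (zero_add 0) := h.1 0 _
    have hx' := (mappingCone.inr _).f n ≫= Cochain.congr_v hx n n (add_zero n)
    simp only [Cochain.zero_cochain_comp_v, Cochain.ofHom_v,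
      mappingCone.inr_f_snd_v_assoc, Cochain.single_v] at hx'
    rw [← Category.assoc, inr_f_coneIdMap_f, Category.assoc] at hx'
    refine ⟨(HomologicalComplex.singleObjXSelf (.up ℤ) n Y).inv ≫
      (mappingCone.inr _).f n ≫ x.v n n (add_zero n), ?_⟩
    rw [HomologicalComplex.single_map_f_self] at hx'
    rw [← cancel_epi (HomologicalComplex.singleObjXSelf (.up ℤ) n X).hom]
    simpa only [Category.assoc] using hx'

end SemiProjective

/-! ### Vanishing of $\mathrm{Ext}^1$ and closure properties of cotorsion pairs. -/

section ExtOne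

variable {R : Type u} [Ring R]

open Abelian

lemma exists_extension_of_subsingleton_ext {S : ShortComplex (ModuleCat.{u} R)} (hS : S.ShortExact)
    {N : ModuleCat.{u} R} (h : Subsingleton (Ext S.X₃ N 1)) (g : S.X₁ ⟶ N) :
    ∃ g' : S.X₂ ⟶ N, S.f ≫ g' = g := by
  obtain ⟨x, hx⟩ := Ext.contravariant_sequence_exact₁ hS N (Ext.mk₀ g) (add_zero 1)
    (Subsingleton.elim _ _)
  obtain ⟨g', rfl⟩ := (Ext.mk₀_bijective _ _).2 x
  exact ⟨g', (Ext.mk₀_bijective _ _).1 (by rw [← hx, Ext.mk₀_comp_mk₀])⟩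

lemma exists_lift_of_subsingleton_ext {S : ShortComplex (ModuleCat.{u} R)} (hS : S.ShortExact)
    {M : ModuleCat.{u} R} (h : Subsingleton (Ext M S.X₁ 1)) (g : M ⟶ S.X₃) :
    ∃ g' : M ⟶ S.X₂, g' ≫ S.g = g := by
  obtain ⟨x, hx⟩ := Ext.covariant_sequence_exact₃ M hS (Ext.mk₀ g) (zero_add 1)
    (Subsingleton.elim _ _)
  obtain ⟨g', rfl⟩ := (Ext.mk₀_bijective _ _).2 x
  exact ⟨g', (Ext.mk₀_bijective _ _).1 (by rw [← hx, Ext.mk₀_comp_mk₀])⟩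

/-- Since $\mathrm{Ext}^1(X_2,N)=0$, every class is the connecting image of a map $X_1\to N$, and
maps that extend to $X_2$ have zero image. -/
lemma subsingleton_ext_of_exists_extension {S : ShortComplex (ModuleCat.{u} R)} (hS : S.ShortExact)
    [Projective S.X₂] {N : ModuleCat.{u} R}
    (h : ∀ g : S.X₁ ⟶ N, ∃ g' : S.X₂ ⟶ N, S.f ≫ g' = g) : Subsingleton (Ext S.X₃ N 1) := by
  refine subsingleton_of_forall_eq 0 fun x => ?_
  obtain ⟨y, rfl⟩ := Ext.contravariant_sequence_exact₃ hS N x (Ext.eq_zero_of_projective _)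
    (add_zero 1)
  obtain ⟨g, rfl⟩ := (Ext.mk₀_bijective _ _).2 y
  obtain ⟨g', rfl⟩ := h g
  rw [← Ext.mk₀_comp_mk₀, ShortComplex.ShortExact.extClass_comp_assoc]

lemma subsingleton_ext_of_exists_lift {S : ShortComplex (ModuleCat.{u} R)} (hS : S.ShortExact)
    [Injective S.X₂] {M : ModuleCat.{u} R}
    (h : ∀ g : M ⟶ S.X₃, ∃ g' : M ⟶ S.X₂, g' ≫ S.g = g) : Subsingleton (Ext M S.X₁ 1) := by
  refine subsingleton_of_forall_eq 0 fun x => ?_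
  obtain ⟨y, rfl⟩ := Ext.covariant_sequence_exact₁ M hS x (Ext.eq_zero_of_injective _)
    (zero_add 1)
  obtain ⟨g, rfl⟩ := (Ext.mk₀_bijective _ _).2 y
  obtain ⟨g', rfl⟩ := h g
  rw [← Ext.mk₀_comp_mk₀, Ext.comp_assoc (a₁₂ := 0) (a₂₃ := 1) (h₁₂ := rfl) (h₂₃ := rfl) (h := rfl),
    hS.comp_extClass, Ext.comp_zero]

lemma leftPerp_of_retract (B : ObjectProperty (ModuleCat.{u} R)) {X Y : ModuleCat.{u} R}
    (r : Retract X Y) (hY : leftPerp B Y) : leftPerp B X := fun M hM => by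
  have := hY M hM
  refine subsingleton_of_forall_eq 0 fun x => ?_
  rw [← Ext.mk₀_id_comp x, ← r.retract, ← Ext.mk₀_comp_mk₀_assoc,
    Subsingleton.elim ((Ext.mk₀ r.r).comp x (zero_add 1)) 0, Ext.comp_zero]

lemma rightPerp_of_retract (A : ObjectProperty (ModuleCat.{u} R)) {X Y : ModuleCat.{u} R}
    (r : Retract X Y) (hY : rightPerp A Y) : rightPerp A X := fun M hM => by
  have := hY M hM
  refine subsingleton_of_forall_eq 0 fun x => ?_
  rw [← Ext.comp_mk₀_id x, ← r.retract, ← Ext.mk₀_comp_mk₀,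
    ← Ext.comp_assoc (a₁₂ := 1) (a₂₃ := 0) (h₁₂ := rfl) (h₂₃ := rfl) (h := rfl),
    Subsingleton.elim (x.comp (Ext.mk₀ r.i) (add_zero 1)) 0, Ext.zero_comp]

lemma leftPerp_of_shortExact (B : ObjectProperty (ModuleCat.{u} R))
    {S : ShortComplex (ModuleCat.{u} R)} (hS : S.ShortExact) (h₁ : leftPerp B S.X₁)
    (h₃ : leftPerp B S.X₃) : leftPerp B S.X₂ := fun M hM => by
  have := h₁ M hM
  have := h₃ M hM
  refine subsingleton_of_forall_eq 0 fun x => ?_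
  obtain ⟨y, rfl⟩ := Ext.contravariant_sequence_exact₂ hS M x (Subsingleton.elim _ _)
  rw [Subsingleton.elim y 0, Ext.comp_zero]

/-- The exact sequence attached to a surjective linear map. -/
lemma shortExact_kernel {X Y : ModuleCat.{u} R} (f : X ⟶ Y) [Epi f] :
    (ShortComplex.mk (kernel.ι f) f (kernel.condition f)).ShortExact :=
  { exact := ShortComplex.exact_of_f_is_kernel _ (kernelIsKernel f) }

lemma shortExact_cokernel {X Y : ModuleCat.{u} R} (f : X ⟶ Y) [Mono f] :
    (ShortComplex.mk f (cokernel.π f) (cokernel.condition f)).ShortExact :=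
  { exact := ShortComplex.exact_of_g_is_cokernel _ (cokernelIsCokernel f) }

lemma subsingleton_ext_of_iso {X X' Y : ModuleCat.{u} R} (e : X ≅ X')
    (h : Subsingleton (Abelian.Ext X Y 1)) : Subsingleton (Abelian.Ext X' Y 1) :=
  leftPerp_of_retract (fun N => N = Y) e.symm.retract (by rintro _ rfl; exact h) Y rfl

end ExtOne

namespace IsCompleteHereditaryCotorsionPair

variable {R : Type u} [Ring R] {A B : ObjectProperty (ModuleCat.{u} R)}

lemma subsingleton_ext (h : IsCompleteHereditaryCotorsionPair A B)
    {X Y : ModuleCat.{u} R} (hX : A X) (hY : B Y) :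
    Subsingleton (Abelian.Ext X Y 1) := by
  rw [← h.rightPerp_eq] at hY
  exact hY X hX

lemma left_of_iso (h : IsCompleteHereditaryCotorsionPair A B)
    {X Y : ModuleCat.{u} R} (e : X ≅ Y) (hX : A X) : A Y := by
  rw [← h.leftPerp_eq] at hX ⊢
  exact leftPerp_of_retract B e.symm.retract hX

lemma right_of_iso (h : IsCompleteHereditaryCotorsionPair A B)
    {X Y : ModuleCat.{u} R} (e : X ≅ Y) (hX : B X) : B Y := by
  rw [← h.rightPerp_eq] at hX ⊢
  exact rightPerp_of_retract A e.symm.retract hX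

lemma left_of_projective (h : IsCompleteHereditaryCotorsionPair A B)
    (X : ModuleCat.{u} R) [Projective X] : A X := by
  rw [← h.leftPerp_eq]
  exact fun M _ => Abelian.Ext.subsingleton_of_projective _ _ _

lemma right_of_injective (h : IsCompleteHereditaryCotorsionPair A B)
    (X : ModuleCat.{u} R) [Injective X] : B X := by
  rw [← h.rightPerp_eq]
  exact fun M _ => Abelian.Ext.subsingleton_of_injective _ _ _

lemma left_of_shortExact (h : IsCompleteHereditaryCotorsionPair A B)
    {S : ShortComplex (ModuleCat.{u} R)} (hS : S.ShortExact)
    (h₁ : A S.X₁) (h₃ : A S.X₃) : A S.X₂ := by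
  rw [← h.leftPerp_eq] at h₁ h₃ ⊢
  exact leftPerp_of_shortExact B hS h₁ h₃

end IsCompleteHereditaryCotorsionPair

/-! ### Complexes with zero differential. -/

section Lifting

variable {R : Type u} [Ring R]

lemma exists_lift_of_projective {P X Y : ModuleCat.{u} R} [Projective P] (f : P ⟶ Y) (g : X ⟶ Y)
    (h : ∀ p : P, ∃ x : X, g x = f p) : ∃ k : P ⟶ X, k ≫ g = f := by
  have hepi : Epi (ModuleCat.ofHom g.hom.rangeRestrict) :=
    (ModuleCat.epi_iff_surjective _).2 g.hom.surjective_rangeRestrict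
  refine ⟨Projective.factorThru (ModuleCat.ofHom (f.hom.codRestrict (LinearMap.range g.hom) h))
    (ModuleCat.ofHom g.hom.rangeRestrict), ?_⟩
  have := Projective.factorThru_comp (ModuleCat.ofHom
    (f.hom.codRestrict (LinearMap.range g.hom) h)) (ModuleCat.ofHom g.hom.rangeRestrict)
  exact congr($this ≫ ModuleCat.ofHom (LinearMap.range g.hom).subtype)

lemma exists_extension_of_injective {I X Y : ModuleCat.{u} R} [Injective I] (f : X ⟶ I)
    (g : X ⟶ Y) (h : ∀ x : X, g x = 0 → f x = 0) : ∃ k : Y ⟶ I, g ≫ k = f := by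
  let S := ShortComplex.mk (kernel.ι g) g (kernel.condition g)
  have hS : S.Exact := ShortComplex.exact_of_f_is_kernel _ (kernelIsKernel g)
  have h0 : S.f ≫ f = 0 := by
    ext x
    exact h _ congr($(kernel.condition g) x)
  exact ⟨hS.descToInjective f h0, hS.comp_descToInjective f h0⟩

end Lifting

section ZeroDifferential

open CochainComplex HomComplex

variable {R : Type u} [Ring R]

/-- All of $K$ consists of cocycles, so vanishing on homology says that $f$ takes values in
coboundaries. Projectivity lifts it through the differential of $L$, and this lift is the homotopy.
-/
lemma nonempty_homotopy_of_projective {K L : CochainComplex (ModuleCat.{u} R) ℤ}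
    (hd : ∀ i j, K.d i j = 0) [∀ n, Projective (K.X n)] (f : K ⟶ L)
    (hf : ∀ s, HomologicalComplex.homologyMap f s = 0) : Nonempty (Homotopy f 0) := by
  have (p q : ℤ) (hpq : p + (-1) = q) : ∃ k : K.X p ⟶ L.X q, k ≫ L.d q p = f.f p := by
    obtain rfl : q = p - 1 := by lia
    refine exists_lift_of_projective _ _ fun x => ?_
    have hx : x ∈ LinearMap.ker (K.d p (p + 1)).hom := by simp [hd]
    have := congr($(hf p) (homologyClass K p ⟨x, hx⟩))
    rw [homologyMap_homologyClass] at this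
    exact (homologyClass_eq_zero_iff _ _ _).1 this
  choose k hk using this
  refine ⟨(Cochain.equivHomotopy f 0).symm ⟨Cochain.mk k, ?_⟩⟩
  ext p
  simp [δ_v (-1) 0 (by simp) _ p p (add_zero p) (p - 1) (p + 1) rfl rfl, hd, hk]

/-- The target has no nonzero coboundaries, so vanishing on homology says that $f$ kills cocycles.
It then extends along the differential of $K$ into an injective module. -/
lemma nonempty_homotopy_of_injective {K L : CochainComplex (ModuleCat.{u} R) ℤ}
    (hd : ∀ i j, L.d i j = 0) [∀ n, Injective (L.X n)] (f : K ⟶ L)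
    (hf : ∀ s, HomologicalComplex.homologyMap f s = 0) : Nonempty (Homotopy f 0) := by
  have (p q : ℤ) (hpq : p + (-1) = q) : ∃ k : K.X p ⟶ L.X q, K.d q p ≫ k = f.f q := by
    obtain rfl : p = q + 1 := by lia
    refine exists_extension_of_injective _ _ fun x hx => ?_
    have := congr($(hf q) (homologyClass K q ⟨x, hx⟩))
    rw [homologyMap_homologyClass] at this
    obtain ⟨w, hw⟩ := (homologyClass_eq_zero_iff _ _ _).1 this
    rw [hd] at hw
    exact hw.symm
  choose k hk using this
  refine ⟨(Cochain.equivHomotopy f 0).symm ⟨Cochain.mk k, ?_⟩⟩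
  ext p
  simp [δ_v (-1) 0 (by simp) _ p p (add_zero p) (p - 1) (p + 1) rfl rfl, hd, hk]

lemma homologyMap_eq_zero_of_acyclic_left {K L : CochainComplex (ModuleCat.{u} R) ℤ}
    (hK : K.Acyclic) (f : K ⟶ L) (s : ℤ) : HomologicalComplex.homologyMap f s = 0 :=
  ((K.exactAt_iff_isZero_homology s).1 (hK s)).eq_of_src _ _

lemma homologyMap_eq_zero_of_acyclic_right {K L : CochainComplex (ModuleCat.{u} R) ℤ}
    (hL : L.Acyclic) (f : K ⟶ L) (s : ℤ) : HomologicalComplex.homologyMap f s = 0 :=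
  ((L.exactAt_iff_isZero_homology s).1 (hL s)).eq_of_tgt _ _

lemma isKProjective_of_d_eq_zero {K : CochainComplex (ModuleCat.{u} R) ℤ}
    (hd : ∀ i j, K.d i j = 0) [∀ n, Projective (K.X n)] : K.IsKProjective where
  nonempty_homotopy_zero f hL :=
    nonempty_homotopy_of_projective hd f (homologyMap_eq_zero_of_acyclic_right hL f)

lemma isKInjective_of_d_eq_zero {K : CochainComplex (ModuleCat.{u} R) ℤ}
    (hd : ∀ i j, K.d i j = 0) [∀ n, Injective (K.X n)] : K.IsKInjective where
  nonempty_homotopy_zero f hL :=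
    nonempty_homotopy_of_injective hd f (homologyMap_eq_zero_of_acyclic_left hL f)

lemma homologyClass_bijective_of_d_eq_zero {K : CochainComplex (ModuleCat.{u} R) ℤ}
    (hd : ∀ i j, K.d i j = 0) (s : ℤ) : Function.Bijective (homologyClass K s) := by
  refine ⟨?_, homologyClass_surjective K s⟩
  rw [injective_iff_map_eq_zero]
  intro z hz
  obtain ⟨w, hw⟩ := (homologyClass_eq_zero_iff _ _ _).1 hz
  rw [hd] at hw
  exact Subtype.ext hw.symm

/-- For a complex with zero differential, the degree `s` part is the homology. -/
noncomputable def homologyIsoOfDEqZero {K : CochainComplex (ModuleCat.{u} R) ℤ}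
    (hd : ∀ i j, K.d i j = 0) (s : ℤ) : K.X s ≅ K.homology s :=
  ((LinearEquiv.ofTop _ (by simp [hd])).symm.trans
    (LinearEquiv.ofBijective _ (homologyClass_bijective_of_d_eq_zero hd s))).toModuleIso

lemma homologyIsoOfDEqZero_hom_apply {K : CochainComplex (ModuleCat.{u} R) ℤ}
    (hd : ∀ i j, K.d i j = 0) (s : ℤ) (x : K.X s) :
    (homologyIsoOfDEqZero hd s).hom x = homologyClass K s ⟨x, by simp [hd]⟩ := rfl

/-- Homology classes of $L$ are lifted to cocycles by projectivity; with zero differential in the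
source, any family of maps into cocycles is a morphism of complexes. -/
lemma exists_homologyMap_eq_of_projective {K L : CochainComplex (ModuleCat.{u} R) ℤ}
    (hd : ∀ i j, K.d i j = 0) [∀ n, Projective (K.X n)]
    (φ : ∀ s, K.homology s ⟶ L.homology s) :
    ∃ f : K ⟶ L, ∀ s, HomologicalComplex.homologyMap f s = φ s := by
  have (s : ℤ) : ∃ k : K.X s ⟶ ModuleCat.of R (LinearMap.ker (L.d s (s + 1)).hom),
      k ≫ ModuleCat.ofHom (homologyClass L s) = (homologyIsoOfDEqZero hd s).hom ≫ φ s :=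
    exists_lift_of_projective _ _ fun x => homologyClass_surjective L s _
  choose k hk using this
  have hkd (i : ℤ) (x : K.X i) : L.d i (i + 1) (k i x).1 = 0 := (k i x).2
  let f : K ⟶ L :=
    { f := fun s => k s ≫ ModuleCat.ofHom (LinearMap.ker (L.d s (s + 1)).hom).subtype
      comm' := by
        rintro i _ rfl
        rw [hd, zero_comp]
        ext x
        exact hkd i x }
  refine ⟨f, fun s => ?_⟩
  rw [← cancel_epi (homologyIsoOfDEqZero hd s).hom, ← hk]
  ext x
  change HomologicalComplex.homologyMap f s ((homologyIsoOfDEqZero hd s).hom x) =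
    homologyClass L s (k s x)
  rw [homologyIsoOfDEqZero_hom_apply, homologyMap_homologyClass]
  rfl

lemma exists_homologyMap_eq_of_injective {K L : CochainComplex (ModuleCat.{u} R) ℤ}
    (hd : ∀ i j, L.d i j = 0) [∀ n, Injective (L.X n)]
    (φ : ∀ s, K.homology s ⟶ L.homology s) :
    ∃ f : K ⟶ L, ∀ s, HomologicalComplex.homologyMap f s = φ s := by
  have (s : ℤ) : ∃ k : K.X s ⟶ L.X s,
      ModuleCat.ofHom (LinearMap.ker (K.d s (s + 1)).hom).subtype ≫ k =
        ModuleCat.ofHom (homologyClass K s) ≫ φ s ≫ (homologyIsoOfDEqZero hd s).inv := by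
    refine exists_extension_of_injective _ _ fun x hx => ?_
    obtain rfl : x = 0 := Subtype.ext hx
    simp
  choose k hk using this
  have hk' (s : ℤ) (x : K.X s) (hx : K.d s (s + 1) x = 0) :
      k s x = (homologyIsoOfDEqZero hd s).inv (φ s (homologyClass K s ⟨x, hx⟩)) :=
    congr($(hk s) ⟨x, hx⟩)
  let f : K ⟶ L :=
    { f := k
      comm' := by
        rintro i j hij
        obtain rfl : i = j - 1 := by simp at hij; lia
        rw [hd, comp_zero]
        ext x
        have hx : K.d j (j + 1) (K.d (j - 1) j x) = 0 := congr($(K.d_comp_d (j - 1) j (j + 1)) x)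
        change 0 = k j (K.d (j - 1) j x)
        rw [hk' _ _ hx, (homologyClass_eq_zero_iff _ _ _).2 ⟨x, rfl⟩]
        simp }
  refine ⟨f, fun s => ?_⟩
  ext y
  obtain ⟨⟨x, hx⟩, rfl⟩ := homologyClass_surjective K s y
  rw [homologyMap_homologyClass]
  change (homologyIsoOfDEqZero hd s).hom (k s x) = _
  rw [hk' s x hx]
  simp

/-- The complex with zero differential attached to a graded module. -/
def zeroDifferentialComplex (F : ℤ → ModuleCat.{u} R) : CochainComplex (ModuleCat.{u} R) ℤ where
  X := F
  d _ _ := 0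

end ZeroDifferential

/-! ### Objects of $\mathrm{D}(R)$ for which morphisms are determined by homology. -/

section HomologyOfQ

open DerivedCategory

variable {C : Type*} [Category* C] [Abelian C] [HasDerivedCategory.{w} C]

lemma exists_Q_map_eq_of_isKProjective (K L : CochainComplex C ℤ) [K.IsKProjective]
    (g : Q.obj K ⟶ Q.obj L) : ∃ f : K ⟶ L, Q.map f = g := by
  obtain ⟨f, hf⟩ := (CochainComplex.IsKProjective.Qh_map_bijective K
    ((HomotopyCategory.quotient _ _).obj L)).2
    ((quotientCompQhIso C).hom.app K ≫ g ≫ (quotientCompQhIso C).inv.app L)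
  obtain ⟨f, rfl⟩ := (HomotopyCategory.quotient _ _).map_surjective f
  refine ⟨f, ?_⟩
  have := (quotientCompQhIso C).hom.naturality f
  rw [← cancel_epi ((quotientCompQhIso C).hom.app K), ← this, Functor.comp_map, hf]
  simp

lemma exists_Q_map_eq_of_isKInjective (K L : CochainComplex C ℤ) [L.IsKInjective]
    (g : Q.obj K ⟶ Q.obj L) : ∃ f : K ⟶ L, Q.map f = g := by
  obtain ⟨f, hf⟩ := (CochainComplex.IsKInjective.Qh_map_bijective
    ((HomotopyCategory.quotient _ _).obj K) L).2
    ((quotientCompQhIso C).hom.app K ≫ g ≫ (quotientCompQhIso C).inv.app L)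
  obtain ⟨f, rfl⟩ := (HomotopyCategory.quotient _ _).map_surjective f
  refine ⟨f, ?_⟩
  have := (quotientCompQhIso C).hom.naturality f
  rw [← cancel_epi ((quotientCompQhIso C).hom.app K), ← this, Functor.comp_map, hf]
  simp

lemma Q_map_eq_zero_of_homotopy {K L : CochainComplex C ℤ} {f : K ⟶ L} (h : Homotopy f 0) :
    Q.map f = 0 := by
  have := (quotientCompQhIso C).hom.naturality f
  rw [← cancel_epi ((quotientCompQhIso C).hom.app K), ← this, Functor.comp_map,
    HomotopyCategory.eq_of_homotopy f 0 h]
  simp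

lemma Qh_map_eq_zero_of_Q_map_eq_zero {K L : CochainComplex C ℤ} (f : K ⟶ L) (hf : Q.map f = 0) :
    Qh.map ((HomotopyCategory.quotient _ _).map f) = 0 := by
  have := (quotientCompQhIso C).hom.naturality f
  rwa [hf, comp_zero, Functor.comp_map,
    Preadditive.IsIso.comp_right_eq_zero] at this

lemma nonempty_homotopy_of_isKProjective {K L : CochainComplex C ℤ} [K.IsKProjective]
    (f : K ⟶ L) (hf : Q.map f = 0) : Nonempty (Homotopy f 0) :=
  ⟨HomotopyCategory.homotopyOfEq _ _ ((CochainComplex.IsKProjective.Qh_map_bijective K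
    ((HomotopyCategory.quotient _ _).obj L)).1 (by
      rw [Qh_map_eq_zero_of_Q_map_eq_zero f hf, Functor.map_zero, Functor.map_zero]))⟩

lemma nonempty_homotopy_of_isKInjective {K L : CochainComplex C ℤ} [L.IsKInjective]
    (f : K ⟶ L) (hf : Q.map f = 0) : Nonempty (Homotopy f 0) :=
  ⟨HomotopyCategory.homotopyOfEq _ _ ((CochainComplex.IsKInjective.Qh_map_bijective
    ((HomotopyCategory.quotient _ _).obj K) L).1 (by
      rw [Qh_map_eq_zero_of_Q_map_eq_zero f hf, Functor.map_zero, Functor.map_zero]))⟩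

/-- The homology of `Q.obj K` is the homology of `K`. -/
noncomputable def homologyQIso (K : CochainComplex C ℤ) (s : ℤ) :
    (homologyFunctor C s).obj (Q.obj K) ≅ K.homology s :=
  (homologyFunctorFactors C s).app K

lemma homologyFunctor_map_Q_map {K L : CochainComplex C ℤ} (f : K ⟶ L) (s : ℤ) :
    (homologyFunctor C s).map (Q.map f) =
      (homologyQIso K s).hom ≫ HomologicalComplex.homologyMap f s ≫ (homologyQIso L s).inv := by
  rw [← Category.assoc, Iso.eq_comp_inv]
  exact homologyFunctorFactors_hom_naturality f s

end HomologyOfQ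

section HomologyFree

open DerivedCategory

variable {R : Type u} [Ring R] [HasDerivedCategory.{w} (ModuleCat.{u} R)]

/-- An object of `D(R)` with projective homology, such that morphisms from it are the same as
morphisms from its homology. -/
structure IsHomologyFree (P : DerivedCategory (ModuleCat.{u} R)) : Prop where
  projective (s : ℤ) : Projective ((homologyFunctor (ModuleCat.{u} R) s).obj P)
  eq_zero {Y : DerivedCategory (ModuleCat.{u} R)} (f : P ⟶ Y)
    (hf : ∀ s, (homologyFunctor (ModuleCat.{u} R) s).map f = 0) : f = 0
  exists_map {Y : DerivedCategory (ModuleCat.{u} R)}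
    (φ : ∀ s, (homologyFunctor (ModuleCat.{u} R) s).obj P ⟶
      (homologyFunctor (ModuleCat.{u} R) s).obj Y) :
    ∃ f : P ⟶ Y, ∀ s, (homologyFunctor (ModuleCat.{u} R) s).map f = φ s

/-- An object of `D(R)` with injective homology, such that morphisms to it are the same as
morphisms to its homology. -/
structure IsHomologyCofree (E : DerivedCategory (ModuleCat.{u} R)) : Prop where
  injective (s : ℤ) : Injective ((homologyFunctor (ModuleCat.{u} R) s).obj E)
  eq_zero {X : DerivedCategory (ModuleCat.{u} R)} (f : X ⟶ E)
    (hf : ∀ s, (homologyFunctor (ModuleCat.{u} R) s).map f = 0) : f = 0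
  exists_map {X : DerivedCategory (ModuleCat.{u} R)}
    (φ : ∀ s, (homologyFunctor (ModuleCat.{u} R) s).obj X ⟶
      (homologyFunctor (ModuleCat.{u} R) s).obj E) :
    ∃ f : X ⟶ E, ∀ s, (homologyFunctor (ModuleCat.{u} R) s).map f = φ s

lemma IsHomologyFree.of_retract {P Y : DerivedCategory (ModuleCat.{u} R)} (r : Retract P Y)
    (hY : IsHomologyFree Y) : IsHomologyFree P where
  projective s := by
    have := hY.projective s
    exact (r.map (homologyFunctor (ModuleCat.{u} R) s)).projective
  eq_zero f hf := by
    rw [← Category.id_comp f, ← r.retract, Category.assoc,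
      hY.eq_zero (r.r ≫ f) (fun s => by rw [Functor.map_comp, hf, comp_zero]), comp_zero]
  exists_map {Z} φ := by
    obtain ⟨f, hf⟩ := hY.exists_map (fun s => (homologyFunctor (ModuleCat.{u} R) s).map r.r ≫ φ s)
    refine ⟨r.i ≫ f, fun s => ?_⟩
    rw [Functor.map_comp, hf, ← Category.assoc, ← Functor.map_comp, r.retract,
      CategoryTheory.Functor.map_id,
      Category.id_comp]

lemma isHomologyFree_Q {K : CochainComplex (ModuleCat.{u} R) ℤ} (hd : ∀ i j, K.d i j = 0)
    [∀ n, Projective (K.X n)] : IsHomologyFree (Q.obj K) where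
  projective s := Projective.of_iso (homologyIsoOfDEqZero hd s ≪≫ (homologyQIso K s).symm)
    inferInstance
  eq_zero {Y} f hf := by
    have := isKProjective_of_d_eq_zero hd
    obtain ⟨g, hg⟩ := exists_Q_map_eq_of_isKProjective K (Q.objPreimage Y)
      (f ≫ (Q.objObjPreimageIso Y).inv)
    obtain ⟨h⟩ := nonempty_homotopy_of_projective hd g fun s => by
      have := homologyFunctor_map_Q_map g s
      rw [hg, Functor.map_comp, hf, zero_comp] at this
      simpa using this.symm
    rw [Q_map_eq_zero_of_homotopy h] at hg
    simpa using hg.symm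
  exists_map {Y} φ := by
    obtain ⟨g, hg⟩ := exists_homologyMap_eq_of_projective hd (L := Q.objPreimage Y) fun s =>
      (homologyQIso K s).inv ≫ φ s ≫ (homologyFunctor (ModuleCat.{u} R) s).map
        (Q.objObjPreimageIso Y).inv ≫ (homologyQIso _ s).hom
    refine ⟨Q.map g ≫ (Q.objObjPreimageIso Y).hom, fun s => ?_⟩
    rw [Functor.map_comp, homologyFunctor_map_Q_map, hg]
    simp [← Functor.map_comp]

lemma isHomologyCofree_Q {K : CochainComplex (ModuleCat.{u} R) ℤ} (hd : ∀ i j, K.d i j = 0)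
    [∀ n, Injective (K.X n)] : IsHomologyCofree (Q.obj K) where
  injective s := Injective.of_iso (homologyIsoOfDEqZero hd s ≪≫ (homologyQIso K s).symm)
    inferInstance
  eq_zero {X} f hf := by
    have := isKInjective_of_d_eq_zero hd
    obtain ⟨g, hg⟩ := exists_Q_map_eq_of_isKInjective (Q.objPreimage X) K
      ((Q.objObjPreimageIso X).hom ≫ f)
    obtain ⟨h⟩ := nonempty_homotopy_of_injective hd g fun s => by
      have := homologyFunctor_map_Q_map g s
      rw [hg, Functor.map_comp, hf, comp_zero] at this
      simpa using this.symm
    rw [Q_map_eq_zero_of_homotopy h] at hg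
    simpa using hg.symm
  exists_map {X} φ := by
    obtain ⟨g, hg⟩ := exists_homologyMap_eq_of_injective hd (K := Q.objPreimage X) fun s =>
      (homologyQIso _ s).inv ≫ (homologyFunctor (ModuleCat.{u} R) s).map
        (Q.objObjPreimageIso X).hom ≫ φ s ≫ (homologyQIso K s).hom
    refine ⟨(Q.objObjPreimageIso X).inv ≫ Q.map g, fun s => ?_⟩
    rw [Functor.map_comp, homologyFunctor_map_Q_map, hg]
    simp [← Functor.map_comp_assoc]

/-- Every object of `D(R)` receives a morphism, surjective on homology, from a complex of
projectives with zero differential. -/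
lemma exists_projective_zeroDifferential (X : DerivedCategory (ModuleCat.{u} R)) :
    ∃ (K : CochainComplex (ModuleCat.{u} R) ℤ) (f : Q.obj K ⟶ X), (∀ i j, K.d i j = 0) ∧
      (∀ n, Projective (K.X n)) ∧ ∀ s, Epi ((homologyFunctor (ModuleCat.{u} R) s).map f) := by
  let K := zeroDifferentialComplex fun s =>
    Projective.over ((homologyFunctor (ModuleCat.{u} R) s).obj X)
  have hd : ∀ i j, K.d i j = 0 := fun _ _ => rfl
  have hp (n : ℤ) : Projective (K.X n) := Projective.projective_over _
  obtain ⟨j, hj⟩ : ∃ j : ∀ s, K.X s ⟶ (homologyFunctor (ModuleCat.{u} R) s).obj X,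
      ∀ s, Epi (j s) := ⟨fun s => Projective.π _, fun s => Projective.π_epi _⟩
  obtain ⟨f, hf⟩ := (isHomologyFree_Q hd).exists_map fun s =>
    (homologyQIso K s).hom ≫ (homologyIsoOfDEqZero hd s).inv ≫ j s
  refine ⟨K, f, hd, hp, fun s => ?_⟩
  rw [hf]
  infer_instance

/-- Every object of `D(R)` has a morphism, injective on homology, to a complex of
injectives with zero differential. -/
lemma exists_injective_zeroDifferential (X : DerivedCategory (ModuleCat.{u} R)) :
    ∃ (K : CochainComplex (ModuleCat.{u} R) ℤ) (f : X ⟶ Q.obj K), (∀ i j, K.d i j = 0) ∧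
      (∀ n, Injective (K.X n)) ∧ ∀ s, Mono ((homologyFunctor (ModuleCat.{u} R) s).map f) := by
  let K := zeroDifferentialComplex fun s =>
    Injective.under ((homologyFunctor (ModuleCat.{u} R) s).obj X)
  have hd : ∀ i j, K.d i j = 0 := fun _ _ => rfl
  have hp (n : ℤ) : Injective (K.X n) := Injective.injective_under _
  obtain ⟨j, hj⟩ : ∃ j : ∀ s, (homologyFunctor (ModuleCat.{u} R) s).obj X ⟶ K.X s,
      ∀ s, Mono (j s) := ⟨fun s => Injective.ι _, fun s => Injective.ι_mono _⟩
  obtain ⟨f, hf⟩ := (isHomologyCofree_Q hd).exists_map fun s =>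
    j s ≫ (homologyIsoOfDEqZero hd s).hom ≫ (homologyQIso K s).inv
  refine ⟨K, f, hd, hp, fun s => ?_⟩
  rw [hf]
  infer_instance

lemma isHomologyFree_singleFunctor_shift (M : ModuleCat.{u} R) [Projective M] (n : ℤ) :
    IsHomologyFree (((singleFunctor (ModuleCat.{u} R) 0).obj M)⟦n⟧) := by
  have hp (i : ℤ) :
      Projective (((CochainComplex.singleFunctor (ModuleCat.{u} R) (-n)).obj M).X i) := by
    change Projective (((HomologicalComplex.single (ModuleCat.{u} R) (.up ℤ) (-n)).obj M).X i)
    infer_instance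
  refine IsHomologyFree.of_retract (Iso.retract ?_) (isHomologyFree_Q
    (K := (CochainComplex.singleFunctor (ModuleCat.{u} R) (-n)).obj M) (fun _ _ => rfl))
  exact ((singleFunctors (ModuleCat.{u} R)).shiftIso n (-n) 0 (by simp)).app M ≪≫
    (singleFunctorIsoCompQ _ (-n)).app M

/-- The homology in degree `s` of the object `M⟦-s⟧`. -/
noncomputable def homologySingleShiftIso (M : ModuleCat.{u} R) (s : ℤ) :
    (homologyFunctor (ModuleCat.{u} R) s).obj
      (((singleFunctor (ModuleCat.{u} R) 0).obj M)⟦-s⟧) ≅ M :=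
  (homologyFunctor (ModuleCat.{u} R) s).mapIso
    (((singleFunctors (ModuleCat.{u} R)).shiftIso (-s) s 0 (by simp)).app M) ≪≫
    (singleFunctorCompHomologyFunctorIso (ModuleCat.{u} R) s).app M

end HomologyFree

/-! ### Ghost triangles, $\xi$-projectives and $\xi xt^1_\xi$. -/

section GhostTriangles

open DerivedCategory

variable {R : Type u} [Ring R] [HasDerivedCategory.{w} (ModuleCat.{u} R)]
  {t : Triangle (DerivedCategory (ModuleCat.{u} R))}

/-- By the long exact sequence, both conditions say that the connecting maps vanish. The degree
moves by one between the two sides, which is why the equivalence concerns all degrees together. -/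
lemma forall_epi_homology_iff_forall_mono (ht : t ∈ distTriang _) :
    (∀ s, Epi ((homologyFunctor (ModuleCat.{u} R) s).map t.mor₂)) ↔
      ∀ s, Mono ((homologyFunctor (ModuleCat.{u} R) s).map t.mor₁) := by
  refine ⟨fun h s => ?_, fun h s => ?_⟩
  · rw [HomologySequence.mono_homologyMap_mor₁_iff t ht (s - 1) s (by lia),
      ← HomologySequence.epi_homologyMap_mor₂_iff t ht (s - 1) s (by lia)]
    exact h _
  · rw [HomologySequence.epi_homologyMap_mor₂_iff t ht s (s + 1) (by lia),
      ← HomologySequence.mono_homologyMap_mor₁_iff t ht s (s + 1) (by lia)]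
    exact h _

lemma forall_epi_homology_iff_mor₃ (ht : t ∈ distTriang _) :
    (∀ s, Epi ((homologyFunctor (ModuleCat.{u} R) s).map t.mor₂)) ↔
      ∀ s, (homologyFunctor (ModuleCat.{u} R) s).map t.mor₃ = 0 := by
  refine forall_congr' fun s => ?_
  rw [HomologySequence.epi_homologyMap_mor₂_iff t ht s (s + 1) (by lia)]
  exact Preadditive.IsIso.comp_right_eq_zero _ _

lemma homology_shortExact (ht : t ∈ distTriang _)
    (h : ∀ s, Epi ((homologyFunctor (ModuleCat.{u} R) s).map t.mor₂))
    (s : ℤ) : (ShortComplex.mk _ _ (show (homologyFunctor (ModuleCat.{u} R) s).map t.mor₁ ≫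
      (homologyFunctor (ModuleCat.{u} R) s).map t.mor₂ = 0 by
        rw [← Functor.map_comp, comp_distTriang_mor_zero₁₂ _ ht, Functor.map_zero])).ShortExact :=
  { exact := HomologySequence.exact₂ t ht s
    mono_f := (forall_epi_homology_iff_forall_mono ht).1 h s
    epi_g := h s }

lemma homShortExact_of_isHomologyFree (ht : t ∈ distTriang _)
    (h : ∀ s, Epi ((homologyFunctor (ModuleCat.{u} R) s).map t.mor₂))
    {P : DerivedCategory (ModuleCat.{u} R)} (hP : IsHomologyFree P) : HomShortExact P t := by
  refine ⟨?_, ?_, ?_⟩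
  · intro f g hfg
    rw [← sub_eq_zero]
    refine hP.eq_zero _ fun s => ?_
    have := (homology_shortExact ht h s).mono_f
    rw [← cancel_mono ((homologyFunctor (ModuleCat.{u} R) s).map t.mor₁), zero_comp,
      ← Functor.map_comp, Preadditive.sub_comp, sub_eq_zero.2 hfg, Functor.map_zero]
  · intro f
    refine ⟨fun hf => ?_, ?_⟩
    · obtain ⟨g, hg⟩ := Triangle.coyoneda_exact₂ t ht f hf
      exact ⟨g, hg.symm⟩
    · rintro ⟨g, rfl⟩
      simp [comp_distTriang_mor_zero₁₂ _ ht]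
  · intro f
    have := hP.projective
    have := h
    obtain ⟨g, hg⟩ := hP.exists_map fun s =>
      Projective.factorThru ((homologyFunctor (ModuleCat.{u} R) s).map f)
        ((homologyFunctor (ModuleCat.{u} R) s).map t.mor₂)
    refine ⟨g, ?_⟩
    rw [← sub_eq_zero]
    refine hP.eq_zero _ fun s => ?_
    rw [Functor.map_sub, Functor.map_comp, hg, Projective.factorThru_comp, sub_self]

lemma HomShortExact.of_retract {P Y : DerivedCategory (ModuleCat.{u} R)} (r : Retract P Y)
    (h : HomShortExact Y t) : HomShortExact P t := by
  obtain ⟨h₁, h₂, h₃⟩ := h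
  refine ⟨fun f g hfg => ?_, fun f => ⟨fun hf => ?_, ?_⟩, fun f => ?_⟩
  · have := h₁ (a₁ := r.r ≫ f) (a₂ := r.r ≫ g) (by simpa using congr(r.r ≫ $hfg))
    simpa using congr(r.i ≫ $this)
  · obtain ⟨g, hg⟩ := (h₂ (r.r ≫ f)).1 (by simpa using congr(r.r ≫ $hf))
    exact ⟨r.i ≫ g, by simpa using congr(r.i ≫ $hg)⟩
  · rintro ⟨g, rfl⟩
    have := (h₂ _).2 ⟨r.r ≫ g, rfl⟩
    simpa using congr(r.i ≫ $this)
  · obtain ⟨g, hg⟩ := h₃ (r.r ≫ f)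
    exact ⟨r.i ≫ g, by simpa using congr(r.i ≫ $hg)⟩

lemma HomShortExact.of_isColimit {J : Type*} {F : J → DerivedCategory (ModuleCat.{u} R)}
    {c : Cofan F} (hc : IsColimit c) (h : ∀ j, HomShortExact (F j) t) : HomShortExact c.pt t := by
  refine ⟨fun f g hfg => ?_, fun f => ⟨fun hf => ?_, ?_⟩, fun f => ?_⟩
  · refine Cofan.IsColimit.hom_ext hc _ _ fun j => (h j).1 ?_
    simpa using congr(c.inj j ≫ $hfg)
  · have (j : J) : ∃ g : F j ⟶ t.obj₁, g ≫ t.mor₁ = c.inj j ≫ f :=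
      ((h j).2.1 _).1 (by simpa using congr(c.inj j ≫ $hf))
    choose g hg using this
    exact ⟨Cofan.IsColimit.desc hc g, Cofan.IsColimit.hom_ext hc _ _ fun j => by simp [hg]⟩
  · rintro ⟨g, rfl⟩
    refine Cofan.IsColimit.hom_ext hc _ _ fun j => ?_
    simpa using ((h j).2.1 _).2 ⟨c.inj j ≫ g, rfl⟩
  · have (j : J) : ∃ g : F j ⟶ t.obj₂, g ≫ t.mor₂ = c.inj j ≫ f := (h j).2.2 _
    choose g hg using this
    exact ⟨Cofan.IsColimit.desc hc g, Cofan.IsColimit.hom_ext hc _ _ fun j => by simp [hg]⟩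

lemma retractsOfCoproductsOfShifts_single (X : ObjectProperty (ModuleCat.{u} R))
    (M : ModuleCat.{u} R) (hM : X M) (n : ℤ) :
    retractsOfCoproductsOfShifts X (((singleFunctor (ModuleCat.{u} R) 0).obj M)⟦n⟧) :=
  ⟨PUnit, fun _ => M, fun _ => n, Cofan.mk _ fun _ => 𝟙 _, fun _ => hM,
    ⟨Cofan.IsColimit.mk _ (fun s => s.inj PUnit.unit) (by simp)
      (by intro s m hm; simpa using hm .unit)⟩,
    ⟨Retract.refl _⟩⟩

/-- The cohomologically ghost triangles are the exact triangles inducing short exact sequences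
on homology. -/
lemma ghostTriangles_iff : ghostTriangles R t ↔ t ∈ distTriang _ ∧
    ∀ s, Epi ((homologyFunctor (ModuleCat.{u} R) s).map t.mor₂) := by
  constructor
  · rintro ⟨ht, h⟩
    refine ⟨ht, fun s => (ModuleCat.epi_iff_surjective _).2 fun y => ?_⟩
    -- An element $y$ of $H^s$ is a map $R\to H^s$, realized by a morphism from $R[-s]$. Lifting
    -- that morphism along the triangle lifts $y$.
    have hR : Projective (ModuleCat.of R R) :=
      ModuleCat.projective_of_free (Module.Free.chooseBasis R R)
    obtain ⟨f, hf⟩ := (isHomologyFree_singleFunctor_shift (ModuleCat.of R R) (-s)).exists_map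
      (Y := t.obj₃) (Function.update (fun _ => 0) s
        ((homologySingleShiftIso (ModuleCat.of R R) s).hom ≫
          ModuleCat.ofHom (LinearMap.toSpanSingleton R _ y)))
    obtain ⟨g, hg⟩ := (h _ (retractsOfCoproductsOfShifts_single _ (ModuleCat.of R R) hR (-s))).2.2 f
    have hf' := hf s
    rw [Function.update_self, ← hg] at hf'
    dsimp only at hf'
    rw [Functor.map_comp] at hf'
    refine ⟨(homologyFunctor (ModuleCat.{u} R) s).map g
      ((homologySingleShiftIso (ModuleCat.of R R) s).inv (1 : R)), ?_⟩
    refine (congr($hf' ((homologySingleShiftIso (ModuleCat.of R R) s).inv (1 : R)))).trans ?_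
    simp
  · rintro ⟨ht, h⟩
    refine ⟨ht, ?_⟩
    rintro P ⟨J, M, n, c, hM, ⟨hc⟩, ⟨r⟩⟩
    refine HomShortExact.of_retract r (HomShortExact.of_isColimit hc fun j => ?_)
    have : Projective (M j) := hM j
    exact homShortExact_of_isHomologyFree ht h (isHomologyFree_singleFunctor_shift (M j) (n j))

lemma xiProjective_of_isHomologyFree {P : DerivedCategory (ModuleCat.{u} R)}
    (hP : IsHomologyFree P) : xiProjective (ghostTriangles R) P := fun _ ht =>
  homShortExact_of_isHomologyFree (ghostTriangles_iff.1 ht).1 (ghostTriangles_iff.1 ht).2 hP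

/-- Every object is the target of a deflation from an object with free homology. -/
lemma exists_ghostTriangle_free (X : DerivedCategory (ModuleCat.{u} R)) :
    ∃ (K P : DerivedCategory (ModuleCat.{u} R)) (i : K ⟶ P) (p : P ⟶ X)
      (h : X ⟶ K⟦(1 : ℤ)⟧), IsHomologyFree P ∧ ghostTriangles R (Triangle.mk i p h) := by
  obtain ⟨K, f, hd, hp, hf⟩ := exists_projective_zeroDifferential X
  obtain ⟨Z, g, h, ht⟩ := distinguished_cocone_triangle₁ f
  exact ⟨Z, _, g, f, h, isHomologyFree_Q hd, ghostTriangles_iff.2 ⟨ht, hf⟩⟩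

/-- The identity of $P$ lifts along a ghost triangle whose middle term is homology-free, so $P$ is a
retract of that term. -/
lemma isHomologyFree_of_xiProjective {P : DerivedCategory (ModuleCat.{u} R)}
    (hP : xiProjective (ghostTriangles R) P) : IsHomologyFree P := by
  obtain ⟨K, F, i, p, h, hF, ht⟩ := exists_ghostTriangle_free P
  obtain ⟨s, hs⟩ := (hP _ ht).2.2 (𝟙 P)
  exact IsHomologyFree.of_retract ⟨s, p, hs⟩ hF

lemma nonempty_xiProjectiveResolution (X : DerivedCategory (ModuleCat.{u} R)) :
    Nonempty (XiProjectiveResolution (ghostTriangles R) X) := by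
  choose K P i p h hP ht using exists_ghostTriangle_free (R := R)
  let Z : ℕ → DerivedCategory (ModuleCat.{u} R) := fun n => Nat.rec X (fun _ Y => K Y) n
  exact ⟨{ K := Z
           P := fun n => P (Z n)
           ι := fun n => i (Z n)
           π := fun n => p (Z n)
           ν := fun n => h (Z n)
           mem := fun n => ht (Z n)
           projective := fun n => xiProjective_of_isHomologyFree (hP _)
           augmentation := Iso.refl _ }⟩

end GhostTriangles

section XiExt

open DerivedCategory

variable {R : Type u} [Ring R] [HasDerivedCategory.{w} (ModuleCat.{u} R)]

lemma subsingleton_xiExtSucc_iff {T : Type*} [Category* T] [Preadditive T] [HasZeroObject T]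
    [HasShift T ℤ] [∀ n : ℤ, (shiftFunctor T n).Additive] [Pretriangulated T]
    {ξ : ObjectProperty (Triangle T)} {X : T} (ρ : XiProjectiveResolution ξ X) (Y : T) (n : ℕ) :
    Subsingleton (ρ.XiExtSucc Y n) ↔ ∀ f : ρ.P (n + 1) ⟶ Y, ρ.d (n + 1) ≫ f = 0 →
      ∃ g : ρ.P n ⟶ Y, ρ.d n ≫ g = f := by
  refine ⟨fun h f hf => ?_, fun h => subsingleton_of_forall_eq 0 fun x => ?_⟩
  · have := (QuotientAddGroup.eq_zero_iff (N := (ρ.homD Y n).range.addSubgroupOf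
      (ρ.homD Y (n + 1)).ker) ⟨f, hf⟩).1 (Subsingleton.elim _ _)
    exact this
  · obtain ⟨⟨f, hf⟩, rfl⟩ := QuotientAddGroup.mk_surjective x
    exact (QuotientAddGroup.eq_zero_iff _).2 (h f hf)

/-- Homology turns the triangles of the resolution into short exact sequences with projective middle
terms, and morphisms out of the $P_n$ are graded maps on homology. The vanishing thus says, in each
degree separately, that maps from the first syzygy of $H^sX$ to $H^sY$ extend to $H^s(P_0)$. -/
lemma subsingleton_xiExtSucc_zero_iff {X : DerivedCategory (ModuleCat.{u} R)}
    (ρ : XiProjectiveResolution (ghostTriangles R) X) (Y : DerivedCategory (ModuleCat.{u} R)) :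
    Subsingleton (ρ.XiExtSucc Y 0) ↔
      ∀ s, Subsingleton (Abelian.Ext ((homologyFunctor (ModuleCat.{u} R) s).obj X)
        ((homologyFunctor (ModuleCat.{u} R) s).obj Y) 1) := by
  rw [subsingleton_xiExtSucc_iff]
  have hP (n : ℕ) : IsHomologyFree (ρ.P n) := isHomologyFree_of_xiProjective (ρ.projective n)
  have hp (n : ℕ) := (hP n).projective
  have hιπ (n : ℕ) (s : ℤ) : (homologyFunctor (ModuleCat.{u} R) s).map (ρ.ι n) ≫
    (homologyFunctor (ModuleCat.{u} R) s).map (ρ.π n) = 0 := by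
    rw [← Functor.map_comp, show ρ.ι n ≫ ρ.π n = 0 from
      comp_distTriang_mor_zero₁₂ _ (ghostTriangles_iff.1 (ρ.mem n)).1, Functor.map_zero]
  have hS (n : ℕ) (s : ℤ) : (ShortComplex.mk _ _ (hιπ n s)).ShortExact :=
    homology_shortExact (ghostTriangles_iff.1 (ρ.mem n)).1 (ghostTriangles_iff.1 (ρ.mem n)).2 s
  have hι (n : ℕ) (s : ℤ) : Mono ((homologyFunctor (ModuleCat.{u} R) s).map (ρ.ι n)) :=
    (hS n s).mono_f
  have hπ (n : ℕ) (s : ℤ) : Epi ((homologyFunctor (ModuleCat.{u} R) s).map (ρ.π n)) :=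
    (hS n s).epi_g
  constructor
  · intro h s
    refine subsingleton_ext_of_iso
      ((homologyFunctor (ModuleCat.{u} R) s).mapIso ρ.augmentation)
      (subsingleton_ext_of_exists_extension (hS 0 s) fun g => ?_)
    change (homologyFunctor (ModuleCat.{u} R) s).obj (ρ.K 1) ⟶ _ at g
    change ∃ g', (homologyFunctor (ModuleCat.{u} R) s).map (ρ.ι 0) ≫ g' = g
    -- The map $g$ is placed in degree $s$ alone and continued by zero in all other degrees, so that
    -- the vanishing in $\mathrm{D}(R)$ yields the extension in that one degree.
    obtain ⟨f, hf⟩ := (hP 1).exists_map (Y := Y) (Function.update (fun _ => 0) s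
      ((homologyFunctor (ModuleCat.{u} R) s).map (ρ.π 1) ≫ g))
    obtain ⟨g', hg'⟩ := h f ((hP 2).eq_zero _ fun t => by
      rw [XiProjectiveResolution.d, Functor.map_comp, Functor.map_comp, hf]
      by_cases hts : t = s
      · subst hts
        rw [Function.update_self, Category.assoc, ← Category.assoc _ _ g, hιπ, zero_comp, comp_zero]
      · rw [Function.update_of_ne hts, comp_zero])
    refine ⟨(homologyFunctor (ModuleCat.{u} R) s).map g', ?_⟩
    have hfs := hf s
    rw [Function.update_self, ← hg', XiProjectiveResolution.d, Category.assoc, Functor.map_comp,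
      cancel_epi, Functor.map_comp] at hfs
    exact hfs
  · intro h f hf
    -- On homology $f$ kills the second syzygy, so it descends to the first one, where vanishing of
    -- $\mathrm{Ext}^1$ extends it.
    have h₁ (s : ℤ) : (homologyFunctor (ModuleCat.{u} R) s).map (ρ.ι 1) ≫
        (homologyFunctor (ModuleCat.{u} R) s).map f = 0 := by
      rw [← cancel_epi ((homologyFunctor (ModuleCat.{u} R) s).map (ρ.π 2)), comp_zero,
        ← Functor.map_comp, ← Functor.map_comp, ← Category.assoc]
      exact (congrArg _ hf).trans (Functor.map_zero _ _ _)
    have h₂ (s : ℤ) : ∃ g, (homologyFunctor (ModuleCat.{u} R) s).map (ρ.π 1) ≫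
        (homologyFunctor (ModuleCat.{u} R) s).map (ρ.ι 0) ≫ g =
          (homologyFunctor (ModuleCat.{u} R) s).map f := by
      have := (hS 1 s).epi_g
      obtain ⟨g, hg⟩ := exists_extension_of_subsingleton_ext (hS 0 s)
        (N := (homologyFunctor (ModuleCat.{u} R) s).obj Y)
        (subsingleton_ext_of_iso ((homologyFunctor (ModuleCat.{u} R) s).mapIso
          ρ.augmentation.symm) (h s)) ((hS 1 s).exact.desc _ (h₁ s))
      refine ⟨g, ?_⟩
      exact (congrArg _ hg).trans ((hS 1 s).exact.g_desc _ (h₁ s))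
    choose g hg using h₂
    obtain ⟨k, hk⟩ := (hP 0).exists_map g
    refine ⟨k, ?_⟩
    rw [← sub_eq_zero]
    refine (hP 1).eq_zero _ fun s => ?_
    rw [Functor.map_sub, XiProjectiveResolution.d, Functor.map_comp, Functor.map_comp, hk,
      Category.assoc, hg, sub_self]

/-- `ξxt¹(X, Y) = 0` if and only if `Ext¹` vanishes between the homology modules in each degree. -/
lemma xiExtOneVanishes_iff (X Y : DerivedCategory (ModuleCat.{u} R)) :
    XiExtOneVanishes (ghostTriangles R) X Y ↔
      ∀ s, Subsingleton (Abelian.Ext ((homologyFunctor (ModuleCat.{u} R) s).obj X)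
        ((homologyFunctor (ModuleCat.{u} R) s).obj Y) 1) := by
  constructor
  · rintro ⟨ρ, hρ⟩
    exact (subsingleton_xiExtSucc_zero_iff ρ Y).1 hρ
  · intro h
    obtain ⟨ρ⟩ := nonempty_xiProjectiveResolution X
    exact ⟨ρ, (subsingleton_xiExtSucc_zero_iff ρ Y).2 h⟩

end XiExt

/-! ### Countable products and direct sums of complexes. -/

section ProductComplex

open HomologicalComplex

variable {R : Type u} [Ring R] (T : ℕ → CochainComplex (ModuleCat.{u} R) ℤ)

/-- The degreewise product of a sequence of complexes of modules. -/
def productComplex : CochainComplex (ModuleCat.{u} R) ℤ where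
  X n := ModuleCat.of R (∀ p, (T p).X n)
  d i j := ModuleCat.ofHom (LinearMap.pi fun p => ((T p).d i j).hom ∘ₗ LinearMap.proj p)
  shape i j hij := by
    ext x p
    exact congr($((T p).shape i j hij) (x p))
  d_comp_d' i j k _ _ := by
    ext x p
    exact congr($((T p).d_comp_d i j k) (x p))

/-- The projections of the product complex. -/
def productComplexπ (p : ℕ) : productComplex T ⟶ T p where
  f _ := ModuleCat.ofHom (LinearMap.proj p)
  comm' _ _ _ := rfl

variable {T}

/-- The degreewise morphism to the product complex with given components. -/
def productComplexLiftX {n : ℤ} {M : ModuleCat.{u} R} (φ : ∀ p, M ⟶ (T p).X n) :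
    M ⟶ (productComplex T).X n :=
  ModuleCat.ofHom (LinearMap.pi fun p => (φ p).hom)

lemma productComplex_hom_ext {n : ℤ} {M : ModuleCat.{u} R}
    {f g : M ⟶ (productComplex T).X n}
    (h : ∀ p, f ≫ (productComplexπ T p).f n = g ≫ (productComplexπ T p).f n) : f = g := by
  ext x
  exact funext fun p => congr($(h p) x)

lemma exists_lift_productComplex {K : CochainComplex (ModuleCat.{u} R) ℤ} (f : ∀ p, K ⟶ T p) :
    ∃ g : K ⟶ productComplex T, ∀ p, g ≫ productComplexπ T p = f p :=
  ⟨{ f := fun n => productComplexLiftX fun p => (f p).f n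
     comm' := fun i j _ => productComplex_hom_ext fun p => (f p).comm i j }, fun _ => rfl⟩

lemma nonempty_homotopy_productComplex {K : CochainComplex (ModuleCat.{u} R) ℤ}
    (f : K ⟶ productComplex T) (hf : ∀ p, Nonempty (Homotopy (f ≫ productComplexπ T p) 0)) :
    Nonempty (Homotopy f 0) := by
  have h := fun p => (hf p).some
  refine ⟨{ hom := fun i j => productComplexLiftX fun p => (h p).hom i j
            zero := fun i j hij => productComplex_hom_ext fun p => (h p).zero i j hij
            comm := fun i => productComplex_hom_ext fun p => ((h p).comm i).trans ?_ }⟩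
  simp only [dNext_eq _ (show (ComplexShape.up ℤ).Rel i (i + 1) from rfl),
    prevD_eq _ (show (ComplexShape.up ℤ).Rel (i - 1) i by simp)]
  rfl

instance isKInjective_productComplex [∀ p, (T p).IsKInjective] :
    (productComplex T).IsKInjective where
  nonempty_homotopy_zero f hK := nonempty_homotopy_productComplex f fun _ =>
    CochainComplex.IsKInjective.nonempty_homotopy_zero _ hK

lemma injective_productComplex {n : ℤ} (h : ∀ p, Injective ((T p).X n)) :
    Injective ((productComplex T).X n) where
  factors {X Y} g f _ := by
    have (p : ℕ) : ∃ k : Y ⟶ (T p).X n, f ≫ k = g ≫ (productComplexπ T p).f n :=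
      ⟨_, Injective.comp_factorThru _ _⟩
    choose k hk using this
    refine ⟨ModuleCat.ofHom (LinearMap.pi fun p => (k p).hom), ?_⟩
    ext x
    funext p
    exact congr($(hk p) x)

lemma bijective_homology_productComplex (s : ℤ) :
    Function.Bijective (fun (x : (productComplex T).homology s) (p : ℕ) =>
      homologyMap (productComplexπ T p) s x) := by
  constructor
  · intro x y hxy
    rw [← sub_eq_zero]
    have hz (p : ℕ) : homologyMap (productComplexπ T p) s (x - y) = 0 := by
      rw [map_sub, sub_eq_zero]
      exact congrFun hxy p
    obtain ⟨z, hz'⟩ := homologyClass_surjective _ s (x - y)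
    rw [← hz'] at hz ⊢
    simp only [homologyMap_homologyClass] at hz
    choose w hw using fun p => (homologyClass_eq_zero_iff _ _ _).1 (hz p)
    exact (homologyClass_eq_zero_iff _ _ _).2 ⟨w, funext hw⟩
  · intro y
    choose z hz using fun p => homologyClass_surjective _ s (y p)
    refine ⟨homologyClass (productComplex T) s ⟨fun p => (z p).1, funext fun p => (z p).2⟩, ?_⟩
    funext p
    dsimp only
    rw [homologyMap_homologyClass, ← hz p]
    rfl

end ProductComplex

section CoproductComplex

open HomologicalComplex

variable {R : Type u} [Ring R] (T : ℕ → CochainComplex (ModuleCat.{u} R) ℤ)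

/-- The degreewise direct sum of a sequence of complexes of modules. -/
noncomputable def coproductComplex : CochainComplex (ModuleCat.{u} R) ℤ where
  X n := ModuleCat.of R (DirectSum ℕ fun p => (T p).X n)
  d i j := ModuleCat.ofHom (DirectSum.lmap fun p => ((T p).d i j).hom)
  shape i j hij := by
    ext p x
    simp [(T p).shape i j hij]
  d_comp_d' i j k _ _ := by
    ext p x
    simp [← ModuleCat.comp_apply]

/-- The inclusions of the direct sum complex. -/
noncomputable def coproductComplexι (p : ℕ) : T p ⟶ coproductComplex T where
  f n := ModuleCat.ofHom (DirectSum.lof R ℕ (fun p => (T p).X n) p)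
  comm' i j _ := by
    ext x
    exact DirectSum.lmap_lof (fun p => ((T p).d i j).hom) p x

/-- The projections of the direct sum complex. -/
noncomputable def coproductComplexπ (p : ℕ) : coproductComplex T ⟶ T p where
  f n := ModuleCat.ofHom (DirectSum.component R ℕ (fun p => (T p).X n) p)
  comm' i j _ := by
    ext x
    exact (DirectSum.lmap_apply (fun p => ((T p).d i j).hom) x p).symm

variable {T}

/-- Descent of degreewise morphisms to the direct sum complex. -/
noncomputable def coproductComplexDescX {n : ℤ} {M : ModuleCat.{u} R} (φ : ∀ p, (T p).X n ⟶ M) :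
    (coproductComplex T).X n ⟶ M :=
  ModuleCat.ofHom (DirectSum.toModule R ℕ M fun p => (φ p).hom)

lemma coproductComplexι_descX {n : ℤ} {M : ModuleCat.{u} R} (φ : ∀ p, (T p).X n ⟶ M) (p : ℕ) :
    (coproductComplexι T p).f n ≫ coproductComplexDescX φ = φ p := by
  ext x
  exact DirectSum.toModule_lof R (M := fun p => (T p).X n) (φ := fun p => (φ p).hom) p x

lemma coproductComplexι_descX_assoc {n : ℤ} {M N : ModuleCat.{u} R} (φ : ∀ p, (T p).X n ⟶ M)
    (p : ℕ) (h : M ⟶ N) :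
    (coproductComplexι T p).f n ≫ coproductComplexDescX φ ≫ h = φ p ≫ h := by
  rw [← Category.assoc, coproductComplexι_descX]

lemma coproductComplex_hom_ext {n : ℤ} {M : ModuleCat.{u} R}
    {f g : (coproductComplex T).X n ⟶ M}
    (h : ∀ p, (coproductComplexι T p).f n ≫ f = (coproductComplexι T p).f n ≫ g) : f = g :=
  ModuleCat.hom_ext (DirectSum.linearMap_ext R fun p => congrArg ModuleCat.Hom.hom (h p))

lemma coproductComplexι_comp_π_self (p : ℕ) :
    coproductComplexι T p ≫ coproductComplexπ T p = 𝟙 _ := by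
  ext n x
  exact DirectSum.component.lof_self R (M := fun p => (T p).X n) p x

lemma coproductComplexι_comp_π_of_ne {p q : ℕ} (h : p ≠ q) :
    coproductComplexι T p ≫ coproductComplexπ T q = 0 := by
  ext n x
  exact DFinsupp.single_eq_of_ne h.symm

lemma exists_desc_coproductComplex {K : CochainComplex (ModuleCat.{u} R) ℤ} (f : ∀ p, T p ⟶ K) :
    ∃ g : coproductComplex T ⟶ K, ∀ p, coproductComplexι T p ≫ g = f p := by
  refine ⟨{ f := fun n => coproductComplexDescX fun p => (f p).f n
            comm' := fun i j _ => ?_ }, fun p => ?_⟩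
  · refine coproductComplex_hom_ext fun p => ?_
    rw [coproductComplexι_descX_assoc, Hom.comm_assoc, coproductComplexι_descX, (f p).comm]
  · ext n : 1
    exact coproductComplexι_descX _ p

lemma nonempty_homotopy_coproductComplex {K : CochainComplex (ModuleCat.{u} R) ℤ}
    (f : coproductComplex T ⟶ K) (hf : ∀ p, Nonempty (Homotopy (coproductComplexι T p ≫ f) 0)) :
    Nonempty (Homotopy f 0) := by
  have h := fun p => (hf p).some
  refine ⟨{ hom := fun i j => coproductComplexDescX fun p => (h p).hom i j
            zero := fun i j hij => ?_
            comm := fun i => ?_ }⟩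
  · refine coproductComplex_hom_ext fun p => ?_
    rw [coproductComplexι_descX, comp_zero, (h p).zero i j hij]
  · refine coproductComplex_hom_ext fun p => ?_
    refine ((h p).comm i).trans ?_
    simp only [dNext_eq _ (show (ComplexShape.up ℤ).Rel i (i + 1) from rfl),
      prevD_eq _ (show (ComplexShape.up ℤ).Rel (i - 1) i by simp), Preadditive.comp_add,
      Hom.comm_assoc, coproductComplexι_descX, coproductComplexι_descX_assoc, zero_f, comp_zero]

instance isKProjective_coproductComplex [∀ p, (T p).IsKProjective] :
    (coproductComplex T).IsKProjective where
  nonempty_homotopy_zero f hK := nonempty_homotopy_coproductComplex f fun _ =>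
    CochainComplex.IsKProjective.nonempty_homotopy_zero _ hK

lemma projective_coproductComplex {n : ℤ} (h : ∀ p, Projective ((T p).X n)) :
    Projective ((coproductComplex T).X n) where
  factors {X Y} g f _ := by
    have (p : ℕ) : ∃ k : (T p).X n ⟶ X, k ≫ f = (coproductComplexι T p).f n ≫ g :=
      ⟨_, Projective.factorThru_comp _ _⟩
    choose k hk using this
    refine ⟨coproductComplexDescX k, coproductComplex_hom_ext fun p => ?_⟩
    rw [coproductComplexι_descX_assoc, hk]

lemma homology_coproductComplex_eq_zero {s : ℤ} (x : (coproductComplex T).homology s)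
    (hx : ∀ p, homologyMap (coproductComplexπ T p) s x = 0) : x = 0 := by
  classical
  obtain ⟨⟨z, hz⟩, rfl⟩ := homologyClass_surjective _ s x
  simp only [homologyMap_homologyClass] at hx
  choose w hw using fun p => (homologyClass_eq_zero_iff _ _ _).1 (hx p)
  change DirectSum ℕ fun p => (T p).X s at z
  -- The primitives $w_p$ are chosen for every $p$, hence need not form an element of the direct
  -- sum. Cutting them off outside the support of $z$ gives one and loses nothing, since $z_p=0$
  -- there.
  refine (homologyClass_eq_zero_iff _ _ _).2
    ⟨DirectSum.mk (fun p => (T p).X (s - 1)) z.support fun p => w p.1, ?_⟩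
  refine DFinsupp.ext fun p => ?_
  by_cases hp : p ∈ z.support
  · refine Eq.trans ?_ (hw p)
    exact congrArg ((T p).d (s - 1) s) (DirectSum.mk_apply_of_mem hp)
  · refine Eq.trans ?_ (DFinsupp.notMem_support_iff.1 hp).symm
    have h0 : DirectSum.mk (fun p => (T p).X (s - 1)) z.support (fun p => w p.1) p = 0 :=
      DirectSum.mk_apply_of_notMem hp
    exact (congrArg ((T p).d (s - 1) s) h0).trans (map_zero _)

lemma homology_coproductComplex_induction {s : ℤ}
    (S : AddSubgroup ((coproductComplex T).homology s))
    (hS : ∀ p x, homologyMap (coproductComplexι T p) s x ∈ S)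
    (x : (coproductComplex T).homology s) : x ∈ S := by
  classical
  obtain ⟨⟨z, hz⟩, rfl⟩ := homologyClass_surjective _ s x
  change DirectSum ℕ fun p => (T p).X s at z
  have hz' (p : ℕ) : z p ∈ LinearMap.ker ((T p).d s (s + 1)).hom := DFinsupp.ext_iff.1 hz p
  have : (⟨z, hz⟩ : LinearMap.ker ((coproductComplex T).d s (s + 1)).hom) =
      ∑ p ∈ z.support, mapCocycle (coproductComplexι T p) s ⟨z p, hz' p⟩ := by
    refine Subtype.ext ?_
    rw [AddSubmonoidClass.coe_finsetSum]
    exact (DirectSum.sum_support_of z).symm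
  rw [this, map_sum]
  refine sum_mem fun p _ => ?_
  rw [← homologyMap_homologyClass]
  exact hS _ _

end CoproductComplex

/-! ### Objects with K-injective or K-projective models. -/

section MappingCone

open CochainComplex

variable {C : Type*} [Category* C] [Abelian C] {K L : CochainComplex C ℤ} (f : K ⟶ L)

instance isKInjective_mappingCone [K.IsKInjective] [L.IsKInjective] :
    (mappingCone f).IsKInjective := by
  rw [isKInjective_iff_rightOrthogonal]
  exact ObjectProperty.ext_of_isTriangulatedClosed₃ _ _
    (HomotopyCategory.mappingCone_triangleh_distinguished f)
    (IsKInjective.rightOrthogonal K) (IsKInjective.rightOrthogonal L)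

instance isKProjective_mappingCone [K.IsKProjective] [L.IsKProjective] :
    (mappingCone f).IsKProjective := by
  rw [isKProjective_iff_leftOrthogonal]
  exact ObjectProperty.ext_of_isTriangulatedClosed₃ _ _
    (HomotopyCategory.mappingCone_triangleh_distinguished f)
    (IsKProjective.leftOrthogonal K) (IsKProjective.leftOrthogonal L)

lemma injective_mappingCone_X (n : ℤ) [Injective (K.X (n + 1))] [Injective (L.X n)] :
    Injective ((mappingCone f).X n) :=
  Injective.of_iso (HomologicalComplex.homotopyCofiber.XIsoBiprod f n (n + 1) rfl).symm
    inferInstance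

lemma projective_mappingCone_X (n : ℤ) [Projective (K.X (n + 1))] [Projective (L.X n)] :
    Projective ((mappingCone f).X n) :=
  Projective.of_iso (HomologicalComplex.homotopyCofiber.XIsoBiprod f n (n + 1) rfl).symm
    inferInstance

end MappingCone

section Resolvable

open DerivedCategory

variable {R : Type u} [Ring R] [HasDerivedCategory.{w} (ModuleCat.{u} R)]

/-- The objects of `D(R)` represented by a K-injective complex of injectives. -/
def HasInjectiveModel (Y : DerivedCategory (ModuleCat.{u} R)) : Prop :=
  ∃ I : CochainComplex (ModuleCat.{u} R) ℤ, I.IsKInjective ∧ (∀ n, Injective (I.X n)) ∧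
    Nonempty (Q.obj I ≅ Y)

/-- The objects of `D(R)` represented by a K-projective complex of projectives. -/
def HasProjectiveModel (Y : DerivedCategory (ModuleCat.{u} R)) : Prop :=
  ∃ P : CochainComplex (ModuleCat.{u} R) ℤ, P.IsKProjective ∧ (∀ n, Projective (P.X n)) ∧
    Nonempty (Q.obj P ≅ Y)

variable {Y Z : DerivedCategory (ModuleCat.{u} R)}

lemma HasInjectiveModel.of_iso (e : Y ≅ Z) (h : HasInjectiveModel Y) : HasInjectiveModel Z := by
  obtain ⟨I, h₁, h₂, ⟨e'⟩⟩ := h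
  exact ⟨I, h₁, h₂, ⟨e' ≪≫ e⟩⟩

lemma HasProjectiveModel.of_iso (e : Y ≅ Z) (h : HasProjectiveModel Y) :
    HasProjectiveModel Z := by
  obtain ⟨I, h₁, h₂, ⟨e'⟩⟩ := h
  exact ⟨I, h₁, h₂, ⟨e' ≪≫ e⟩⟩

/-- K-injectivity of the model of the source's image lets the second map be represented by an actual
morphism of complexes; its cocone is again a K-injective complex of injectives and is isomorphic to
the first term. -/
lemma HasInjectiveModel.fiber {t : Triangle (DerivedCategory (ModuleCat.{u} R))}
    (ht : t ∈ distTriang _) (h₂ : HasInjectiveModel t.obj₂) (h₃ : HasInjectiveModel t.obj₃) :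
    HasInjectiveModel t.obj₁ := by
  obtain ⟨I, hI, hI', ⟨e⟩⟩ := h₂
  obtain ⟨J, hJ, hJ', ⟨e'⟩⟩ := h₃
  obtain ⟨f, hf⟩ := exists_Q_map_eq_of_isKInjective I J (e.hom ≫ t.mor₂ ≫ e'.inv)
  have hd := mappingCocone_triangle_distinguished f
  have hc : Q.map f ≫ e'.hom = e.hom ≫ t.mor₂ := by simp [hf]
  obtain ⟨a, ha⟩ := complete_distinguished_triangle_morphism₁ _ _ hd ht e.hom e'.hom hc
  have : IsIso a := isIso₁_of_isIso₂₃ (Triangle.homMk _ _ a e.hom e'.hom ha.1 hc ha.2) hd ht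
    (inferInstanceAs (IsIso e.hom)) (inferInstanceAs (IsIso e'.hom))
  refine ⟨CochainComplex.mappingCocone f, ?_, fun n => ?_, ⟨@asIso _ _ _ _ a this⟩⟩
  · rw [CochainComplex.mappingCocone]
    infer_instance
  · exact injective_mappingCone_X f (n + -1)

lemma HasProjectiveModel.cone {t : Triangle (DerivedCategory (ModuleCat.{u} R))}
    (ht : t ∈ distTriang _) (h₁ : HasProjectiveModel t.obj₁) (h₂ : HasProjectiveModel t.obj₂) :
    HasProjectiveModel t.obj₃ := by
  obtain ⟨I, hI, hI', ⟨e⟩⟩ := h₁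
  obtain ⟨J, hJ, hJ', ⟨e'⟩⟩ := h₂
  obtain ⟨f, hf⟩ := exists_Q_map_eq_of_isKProjective I J (e.hom ≫ t.mor₁ ≫ e'.inv)
  have hd := mappingCone_triangle_distinguished f
  have hc : Q.map f ≫ e'.hom = e.hom ≫ t.mor₁ := by simp [hf]
  obtain ⟨a, ha⟩ := complete_distinguished_triangle_morphism _ _ hd ht e.hom e'.hom hc
  have : IsIso a := isIso₃_of_isIso₁₂ (Triangle.homMk _ _ e.hom e'.hom a hc ha.1 ha.2) hd ht
    (inferInstanceAs (IsIso e.hom)) (inferInstanceAs (IsIso e'.hom))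
  exact ⟨CochainComplex.mappingCone f, inferInstance, fun n => projective_mappingCone_X f n,
    ⟨@asIso _ _ _ _ a this⟩⟩

/-- The homology modules of the objects of `D(R)`. -/
noncomputable abbrev homologyModule (s : ℤ) : DerivedCategory (ModuleCat.{u} R) ⥤ ModuleCat.{u} R :=
  homologyFunctor (ModuleCat.{u} R) s

/-- A countable product in `D(R)` which is also a product on homology. -/
structure IsHomologyProduct (T : ℕ → DerivedCategory (ModuleCat.{u} R))
    (W : DerivedCategory (ModuleCat.{u} R)) (π : ∀ p, W ⟶ T p) : Prop where
  exists_lift {X : DerivedCategory (ModuleCat.{u} R)} (f : ∀ p, X ⟶ T p) :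
    ∃ g : X ⟶ W, ∀ p, g ≫ π p = f p
  eq_zero {X : DerivedCategory (ModuleCat.{u} R)} (g : X ⟶ W) (hg : ∀ p, g ≫ π p = 0) : g = 0
  bijective (s : ℤ) : Function.Bijective (fun x p => (homologyModule s).map (π p) x)

/-- A countable coproduct in `D(R)` which is also a coproduct on homology. -/
structure IsHomologyCoproduct (T : ℕ → DerivedCategory (ModuleCat.{u} R))
    (S : DerivedCategory (ModuleCat.{u} R)) (ι : ∀ p, T p ⟶ S) : Prop where
  exists_desc {X : DerivedCategory (ModuleCat.{u} R)} (f : ∀ p, T p ⟶ X) :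
    ∃ g : S ⟶ X, ∀ p, ι p ≫ g = f p
  eq_zero {X : DerivedCategory (ModuleCat.{u} R)} (g : S ⟶ X) (hg : ∀ p, ι p ≫ g = 0) : g = 0
  homology_induction (s : ℤ) (U : AddSubgroup ((homologyModule s).obj S))
    (hU : ∀ p x, (homologyModule s).map (ι p) x ∈ U) (x : (homologyModule s).obj S) : x ∈ U
  exists_proj : ∃ π : ∀ p, S ⟶ T p, (∀ p, ι p ≫ π p = 𝟙 _) ∧
    (∀ p q, p ≠ q → ι p ≫ π q = 0) ∧ ∀ (s : ℤ) (x : (homologyModule s).obj S),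
      (∀ p, (homologyModule s).map (π p) x = 0) → x = 0

lemma exists_isHomologyProduct {T : ℕ → DerivedCategory (ModuleCat.{u} R)}
    (hT : ∀ p, HasInjectiveModel (T p)) :
    ∃ W π, HasInjectiveModel W ∧ IsHomologyProduct T W π := by
  choose I hI hI' e using hT
  replace e := fun p => (e p).some
  refine ⟨Q.obj (productComplex I), fun p => Q.map (productComplexπ I p) ≫ (e p).hom,
    ⟨_, inferInstance, fun n => injective_productComplex fun p => hI' p n, ⟨Iso.refl _⟩⟩,
    ⟨fun {X} f => ?_, fun {X} g hg => ?_, fun s => ?_⟩⟩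
  · choose f' hf' using fun p => exists_Q_map_eq_of_isKInjective (Q.objPreimage X) (I p)
      ((Q.objObjPreimageIso X).hom ≫ f p ≫ (e p).inv)
    obtain ⟨g, hg⟩ := exists_lift_productComplex f'
    refine ⟨(Q.objObjPreimageIso X).inv ≫ Q.map g, fun p => ?_⟩
    rw [Category.assoc, ← Functor.map_comp_assoc, hg, hf']
    simp
  · obtain ⟨g', hg'⟩ := exists_Q_map_eq_of_isKInjective (Q.objPreimage X) (productComplex I)
      ((Q.objObjPreimageIso X).hom ≫ g)
    obtain ⟨h⟩ := nonempty_homotopy_productComplex g' fun p =>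
      nonempty_homotopy_of_isKInjective _ (by
        rw [← cancel_mono (e p).hom, Functor.map_comp, hg', Category.assoc, Category.assoc, hg,
          comp_zero, zero_comp])
    rw [← cancel_epi (Q.objObjPreimageIso X).hom, ← hg', Q_map_eq_zero_of_homotopy h, comp_zero]
  · have h := bijective_homology_productComplex (T := I) s
    let i (p : ℕ) := (homologyQIso (I p) s).symm ≪≫ (homologyModule s).mapIso (e p)
    have := ((Equiv.piCongrRight fun p => (i p).toLinearEquiv.toEquiv).bijective.comp h).comp
      (homologyQIso (productComplex I) s).toLinearEquiv.bijective
    convert this using 1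
    funext x p
    rw [Functor.map_comp, homologyFunctor_map_Q_map]
    rfl

lemma exists_isHomologyCoproduct {T : ℕ → DerivedCategory (ModuleCat.{u} R)}
    (hT : ∀ p, HasProjectiveModel (T p)) :
    ∃ S ι, HasProjectiveModel S ∧ IsHomologyCoproduct T S ι := by
  choose I hI hI' e using hT
  replace e := fun p => (e p).some
  refine ⟨Q.obj (coproductComplex I), fun p => (e p).inv ≫ Q.map (coproductComplexι I p),
    ⟨_, inferInstance, fun n => projective_coproductComplex fun p => hI' p n, ⟨Iso.refl _⟩⟩,
    ⟨fun {X} f => ?_, fun {X} g hg => ?_, fun s U hU x => ?_, ?_⟩⟩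
  · choose f' hf' using fun p => exists_Q_map_eq_of_isKProjective (I p) (Q.objPreimage X)
      ((e p).hom ≫ f p ≫ (Q.objObjPreimageIso X).inv)
    obtain ⟨g, hg⟩ := exists_desc_coproductComplex f'
    refine ⟨Q.map g ≫ (Q.objObjPreimageIso X).hom, fun p => ?_⟩
    rw [Category.assoc, ← Functor.map_comp_assoc, hg, hf']
    simp
  · obtain ⟨g', hg'⟩ := exists_Q_map_eq_of_isKProjective (coproductComplex I) (Q.objPreimage X)
      (g ≫ (Q.objObjPreimageIso X).inv)
    obtain ⟨h⟩ := nonempty_homotopy_coproductComplex g' fun p =>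
      nonempty_homotopy_of_isKProjective _ (by
        rw [← cancel_epi (e p).inv, Functor.map_comp, hg', ← Category.assoc, ← Category.assoc, hg,
          comp_zero, zero_comp])
    rw [← cancel_mono (Q.objObjPreimageIso X).inv, ← hg', Q_map_eq_zero_of_homotopy h, zero_comp]
  · obtain ⟨y, rfl⟩ := (homologyQIso (coproductComplex I) s).symm.toLinearEquiv.surjective x
    refine homology_coproductComplex_induction (U.comap
      (homologyQIso (coproductComplex I) s).inv.hom.toAddMonoidHom) (fun p z => ?_) y
    have := hU p ((homologyModule s).map (e p).hom ((homologyQIso (I p) s).inv z))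
    rw [← ModuleCat.comp_apply, ← ModuleCat.comp_apply, ← Functor.map_comp, Iso.hom_inv_id_assoc,
      homologyFunctor_map_Q_map, Iso.inv_hom_id_assoc] at this
    exact this
  · refine ⟨fun p => Q.map (coproductComplexπ I p) ≫ (e p).hom, fun p => ?_, fun p q hpq => ?_,
      fun s x hx => ?_⟩
    · rw [Category.assoc, ← Functor.map_comp_assoc, coproductComplexι_comp_π_self]
      simp
    · rw [Category.assoc, ← Functor.map_comp_assoc, coproductComplexι_comp_π_of_ne hpq]
      simp
    · refine (homologyQIso (coproductComplex I) s).toLinearEquiv.injective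
        ((homology_coproductComplex_eq_zero _ fun p => ?_).trans (map_zero _).symm)
      have := hx p
      rw [Functor.map_comp, homologyFunctor_map_Q_map] at this
      refine ((homologyQIso (I p) s).symm ≪≫
        (homologyModule s).mapIso (e p)).toLinearEquiv.injective (this.trans (map_zero _).symm)

end Resolvable

/-! ### Existence of resolutions by homotopy limits and colimits. -/

section Towers

open DerivedCategory

variable {R : Type u} [Ring R] [HasDerivedCategory.{w} (ModuleCat.{u} R)]
  {X Y Z : DerivedCategory (ModuleCat.{u} R)}

lemma homologyModule_map_comp_apply (f : X ⟶ Y) (g : Y ⟶ Z) (s : ℤ)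
    (x : (homologyModule s).obj X) :
    (homologyModule s).map (f ≫ g) x = (homologyModule s).map g ((homologyModule s).map f x) := by
  rw [Functor.map_comp]
  rfl

lemma homologyModule_map_sub_apply (f g : X ⟶ Y) (s : ℤ) (x : (homologyModule s).obj X) :
    (homologyModule s).map (f - g) x = (homologyModule s).map f x - (homologyModule s).map g x := by
  rw [Functor.map_sub]
  rfl

lemma homologyModule_map_zero_apply (s : ℤ) (x : (homologyModule s).obj X) :
    (homologyModule s).map (0 : X ⟶ Y) x = 0 := by
  rw [Functor.map_zero]
  rfl

lemma isIso_iff_bijective_homology (f : X ⟶ Y) :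
    IsIso f ↔ ∀ s, Function.Bijective ((homologyModule s).map f) := by
  rw [isIso_iff]
  exact forall_congr' fun s => ConcreteCategory.isIso_iff_bijective _

lemma exists_homology_eq_of_distTriang {t : Triangle (DerivedCategory (ModuleCat.{u} R))}
    (ht : t ∈ distTriang _) (s : ℤ) (y : (homologyModule s).obj t.obj₂)
    (hy : (homologyModule s).map t.mor₂ y = 0) :
    ∃ x, (homologyModule s).map t.mor₁ x = y :=
  (ShortComplex.moduleCat_exact_iff _).1 (HomologySequence.exact₂ t ht s) y hy

/-- The difference of the identity and the shift of a tower, on its product. -/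
lemma IsHomologyProduct.exists_one_sub_shift {T : ℕ → DerivedCategory (ModuleCat.{u} R)}
    {W : DerivedCategory (ModuleCat.{u} R)} {π : ∀ p, W ⟶ T p} (hW : IsHomologyProduct T W π)
    (r : ∀ p, T (p + 1) ⟶ T p) : ∃ θ : W ⟶ W, ∀ p, θ ≫ π p = π p - π (p + 1) ≫ r p :=
  hW.exists_lift _

/-- The object $X$ is the homotopy limit of the tower, that is, the fiber of identity minus shift on
the product. In homology the image of each transition map lies in the image of $X$, so the tower
satisfies a one-step Mittag-Leffler condition: identity minus shift is surjective, and its kernel of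
compatible families is $H^s(X)$. -/
lemma HasInjectiveModel.of_tower {T : ℕ → DerivedCategory (ModuleCat.{u} R)}
    (hT : ∀ p, HasInjectiveModel (T p)) (r : ∀ p, T (p + 1) ⟶ T p) (x : ∀ p, X ⟶ T p)
    (hx : ∀ p, x (p + 1) ≫ r p = x p)
    (hinj : ∀ p s, Function.Injective ((homologyModule s).map (x p)))
    (him : ∀ p s (y : (homologyModule s).obj (T (p + 1))),
      ∃ z, (homologyModule s).map (x p) z = (homologyModule s).map (r p) y) :
    HasInjectiveModel X := by
  obtain ⟨W, π, hWi, hW⟩ := exists_isHomologyProduct hT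
  obtain ⟨θ, hθ⟩ := hW.exists_one_sub_shift r
  obtain ⟨y, hy⟩ := hW.exists_lift x
  have hyθ : y ≫ θ = 0 := hW.eq_zero _ fun p => by
    rw [Category.assoc, hθ, Preadditive.comp_sub, ← Category.assoc, hy, hy, hx, sub_self]
  have hθ' (s : ℤ) (w : (homologyModule s).obj W) (p : ℕ) :
      (homologyModule s).map (π p) ((homologyModule s).map θ w) =
        (homologyModule s).map (π p) w -
          (homologyModule s).map (r p) ((homologyModule s).map (π (p + 1)) w) := by
    rw [← homologyModule_map_comp_apply, hθ, homologyModule_map_sub_apply,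
      homologyModule_map_comp_apply]
  have hy' (s : ℤ) (z : (homologyModule s).obj X) (p : ℕ) :
      (homologyModule s).map (π p) ((homologyModule s).map y z) =
        (homologyModule s).map (x p) z := by
    rw [← homologyModule_map_comp_apply, hy]
  obtain ⟨I, ι, h, ht⟩ := distinguished_cocone_triangle₁ θ
  obtain ⟨ψ, hψ⟩ : ∃ ψ : X ⟶ I, y = ψ ≫ ι := Triangle.coyoneda_exact₂ _ ht y hyθ
  have hepi (s : ℤ) : Epi ((homologyFunctor (ModuleCat.{u} R) s).map θ) := by
    refine (ModuleCat.epi_iff_surjective _).2 fun u => ?_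
    choose z hz using fun p => him p s ((homologyModule s).map (π (p + 1)) u)
    -- A preimage of $u$ is sought as $u_p+x_p(a_p)$. With $r_p(u_{p+1})=x_p(z_p)$, the requirement
    -- becomes $x_p(a_p-z_p-a_{p+1})=0$, which this recursion satisfies.
    let a : ℕ → (homologyModule s).obj X := Nat.rec 0 fun p b => b - z p
    obtain ⟨t, ht⟩ := (hW.bijective s).2 fun p =>
      (homologyModule s).map (π p) u + (homologyModule s).map (x p) (a p)
    refine ⟨t, (hW.bijective s).1 (funext fun p => ?_)⟩
    have htp := fun p => congrFun ht p
    dsimp only at htp ⊢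
    rw [hθ', htp, htp, map_add, ← hz, ← homologyModule_map_comp_apply, hx,
      show a (p + 1) = a p - z p from rfl, map_sub]
    abel
  have hmono (s : ℤ) : Function.Injective ((homologyModule s).map ι) :=
    (ModuleCat.mono_iff_injective _).1 ((forall_epi_homology_iff_forall_mono ht).1 hepi s)
  have hψ' : IsIso ψ := by
    rw [isIso_iff_bijective_homology]
    refine fun s => ⟨fun a b hab => hinj 0 s ?_, fun c => ?_⟩
    · rw [← hy', ← hy', hψ, homologyModule_map_comp_apply, homologyModule_map_comp_apply, hab]
    · set w := (homologyModule s).map ι c with hw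
      have hw0 : (homologyModule s).map θ w = 0 := by
        rw [hw, ← homologyModule_map_comp_apply,
          show ι ≫ θ = 0 from comp_distTriang_mor_zero₁₂ _ ht, homologyModule_map_zero_apply]
      have hwr (p : ℕ) : (homologyModule s).map (π p) w =
          (homologyModule s).map (r p) ((homologyModule s).map (π (p + 1)) w) := by
        rw [← sub_eq_zero, ← hθ', hw0, map_zero]
      choose z hz using fun p => him p s ((homologyModule s).map (π (p + 1)) w)
      -- A compatible family comes at each stage from some $z_p\in H^s(X)$. Injectivity on homology
      -- of $X\to T_p$ makes all the $z_p$ equal.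
      have hzz (p : ℕ) : z p = z 0 := by
        induction p with
        | zero => rfl
        | succ p ih =>
          rw [← ih]
          apply hinj p s
          rw [hz, ← hx, homologyModule_map_comp_apply, hz, ← hwr]
      refine ⟨z 0, hmono s ((hW.bijective s).1 (funext fun p => ?_))⟩
      dsimp only
      rw [← homologyModule_map_comp_apply ψ, ← hψ, hy', ← hzz p, hz, ← hwr]
  exact (HasInjectiveModel.fiber ht hWi hWi).of_iso (asIso ψ).symm

/-- Here $X$ is the homotopy colimit, the cone of identity minus shift on the direct sum. Its
homology is the colimit of the homologies of the stages: surjectivity onto $H^s(X)$ already holds at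
stage zero, and a class that dies in $X$ dies one stage later. -/
lemma HasProjectiveModel.of_tower {T : ℕ → DerivedCategory (ModuleCat.{u} R)}
    (hT : ∀ p, HasProjectiveModel (T p)) (j : ∀ p, T p ⟶ T (p + 1)) (v : ∀ p, T p ⟶ X)
    (hv : ∀ p, j p ≫ v (p + 1) = v p)
    (hsurj : ∀ s, Function.Surjective ((homologyModule s).map (v 0)))
    (hker : ∀ p s (y : (homologyModule s).obj (T p)), (homologyModule s).map (v p) y = 0 →
      (homologyModule s).map (j p) y = 0) :
    HasProjectiveModel X := by
  obtain ⟨S, ι, hSp, hS⟩ := exists_isHomologyCoproduct hT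
  obtain ⟨π, hπ, hπ', hπ''⟩ := hS.exists_proj
  obtain ⟨θ, hθ⟩ := hS.exists_desc fun p => ι p - j p ≫ ι (p + 1)
  obtain ⟨y, hy⟩ := hS.exists_desc v
  have hyθ : θ ≫ y = 0 := hS.eq_zero _ fun p => by
    rw [← Category.assoc, hθ, Preadditive.sub_comp, Category.assoc, hy, hy, hv, sub_self]
  have hθ' (s : ℤ) (p : ℕ) (w : (homologyModule s).obj (T p)) :
      (homologyModule s).map θ ((homologyModule s).map (ι p) w) =
        (homologyModule s).map (ι p) w -
          (homologyModule s).map (ι (p + 1)) ((homologyModule s).map (j p) w) := by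
    rw [← homologyModule_map_comp_apply, hθ, homologyModule_map_sub_apply,
      homologyModule_map_comp_apply]
  have hy' (s : ℤ) (p : ℕ) (w : (homologyModule s).obj (T p)) :
      (homologyModule s).map y ((homologyModule s).map (ι p) w) =
        (homologyModule s).map (v p) w := by
    rw [← homologyModule_map_comp_apply, hy]
  obtain ⟨C, c, h, ht⟩ := distinguished_cocone_triangle θ
  obtain ⟨ψ, hψ⟩ : ∃ ψ : C ⟶ X, y = c ≫ ψ := Triangle.yoneda_exact₂ _ ht y hyθ
  have hθπ₀ : θ ≫ π 0 = π 0 := by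
    rw [← sub_eq_zero]
    refine hS.eq_zero _ fun p => ?_
    rw [Preadditive.comp_sub, ← Category.assoc, hθ, Preadditive.sub_comp, Category.assoc,
      hπ' (p + 1) 0 (by simp)]
    simp
  have hθπ (p : ℕ) : θ ≫ π (p + 1) = π (p + 1) - π p ≫ j p := by
    rw [← sub_eq_zero]
    refine hS.eq_zero _ fun q => ?_
    rw [Preadditive.comp_sub, ← Category.assoc, hθ, Preadditive.sub_comp, Category.assoc,
      Preadditive.comp_sub]
    by_cases hpq : q = p
    · subst hpq
      rw [hπ, ← Category.assoc, hπ]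
      simp
    · rw [hπ' (q + 1) (p + 1) (by simpa using hpq), ← Category.assoc, hπ' q p hpq]
      simp
  -- The coordinates of $\theta(w)$ are $w_0$ and $w_{p+1}-j_p(w_p)$, so $\theta(w)=0$ forces
  -- $w_p=0$ successively.
  have hmono (s : ℤ) : Mono ((homologyFunctor (ModuleCat.{u} R) s).map θ) := by
    refine (ModuleCat.mono_iff_injective _).2 ((injective_iff_map_eq_zero _).2 fun w hw => ?_)
    refine hπ'' s w fun p => ?_
    induction p with
    | zero =>
      rw [← hθπ₀, homologyModule_map_comp_apply]
      exact (congrArg _ hw).trans (map_zero _)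
    | succ p ih =>
      have := congrArg ((homologyModule s).map (π (p + 1))) hw
      rw [map_zero] at this
      have h' : (homologyModule s).map (θ ≫ π (p + 1)) w = 0 := by
        rw [homologyModule_map_comp_apply]
        exact this
      rw [hθπ, homologyModule_map_sub_apply, homologyModule_map_comp_apply, ih, map_zero,
        sub_zero] at h'
      exact h'
  have hepi (s : ℤ) : Function.Surjective ((homologyModule s).map c) :=
    (ModuleCat.epi_iff_surjective _).1 ((forall_epi_homology_iff_forall_mono ht).2 hmono s)
  have hcθ (s : ℤ) (a : (homologyModule s).obj S) :
      (homologyModule s).map c ((homologyModule s).map θ a) = 0 := by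
    rw [← homologyModule_map_comp_apply, show θ ≫ c = 0 from comp_distTriang_mor_zero₁₂ _ ht,
      homologyModule_map_zero_apply]
  have hstep (s : ℤ) (p : ℕ) (w : (homologyModule s).obj (T p)) :
      (homologyModule s).map c ((homologyModule s).map (ι p) w) =
        (homologyModule s).map c
          ((homologyModule s).map (ι (p + 1)) ((homologyModule s).map (j p) w)) := by
    rw [← sub_eq_zero, ← map_sub, ← hθ', hcθ]
  -- In the cone, a class from stage $p$ equals its image at every later stage. Hence a finite sum
  -- of classes can be moved to one common stage.
  have hstep' (s : ℤ) (p k : ℕ) (w : (homologyModule s).obj (T p)) :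
      ∃ w', (homologyModule s).map c ((homologyModule s).map (ι p) w) =
        (homologyModule s).map c ((homologyModule s).map (ι (p + k)) w') := by
    induction k with
    | zero => exact ⟨w, rfl⟩
    | succ k ih =>
      obtain ⟨w', hw'⟩ := ih
      exact ⟨_, hw'.trans (hstep s (p + k) w')⟩
  have hrep (s : ℤ) (a : (homologyModule s).obj S) : ∃ p w, (homologyModule s).map c a =
      (homologyModule s).map c ((homologyModule s).map (ι p) w) := by
    refine hS.homology_induction s
      { carrier := {a | ∃ p w, (homologyModule s).map c a =
          (homologyModule s).map c ((homologyModule s).map (ι p) w)}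
        zero_mem' := ⟨0, 0, by simp⟩
        add_mem' := ?_
        neg_mem' := ?_ } (fun p x => ⟨p, x, rfl⟩) a
    · rintro a b ⟨p, w, hw⟩ ⟨q, w', hw'⟩
      obtain ⟨w₁, hw₁⟩ := hstep' s p q w
      obtain ⟨w₂, hw₂⟩ := add_comm q p ▸ hstep' s q p w'
      exact ⟨p + q, w₁ + w₂, by rw [map_add, hw, hw₁, hw', hw₂, ← map_add, ← map_add]⟩
    · rintro a ⟨p, w, hw⟩
      exact ⟨p, -w, by rw [map_neg, hw, map_neg, map_neg]⟩
  have hψ' : IsIso ψ := by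
    rw [isIso_iff_bijective_homology]
    refine fun s => ⟨(injective_iff_map_eq_zero _).2 fun a ha => ?_, fun b => ?_⟩
    · obtain ⟨a, rfl⟩ := hepi s a
      obtain ⟨p, w, hw⟩ := hrep s a
      rw [hw, ← homologyModule_map_comp_apply, ← hψ, hy'] at ha
      rw [hw, hstep, hker p s w ha, map_zero, map_zero]
    · obtain ⟨w, rfl⟩ := hsurj s b
      exact ⟨(homologyModule s).map c ((homologyModule s).map (ι 0) w), by
        rw [← homologyModule_map_comp_apply, ← hψ, hy']⟩
  exact (HasProjectiveModel.cone ht hSp hSp).of_iso (asIso ψ)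

/-- $T'$ is the fiber of $T\to C\to K$, where $C$ is the cone of $x$ and $C\to K$ is injective on
homology. A class coming from $T'$ vanishes in $H(K)$, hence in $H(C)$, hence comes from $X$. The
extra term $K$ has injectives and zero differential, so the model persists. -/
lemma exists_injective_tower_step {T : DerivedCategory (ModuleCat.{u} R)}
    (hT : HasInjectiveModel T) (x : X ⟶ T) :
    ∃ (T' : DerivedCategory (ModuleCat.{u} R)) (r : T' ⟶ T) (x' : X ⟶ T'),
      HasInjectiveModel T' ∧ x' ≫ r = x ∧ ∀ s (y : (homologyModule s).obj T'),
        ∃ z, (homologyModule s).map x z = (homologyModule s).map r y := by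
  obtain ⟨C, g, h, ht⟩ := distinguished_cocone_triangle x
  obtain ⟨K, f, hd, hi, hf⟩ := exists_injective_zeroDifferential C
  obtain ⟨T', r, h', ht'⟩ := distinguished_cocone_triangle₁ (g ≫ f)
  obtain ⟨x', hx'⟩ : ∃ x', x = x' ≫ r := Triangle.coyoneda_exact₂ _ ht' x (by
    change x ≫ g ≫ f = 0
    rw [← Category.assoc, show x ≫ g = 0 from comp_distTriang_mor_zero₁₂ _ ht, zero_comp])
  refine ⟨T', r, x', HasInjectiveModel.fiber ht' hT
    ⟨K, isKInjective_of_d_eq_zero hd, hi, ⟨Iso.refl _⟩⟩, hx'.symm, fun s y => ?_⟩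
  refine exists_homology_eq_of_distTriang ht s _ ((ModuleCat.mono_iff_injective _).1 (hf s) ?_)
  change (homologyModule s).map f ((homologyModule s).map g ((homologyModule s).map r y)) =
    (homologyModule s).map f 0
  rw [map_zero, ← homologyModule_map_comp_apply, ← homologyModule_map_comp_apply,
    show r ≫ g ≫ f = 0 from comp_distTriang_mor_zero₁₂ _ ht', homologyModule_map_zero_apply]

/-- A complex of projectives with zero differential is mapped onto the homology of the fiber of $v$,
and its image in $T$ is coned off. This kills in one step all homology classes of $T$ that vanish in
$X$. -/
lemma exists_projective_tower_step {T : DerivedCategory (ModuleCat.{u} R)}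
    (hT : HasProjectiveModel T) (v : T ⟶ X) :
    ∃ (T' : DerivedCategory (ModuleCat.{u} R)) (j : T ⟶ T') (v' : T' ⟶ X),
      HasProjectiveModel T' ∧ j ≫ v' = v ∧ ∀ s (y : (homologyModule s).obj T),
        (homologyModule s).map v y = 0 → (homologyModule s).map j y = 0 := by
  obtain ⟨F, g, h, ht⟩ := distinguished_cocone_triangle₁ v
  obtain ⟨K, f, hd, hi, hf⟩ := exists_projective_zeroDifferential F
  obtain ⟨T', j, h', ht'⟩ := distinguished_cocone_triangle (f ≫ g)
  obtain ⟨v', hv'⟩ : ∃ v', v = j ≫ v' := Triangle.yoneda_exact₂ _ ht' v (by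
    change (f ≫ g) ≫ v = 0
    rw [Category.assoc, show g ≫ v = 0 from comp_distTriang_mor_zero₁₂ _ ht, comp_zero])
  refine ⟨T', j, v', HasProjectiveModel.cone ht'
    ⟨K, isKProjective_of_d_eq_zero hd, hi, ⟨Iso.refl _⟩⟩ hT, hv'.symm, fun s y hy => ?_⟩
  obtain ⟨a, ha⟩ := exists_homology_eq_of_distTriang ht s y hy
  obtain ⟨b, hb⟩ := (ModuleCat.epi_iff_surjective _).1 (hf s) a
  rw [← ha, ← hb]
  change (homologyModule s).map j ((homologyModule s).map g ((homologyModule s).map f b)) = 0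
  rw [← homologyModule_map_comp_apply, ← homologyModule_map_comp_apply, ← Category.assoc,
    show (f ≫ g) ≫ j = 0 from comp_distTriang_mor_zero₁₂ _ ht', homologyModule_map_zero_apply]

/-- Every object of `D(R)` is represented by a K-injective complex of injectives. -/
theorem hasInjectiveModel (X : DerivedCategory (ModuleCat.{u} R)) : HasInjectiveModel X := by
  let S := Σ' T : DerivedCategory (ModuleCat.{u} R), {_x : X ⟶ T // HasInjectiveModel T}
  have hstep (q : S) : ∃ (q' : S) (r : q'.1 ⟶ q.1), q'.2.1 ≫ r = q.2.1 ∧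
      ∀ s (y : (homologyModule s).obj q'.1),
        ∃ z, (homologyModule s).map q.2.1 z = (homologyModule s).map r y := by
    obtain ⟨T, x, hT⟩ := q
    obtain ⟨T', r, x', hT', h₁, h₂⟩ := exists_injective_tower_step hT x
    exact ⟨⟨T', x', hT'⟩, r, h₁, h₂⟩
  choose F r h₁ h₂ using hstep
  obtain ⟨K, f, hd, hi, hf⟩ := exists_injective_zeroDifferential X
  let q : ℕ → S := Nat.rec ⟨Q.obj K, f, K, isKInjective_of_d_eq_zero hd, hi, ⟨Iso.refl _⟩⟩
    fun _ q => F q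
  refine HasInjectiveModel.of_tower (T := fun p => (q p).1) (fun p => (q p).2.2)
    (fun p => r (q p)) (fun p => (q p).2.1) (fun p => h₁ (q p)) (fun p s => ?_)
    (fun p s => h₂ (q p) s)
  -- Injectivity is arranged at stage zero only; it passes upwards because the map to stage $p$
  -- factors through stage $p+1$.
  induction p with
  | zero => exact (ModuleCat.mono_iff_injective _).1 (hf s)
  | succ p ih =>
    intro a b hab
    apply ih
    dsimp only
    rw [← h₁ (q p), homologyModule_map_comp_apply, homologyModule_map_comp_apply]
    exact congrArg _ hab

/-- Every object of `D(R)` is represented by a K-projective complex of projectives. -/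
theorem hasProjectiveModel (X : DerivedCategory (ModuleCat.{u} R)) : HasProjectiveModel X := by
  let S := Σ' T : DerivedCategory (ModuleCat.{u} R), {_x : T ⟶ X // HasProjectiveModel T}
  have hstep (q : S) : ∃ (q' : S) (j : q.1 ⟶ q'.1), j ≫ q'.2.1 = q.2.1 ∧
      ∀ s (y : (homologyModule s).obj q.1), (homologyModule s).map q.2.1 y = 0 →
        (homologyModule s).map j y = 0 := by
    obtain ⟨T, x, hT⟩ := q
    obtain ⟨T', r, x', hT', h₁, h₂⟩ := exists_projective_tower_step hT x
    exact ⟨⟨T', x', hT'⟩, r, h₁, h₂⟩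
  choose F r h₁ h₂ using hstep
  obtain ⟨K, f, hd, hi, hf⟩ := exists_projective_zeroDifferential X
  let q : ℕ → S := Nat.rec ⟨Q.obj K, f, K, isKProjective_of_d_eq_zero hd, hi, ⟨Iso.refl _⟩⟩
    fun _ q => F q
  exact HasProjectiveModel.of_tower (T := fun p => (q p).1) (fun p => (q p).2.2)
    (fun p => r (q p)) (fun p => (q p).2.1) (fun p => h₁ (q p))
    (fun s => (ModuleCat.epi_iff_surjective _).1 (hf s)) (fun p s => h₂ (q p) s)

end Towers

/-! ### Morphisms that vanish on homology. -/

section GhostVanishing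

open DerivedCategory

variable {R : Type u} [Ring R] [HasDerivedCategory.{w} (ModuleCat.{u} R)]

/-- The homology of a shift. -/
noncomputable def homologyShiftIso (Y : DerivedCategory (ModuleCat.{u} R)) (n a b : ℤ)
    (h : n + a = b) : (homologyModule a).obj (Y⟦n⟧) ≅ (homologyModule b).obj Y :=
  ((homologyFunctor (ModuleCat.{u} R) 0).shiftIso n a b h).app Y

lemma IsHomologyCofree.of_retract {E Y : DerivedCategory (ModuleCat.{u} R)} (r : Retract E Y)
    (hY : IsHomologyCofree Y) : IsHomologyCofree E where
  injective s := by
    have := hY.injective s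
    exact (r.map (homologyFunctor (ModuleCat.{u} R) s)).injective
  eq_zero f hf := by
    rw [← Category.comp_id f, ← r.retract, ← Category.assoc,
      hY.eq_zero (f ≫ r.i) (fun s => by rw [Functor.map_comp, hf, zero_comp]), zero_comp]
  exists_map {Z} φ := by
    obtain ⟨f, hf⟩ := hY.exists_map (fun s => φ s ≫ (homologyFunctor (ModuleCat.{u} R) s).map r.i)
    refine ⟨f ≫ r.r, fun s => ?_⟩
    rw [Functor.map_comp, hf, Category.assoc, ← Functor.map_comp, r.retract,
      CategoryTheory.Functor.map_id, Category.comp_id]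

lemma isHomologyCofree_shift_Q {K : CochainComplex (ModuleCat.{u} R) ℤ}
    (hd : ∀ i j, K.d i j = 0) [∀ n, Injective (K.X n)] (n : ℤ) :
    IsHomologyCofree ((Q.obj K)⟦n⟧) := by
  have hi (i : ℤ) : Injective ((K⟦n⟧).X i) := inferInstanceAs (Injective (K.X (i + n)))
  exact IsHomologyCofree.of_retract (((Q.commShiftIso n).symm.app K).retract)
    (isHomologyCofree_Q (K := K⟦n⟧) fun i j => by
      rw [CochainComplex.shiftFunctor_obj_d', hd]
      exact smul_zero n.negOnePow)

variable {A B : ObjectProperty (ModuleCat.{u} R)}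

/-- Embed $Y[-1]$ on homology into an object $E$ with injective homology and take the cone $Y'$;
heredity keeps its homology in $\mathsf B$, and $Y'\to Y$ is zero on homology. The lift of $\varphi$
to $Y'$ need not be zero on homology. Vanishing of $\mathrm{Ext}^1$ between the homology of $X$ and
that of $Y[-1]$ lets it be corrected by a morphism through $E$, which does not change the composite
to $Y$. -/
lemma IsCompleteHereditaryCotorsionPair.exists_ghost_step
    (h : IsCompleteHereditaryCotorsionPair A B) {X Y : DerivedCategory (ModuleCat.{u} R)}
    (hX : ∀ s, A ((homologyModule s).obj X)) (hY : ∀ s, B ((homologyModule s).obj Y))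
    (φ : X ⟶ Y) (hφ : ∀ s, (homologyModule s).map φ = 0) :
    ∃ (Y' : DerivedCategory (ModuleCat.{u} R)) (r : Y' ⟶ Y) (φ' : X ⟶ Y'),
      (∀ s, B ((homologyModule s).obj Y')) ∧ (∀ s, (homologyModule s).map r = 0) ∧
      (∀ s, (homologyModule s).map φ' = 0) ∧ φ' ≫ r = φ := by
  obtain ⟨K, e, hd, hi, he⟩ := exists_injective_zeroDifferential (Y⟦(-1 : ℤ)⟧)
  obtain ⟨Y', p, v, ht⟩ := distinguished_cocone_triangle e
  have hcof := isHomologyCofree_Q hd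
  have hp := (forall_epi_homology_iff_forall_mono ht).2 he
  have hv := (forall_epi_homology_iff_mor₃ ht).1 hp
  have hS := homology_shortExact ht hp
  have hB (s : ℤ) : B ((homologyModule s).obj (Y⟦(-1 : ℤ)⟧)) :=
    h.right_of_iso (homologyShiftIso Y (-1) s (s - 1) (by lia)).symm (hY _)
  let i : (Y⟦(-1 : ℤ)⟧)⟦(1 : ℤ)⟧ ≅ Y := (shiftEquiv _ (1 : ℤ)).counitIso.app Y
  -- The obstruction to lifting is zero on homology, and its target is homology-cofree, so it is
  -- zero.
  obtain ⟨ψ, hψ⟩ : ∃ ψ : X ⟶ Y', φ ≫ i.inv = ψ ≫ v := Triangle.coyoneda_exact₁ _ ht _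
    ((isHomologyCofree_shift_Q hd 1).eq_zero _ fun s => by
      change (homologyModule s).map ((φ ≫ i.inv) ≫ e⟦(1 : ℤ)⟧') = 0
      rw [Functor.map_comp, Functor.map_comp, hφ, zero_comp, zero_comp])
  have hlift (s : ℤ) : ∃ k : (homologyModule s).obj X ⟶ (homologyModule s).obj (Q.obj K),
      k ≫ (homologyModule s).map p = (homologyModule s).map ψ :=
    exists_lift_of_subsingleton_ext (hS s) (h.subsingleton_ext (hX s) (hB s)) _
  choose k hk using hlift
  obtain ⟨c, hc⟩ := hcof.exists_map k
  refine ⟨Y', v ≫ i.hom, ψ - c ≫ p, fun s => ?_, fun s => ?_, fun s => ?_, ?_⟩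
  · have := hcof.injective s
    exact h.hereditary_right _ (hS s) (hB s)
      (h.right_of_injective ((homologyModule s).obj (Q.obj K)))
  · rw [Functor.map_comp]
    exact (congrArg (· ≫ _) (hv s)).trans zero_comp
  · rw [Functor.map_sub, Functor.map_comp, hc, hk, sub_self]
  · rw [Preadditive.sub_comp, ← Category.assoc, ← hψ, Category.assoc, Category.assoc,
      ← Category.assoc p, show p ≫ v = 0 from comp_distTriang_mor_zero₂₃ _ ht]
    simp

/-- A morphism vanishing on homology is zero, if its source has homology in the left class and
its target has homology in the right class of a complete hereditary cotorsion pair. -/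
theorem IsCompleteHereditaryCotorsionPair.eq_zero_of_homology
    (h : IsCompleteHereditaryCotorsionPair A B) {X Y : DerivedCategory (ModuleCat.{u} R)}
    (hX : ∀ s, A ((homologyModule s).obj X)) (hY : ∀ s, B ((homologyModule s).obj Y))
    (φ : X ⟶ Y) (hφ : ∀ s, (homologyModule s).map φ = 0) : φ = 0 := by
  let S := Σ' Y : DerivedCategory (ModuleCat.{u} R), {φ : X ⟶ Y //
    (∀ s, B ((homologyModule s).obj Y)) ∧ ∀ s, (homologyModule s).map φ = 0}
  have hstep (q : S) : ∃ (q' : S) (r : q'.1 ⟶ q.1), q'.2.1 ≫ r = q.2.1 ∧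
      ∀ s, (homologyModule s).map r = 0 := by
    obtain ⟨Y, φ, hY, hφ⟩ := q
    obtain ⟨Y', r, φ', hY', hr, hφ', h'⟩ := h.exists_ghost_step hX hY φ hφ
    exact ⟨⟨Y', φ', hY', hφ'⟩, r, h', hr⟩
  choose F r h₁ h₂ using hstep
  let q : ℕ → S := Nat.rec ⟨Y, φ, hY, hφ⟩ fun _ q => F q
  obtain ⟨W, π, -, hW⟩ := exists_isHomologyProduct (T := fun p => (q p).1)
    fun p => hasInjectiveModel _
  obtain ⟨θ, hθ⟩ := hW.exists_one_sub_shift fun p => r (q p)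
  obtain ⟨y, hy⟩ := hW.exists_lift fun p => (q p).2.1
  have hyθ : y ≫ θ = 0 := hW.eq_zero _ fun p => by
    rw [Category.assoc, hθ, Preadditive.comp_sub, ← Category.assoc, hy, hy]
    exact sub_eq_zero.2 (h₁ (q p)).symm
  -- The transition maps are zero on homology, so identity minus shift induces the identity there
  -- and is an isomorphism. The family of lifts of $\varphi$ is annihilated by it, hence vanishes.
  have hθ' (s : ℤ) : (homologyModule s).map θ = 𝟙 _ := by
    ext w
    refine (hW.bijective s).1 (funext fun p => ?_)
    dsimp only
    refine (homologyModule_map_comp_apply _ _ _ _).symm.trans ?_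
    rw [hθ, homologyModule_map_sub_apply, Functor.map_comp, h₂, comp_zero]
    exact sub_zero _
  have : IsIso θ := by
    rw [isIso_iff]
    intro s
    rw [show (homologyFunctor _ s).map θ = 𝟙 _ from hθ' s]
    infer_instance
  have hy0 : y = 0 := by rwa [← cancel_mono θ, zero_comp]
  exact (hy 0).symm.trans (by rw [hy0, zero_comp])

end GhostVanishing

/-! ### The two classes of $\mathrm{D}(R)$ described by homology. -/

section Characterization

open DerivedCategory HomologicalComplex

variable {R : Type u} [Ring R]

/-- This is the sequence $0\to H^s\to K^s/B^s\to B^{s+1}\to 0$, with the coboundaries $B^{s+1}$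
written as the kernel of $K^{s+1}\to K^{s+1}/B^{s+1}$. -/
lemma shortExact_homology_opcycles (K : CochainComplex (ModuleCat.{u} R) ℤ) (s : ℤ) :
    ∃ (p : K.opcycles s ⟶ kernel (K.pOpcycles (s + 1))) (w : K.homologyι s ≫ p = 0),
      (ShortComplex.mk (K.homologyι s) p w).ShortExact := by
  have h₀ : K.fromOpcycles s (s + 1) ≫ K.pOpcycles (s + 1) = 0 := by
    rw [← cancel_epi (K.pOpcycles s), p_fromOpcycles_assoc, d_pOpcycles, comp_zero]
  have hw : K.homologyι s ≫ kernel.lift _ _ h₀ = 0 := by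
    rw [← cancel_mono (kernel.ι _), Category.assoc, kernel.lift_ι, homologyι_comp_fromOpcycles,
      zero_comp]
  refine ⟨kernel.lift _ _ h₀, hw, ?_⟩
  have hker := K.homologyIsKernel s (s + 1) (by simp)
  refine { exact := ?_, mono_f := inferInstance, epi_g := ?_ }
  · rw [ShortComplex.moduleCat_exact_iff]
    intro x hx
    have := ShortComplex.exact_of_f_is_kernel (ShortComplex.mk _ _
      (K.homologyι_comp_fromOpcycles s (s + 1))) hker
    refine (ShortComplex.moduleCat_exact_iff _).1 this x ?_
    have := congr(kernel.ι (K.pOpcycles (s + 1)) $hx)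
    rw [map_zero] at this
    rw [← this]
    exact congr($((kernel.lift_ι _ _ h₀).symm) x)
  · refine (ModuleCat.epi_iff_surjective _).2 fun y => ?_
    have hex := ShortComplex.exact_of_g_is_cokernel (ShortComplex.mk _ _
      (K.d_pOpcycles s (s + 1))) (K.opcyclesIsCokernel s (s + 1) (by simp))
    obtain ⟨x, hx⟩ := (ShortComplex.moduleCat_exact_iff _).1 hex
      (kernel.ι (K.pOpcycles (s + 1)) y) congr($(kernel.condition (K.pOpcycles (s + 1))) y)
    refine ⟨K.pOpcycles s x, (ModuleCat.mono_iff_injective (kernel.ι _)).1 inferInstance ?_⟩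
    rw [← hx]
    change (K.pOpcycles s ≫ kernel.lift _ _ h₀ ≫ kernel.ι _) x = K.d s (s + 1) x
    rw [kernel.lift_ι, p_fromOpcycles]

/-- This is the sequence $0\to B^{s+1}\to Z^{s+1}\to H^{s+1}\to 0$, with the coboundaries written as
$K^s/Z^s$. -/
lemma shortExact_cycles_homology (K : CochainComplex (ModuleCat.{u} R) ℤ) (s : ℤ) :
    ∃ (i : cokernel (K.iCycles s) ⟶ K.cycles (s + 1)) (w : i ≫ K.homologyπ (s + 1) = 0),
      (ShortComplex.mk i (K.homologyπ (s + 1)) w).ShortExact := by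
  have h₀ : K.iCycles s ≫ K.toCycles s (s + 1) = 0 := by
    rw [← cancel_mono (K.iCycles (s + 1)), Category.assoc, toCycles_i, iCycles_d, zero_comp]
  have hw : cokernel.desc _ _ h₀ ≫ K.homologyπ (s + 1) = 0 := by
    rw [← cancel_epi (cokernel.π _), cokernel.π_desc_assoc, toCycles_comp_homologyπ, comp_zero]
  refine ⟨cokernel.desc _ _ h₀, hw, ?_⟩
  have hker := K.homologyIsCokernel s (s + 1) (by simp)
  refine { exact := ?_, mono_f := ?_, epi_g := inferInstance }
  · rw [ShortComplex.moduleCat_exact_iff]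
    intro x hx
    have := ShortComplex.exact_of_g_is_cokernel (ShortComplex.mk _ _
      (K.toCycles_comp_homologyπ s (s + 1))) hker
    obtain ⟨y, hy⟩ := (ShortComplex.moduleCat_exact_iff _).1 this x hx
    refine ⟨cokernel.π (K.iCycles s) y, ?_⟩
    rw [← hy]
    exact congr($(cokernel.π_desc _ _ h₀) y)
  · refine (ModuleCat.mono_iff_injective _).2 ((injective_iff_map_eq_zero _).2 fun y hy => ?_)
    obtain ⟨x, rfl⟩ := (ModuleCat.epi_iff_surjective (cokernel.π (K.iCycles s))).1 inferInstance y
    have hex := ShortComplex.exact_of_f_is_kernel (ShortComplex.mk _ _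
      (K.iCycles_d s (s + 1))) (K.cyclesIsKernel s (s + 1) (by simp))
    obtain ⟨z, hz⟩ := (ShortComplex.moduleCat_exact_iff _).1 hex x (by
      have h := congr(K.iCycles (s + 1) $hy)
      rw [map_zero] at h
      rw [← h]
      change K.d s (s + 1) x =
        (cokernel.π (K.iCycles s) ≫ cokernel.desc _ _ h₀ ≫ K.iCycles (s + 1)) x
      rw [cokernel.π_desc_assoc, toCycles_i])
    rw [← hz]
    exact congr($(cokernel.condition (K.iCycles s)) z)

/-- The opcycles of a cochain complex as a cokernel. -/
noncomputable def opcyclesIsoCokernel (K : CochainComplex (ModuleCat.{u} R) ℤ) (s : ℤ) :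
    K.opcycles s ≅ cokernel (K.d (s - 1) s) :=
  (K.opcyclesIsCokernel (s - 1) s (by simp)).coconePointUniqueUpToIso (colimit.isColimit _)

/-- The cycles of a cochain complex as a kernel. -/
noncomputable def cyclesIsoKernel (K : CochainComplex (ModuleCat.{u} R) ℤ) (s : ℤ) :
    K.cycles s ≅ kernel (K.d s (s + 1)) :=
  (K.cyclesIsKernel s (s + 1) (by simp)).conePointUniqueUpToIso (limit.isLimit _)

variable [HasDerivedCategory.{w} (ModuleCat.{u} R)] {A B : ObjectProperty (ModuleCat.{u} R)}

namespace IsCompleteHereditaryCotorsionPair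

/-- Heredity is used twice: the coboundaries are the kernel of a surjection from a projective module
onto a cokernel in $\mathsf A$, and the homology is then the kernel of a surjection from a cokernel
in $\mathsf A$ onto those coboundaries. -/
lemma left_homology_of_projClass (h : IsCompleteHereditaryCotorsionPair A B)
    {Y : DerivedCategory (ModuleCat.{u} R)} (hY : projClass A Y) (s : ℤ) :
    A ((homologyModule s).obj Y) := by
  obtain ⟨K, P, f, ⟨e⟩, hP, hf, hA⟩ := hY
  refine h.left_of_iso ((homologyQIso P s).symm ≪≫ (homologyModule s).mapIso
    (asIso (Q.map f) ≪≫ e)) ?_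
  have hO (s : ℤ) : A (P.opcycles s) := h.left_of_iso (opcyclesIsoCokernel P s).symm (hA s)
  have := hP.projective (s + 1)
  obtain ⟨p, w, hS⟩ := shortExact_homology_opcycles P s
  exact h.hereditary_left _ hS (hO s) (h.hereditary_left _ (shortExact_kernel (P.pOpcycles (s + 1)))
    (h.left_of_projective (P.X (s + 1))) (hO _))

lemma right_homology_of_injClass (h : IsCompleteHereditaryCotorsionPair A B)
    {Y : DerivedCategory (ModuleCat.{u} R)} (hY : injClass B Y) (s : ℤ) :
    B ((homologyModule s).obj Y) := by
  obtain ⟨K, I, f, ⟨e⟩, hI, hf, hB⟩ := hY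
  refine h.right_of_iso ((homologyQIso I s).symm ≪≫ (homologyModule s).mapIso
    ((asIso (Q.map f)).symm ≪≫ e)) ?_
  have hO (s : ℤ) : B (I.cycles s) := h.right_of_iso (cyclesIsoKernel I s).symm (hB s)
  obtain ⟨s, rfl⟩ : ∃ t, s = t + 1 := ⟨s - 1, by simp⟩
  have := hI.injective s
  obtain ⟨p, w, hS⟩ := shortExact_cycles_homology I s
  exact h.hereditary_right _ hS (h.hereditary_right _ (shortExact_cokernel (I.iCycles s))
    (hO s) (h.right_of_injective (I.X s))) (hO _)

lemma right_homology_single (h : IsCompleteHereditaryCotorsionPair A B) {N : ModuleCat.{u} R}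
    (hN : B N) (n s : ℤ) :
    B ((homologyModule s).obj (Q.obj ((single (ModuleCat.{u} R) (.up ℤ) n).obj N))) := by
  refine h.right_of_iso (homologyQIso _ s).symm ?_
  by_cases hs : s = n
  · subst hs
    exact h.right_of_iso (singleObjHomologySelfIso (.up ℤ) s N).symm hN
  · have := (isZero_single_obj_homology (.up ℤ) n N s hs).injective
    exact h.right_of_injective _

lemma left_homology_single (h : IsCompleteHereditaryCotorsionPair A B) {N : ModuleCat.{u} R}
    (hN : A N) (n s : ℤ) :
    A ((homologyModule s).obj (Q.obj ((single (ModuleCat.{u} R) (.up ℤ) n).obj N))) := by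
  refine h.left_of_iso (homologyQIso _ s).symm ?_
  by_cases hs : s = n
  · subst hs
    exact h.left_of_iso (singleObjHomologySelfIso (.up ℤ) s N).symm hN
  · have := (isZero_single_obj_homology (.up ℤ) n N s hs).projective
    exact h.left_of_projective _

/-- For $N\in\mathsf B$ one must extend a map $g$ from the coboundaries in $P^s$ to all of $P^s$.
Composed with the differential, $g$ becomes a morphism from $P$ to $N$ in degree $s-1$ that kills
cocycles. The vanishing theorem makes it zero in $\mathrm{D}(R)$, hence null-homotopic, and the
homotopy is the extension. -/
lemma left_cokernel_of_isKProjective (h : IsCompleteHereditaryCotorsionPair A B)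
    (P : CochainComplex (ModuleCat.{u} R) ℤ) [P.IsKProjective] [∀ n, Projective (P.X n)]
    (hP : ∀ s, A ((homologyModule s).obj (Q.obj P))) (s : ℤ) :
    A (cokernel (P.d (s - 1) s)) := by
  rw [← h.leftPerp_eq]
  intro N hN
  refine subsingleton_ext_of_exists_extension (shortExact_kernel (cokernel.π (P.d (s - 1) s)))
    fun g => ?_
  change kernel (cokernel.π (P.d (s - 1) s)) ⟶ N at g
  let δ : P.X (s - 1) ⟶ kernel (cokernel.π (P.d (s - 1) s)) :=
    kernel.lift _ _ (cokernel.condition _)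
  have hδ : δ ≫ kernel.ι _ = P.d (s - 1) s := kernel.lift_ι _ _ _
  have hδ' (i : ℤ) : P.d i (s - 1) ≫ δ = 0 := by
    rw [← cancel_mono (kernel.ι _), Category.assoc, hδ, P.d_comp_d, zero_comp]
  have : Epi δ := (ShortComplex.exact_iff_epi_kernel_lift (ShortComplex.mk _ _
    (cokernel.condition (P.d (s - 1) s)))).1 (ShortComplex.exact_of_g_is_cokernel _
      (cokernelIsCokernel _))
  let F : P ⟶ (single (ModuleCat.{u} R) (.up ℤ) (s - 1)).obj N :=
    mkHomToSingle (δ ≫ g) fun i _ => by rw [← Category.assoc, hδ', zero_comp]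
  have hF : F.f (s - 1) = (δ ≫ g) ≫ (singleObjXSelf (.up ℤ) (s - 1) N).inv :=
    mkHomToSingle_f _ _
  have hF0 : Q.map F = 0 := by
    refine h.eq_zero_of_homology hP (h.right_homology_single hN _) _ fun t => ?_
    rw [homologyFunctor_map_Q_map]
    suffices homologyMap F t = 0 by rw [this, zero_comp, comp_zero]
    by_cases ht : t = s - 1
    · subst ht
      ext x
      obtain ⟨⟨z, hz₀⟩, rfl⟩ := homologyClass_surjective _ _ x
      refine (homologyMap_homologyClass _ _ _).trans ((homologyClass_eq_zero_iff _ _ _).2 ⟨0, ?_⟩)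
      rw [map_zero, mapCocycle_coe, hF]
      have hz : δ z = 0 := by
        refine (ModuleCat.mono_iff_injective (kernel.ι _)).1 inferInstance ?_
        rw [map_zero]
        refine (congr($hδ z)).trans ?_
        have : P.d (s - 1) (s - 1 + 1) z = 0 := hz₀
        have e : s - 1 + 1 = s := by simp
        rwa [e] at this
      change 0 = (singleObjXSelf (.up ℤ) (s - 1) N).inv (g (δ z))
      rw [hz, map_zero, map_zero]
    · exact (isZero_single_obj_homology (.up ℤ) (s - 1) N t ht).eq_of_tgt _ _
  obtain ⟨H⟩ := nonempty_homotopy_of_isKProjective F hF0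
  -- The target has zero differential, so only the component of the homotopy on $P^s$ survives.
  have hH := H.comm (s - 1)
  rw [dNext_eq _ (show (ComplexShape.up ℤ).Rel (s - 1) s by simp),
    prevD_eq _ (show (ComplexShape.up ℤ).Rel (s - 1 - 1) (s - 1) by simp), hF,
    single_obj_d, comp_zero, add_zero, zero_f, add_zero, Iso.comp_inv_eq, Category.assoc] at hH
  refine ⟨H.hom s (s - 1) ≫ (singleObjXSelf (.up ℤ) (s - 1) N).hom, ?_⟩
  change kernel.ι _ ≫ _ = g
  rw [← cancel_epi δ, ← Category.assoc δ, hδ, hH]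

/-- Dually, a map from $N\in\mathsf A$ to $I^s/Z^s$ gives a morphism from $N$ in degree $s+1$ to $I$
with values in coboundaries. It is null-homotopic by the vanishing theorem, and the homotopy lifts
the map to $I^s$. -/
lemma right_kernel_of_isKInjective (h : IsCompleteHereditaryCotorsionPair A B)
    (I : CochainComplex (ModuleCat.{u} R) ℤ) [I.IsKInjective] [∀ n, Injective (I.X n)]
    (hI : ∀ s, B ((homologyModule s).obj (Q.obj I))) (s : ℤ) :
    B (kernel (I.d s (s + 1))) := by
  rw [← h.rightPerp_eq]
  intro N hN
  refine subsingleton_ext_of_exists_lift (shortExact_cokernel (kernel.ι (I.d s (s + 1))))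
    fun g => ?_
  change N ⟶ cokernel (kernel.ι (I.d s (s + 1))) at g
  let δ : cokernel (kernel.ι (I.d s (s + 1))) ⟶ I.X (s + 1) :=
    cokernel.desc _ _ (kernel.condition _)
  have hδ : cokernel.π _ ≫ δ = I.d s (s + 1) := cokernel.π_desc _ _ _
  have hδ' (i : ℤ) : δ ≫ I.d (s + 1) i = 0 := by
    rw [← cancel_epi (cokernel.π _), ← Category.assoc, hδ, I.d_comp_d, comp_zero]
  have : Mono δ := (ShortComplex.exact_iff_mono_cokernel_desc (ShortComplex.mk _ _
    (kernel.condition (I.d s (s + 1))))).1 (ShortComplex.exact_of_f_is_kernel _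
      (kernelIsKernel _))
  let F : (single (ModuleCat.{u} R) (.up ℤ) (s + 1)).obj N ⟶ I :=
    mkHomFromSingle (g ≫ δ) fun i _ => by rw [Category.assoc, hδ', comp_zero]
  have hF : F.f (s + 1) = (singleObjXSelf (.up ℤ) (s + 1) N).hom ≫ g ≫ δ :=
    mkHomFromSingle_f _ _
  have hF0 : Q.map F = 0 := by
    refine h.eq_zero_of_homology (h.left_homology_single hN _) hI _ fun t => ?_
    rw [homologyFunctor_map_Q_map]
    suffices homologyMap F t = 0 by rw [this, zero_comp, comp_zero]
    by_cases ht : t = s + 1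
    · subst ht
      ext x
      obtain ⟨z, rfl⟩ := homologyClass_surjective _ _ x
      refine (homologyMap_homologyClass _ _ _).trans ((homologyClass_eq_zero_iff _ _ _).2 ?_)
      obtain ⟨y, hy⟩ := (ModuleCat.epi_iff_surjective (cokernel.π (kernel.ι (I.d s (s + 1))))).1
        inferInstance (g ((singleObjXSelf (.up ℤ) (s + 1) N).hom z.1))
      have hy' : I.d s (s + 1) y = F.f (s + 1) z.1 := by
        rw [hF]
        exact (congr($(hδ.symm) y)).trans (congrArg δ hy)
      have e : s + 1 - 1 = s := by simp
      rw [mapCocycle_coe, e]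
      exact ⟨y, hy'⟩
    · exact (isZero_single_obj_homology (.up ℤ) (s + 1) N t ht).eq_of_src _ _
  obtain ⟨H⟩ := nonempty_homotopy_of_isKInjective F hF0
  have hH := H.comm (s + 1)
  rw [dNext_eq _ (show (ComplexShape.up ℤ).Rel (s + 1) (s + 1 + 1) by simp),
    prevD_eq _ (show (ComplexShape.up ℤ).Rel s (s + 1) by simp), hF,
    single_obj_d, zero_comp, zero_add, zero_f, add_zero, ← Iso.eq_inv_comp] at hH
  refine ⟨(singleObjXSelf (.up ℤ) (s + 1) N).inv ≫ H.hom (s + 1) s, ?_⟩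
  change _ ≫ cokernel.π _ = g
  rw [← cancel_mono δ, Category.assoc, hδ, hH, Category.assoc]

/-- The class attached to the left class of a complete hereditary cotorsion pair consists of the
objects with homology in that class. -/
theorem projClass_iff (h : IsCompleteHereditaryCotorsionPair A B)
    (Y : DerivedCategory (ModuleCat.{u} R)) :
    projClass A Y ↔ ∀ s, A ((homologyModule s).obj Y) := by
  refine ⟨h.left_homology_of_projClass, fun hY => ?_⟩
  obtain ⟨P, hP, hP', ⟨e⟩⟩ := hasProjectiveModel Y
  exact ⟨P, P, 𝟙 P, ⟨e⟩, isSemiProjective_of_isKProjective P, inferInstance,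
    h.left_cokernel_of_isKProjective P fun s =>
      h.left_of_iso ((homologyModule s).mapIso e.symm) (hY s)⟩

/-- The class attached to the right class of a complete hereditary cotorsion pair consists of the
objects with homology in that class. -/
theorem injClass_iff (h : IsCompleteHereditaryCotorsionPair A B)
    (Y : DerivedCategory (ModuleCat.{u} R)) :
    injClass B Y ↔ ∀ s, B ((homologyModule s).obj Y) := by
  refine ⟨h.right_homology_of_injClass, fun hY => ?_⟩
  obtain ⟨I, hI, hI', ⟨e⟩⟩ := hasInjectiveModel Y
  exact ⟨I, I, 𝟙 I, ⟨e⟩, isSemiInjective_of_isKInjective I, inferInstance,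
    h.right_kernel_of_isKInjective I fun s =>
      h.right_of_iso ((homologyModule s).mapIso e.symm) (hY s)⟩

end IsCompleteHereditaryCotorsionPair

end Characterization

/-! ### Complexes with prescribed cocycles and coboundaries. -/

section HomologyClass

variable {R : Type u} [Ring R] (K : CochainComplex (ModuleCat.{u} R) ℤ)

lemma homologyClass_succ_eq_zero_iff (s : ℤ) (z : LinearMap.ker (K.d (s + 1) (s + 1 + 1)).hom) :
    homologyClass K (s + 1) z = 0 ↔ ∃ w : K.X s, K.d s (s + 1) w = z.1 := by
  rw [homologyClass_eq_zero_iff]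
  have e : s + 1 - 1 = s := by simp
  rw [e]

lemma d_mem_range (i j k : ℤ) (h : i = j) (x : K.X i) :
    K.d i k x ∈ LinearMap.range (K.d j k).hom := by
  subst h
  exact ⟨x, rfl⟩

lemma exists_factorization_of_surjective {X Y M : ModuleCat.{u} R} (f : X ⟶ Y)
    (hf : Function.Surjective f) (g : X ⟶ M) (h : ∀ x, f x = 0 → g x = 0) :
    ∃ k : Y ⟶ M, f ≫ k = g := by
  have : Epi f := (ModuleCat.epi_iff_surjective _).2 hf
  have h0 : kernel.ι f ≫ g = 0 := by
    ext x
    exact h _ congr($(kernel.condition f) x)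
  exact ⟨(shortExact_kernel f).exact.desc g h0, (shortExact_kernel f).exact.g_desc g h0⟩

end HomologyClass

section GluedComplex

variable {R : Type u} [Ring R] {B Z E N : ℤ → ModuleCat.{u} R} (k : ∀ s, B s ⟶ Z s)
  (j : ∀ s, Z s ⟶ E s) (q : ∀ s, E s ⟶ N s) (τ : ∀ s, B (s + 1) ⟶ N s)
  (hjq : ∀ s, j s ≫ q s = 0)

/-- The pullback of `q s` and `τ s`. -/
abbrev gluedX (s : ℤ) : ModuleCat.{u} R :=
  ModuleCat.of R (LinearMap.eqLocus ((q s).hom ∘ₗ LinearMap.fst R (E s) (B (s + 1)))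
    ((τ s).hom ∘ₗ LinearMap.snd R (E s) (B (s + 1))))

/-- The differential of the glued complex. -/
def gluedD (s : ℤ) : gluedX q τ s ⟶ gluedX q τ (s + 1) :=
  ModuleCat.ofHom (LinearMap.codRestrict _
    (LinearMap.prod ((k (s + 1) ≫ j (s + 1)).hom ∘ₗ LinearMap.snd R (E s) (B (s + 1)) ∘ₗ
      Submodule.subtype _) 0) fun y => by
        change q (s + 1) (j (s + 1) (k (s + 1) y.1.2)) = τ (s + 1) 0
        rw [map_zero]
        exact congr($(hjq (s + 1)) (k (s + 1) y.1.2)))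

lemma gluedD_apply (s : ℤ) (y : gluedX q τ s) :
    (gluedD k j q τ hjq s y).1 = (j (s + 1) (k (s + 1) y.1.2), 0) := rfl

/-- The complex obtained by gluing the modules `B (s + 1)` to the modules `Z s`. -/
def gluedComplex : CochainComplex (ModuleCat.{u} R) ℤ :=
  CochainComplex.of (gluedX q τ) (gluedD k j q τ hjq) fun s => by
    refine ModuleCat.hom_ext (LinearMap.ext fun y => Subtype.ext ?_)
    change (gluedD k j q τ hjq (s + 1) (gluedD k j q τ hjq s y)).1 = 0
    rw [gluedD_apply, gluedD_apply]
    simp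

lemma gluedComplex_d (s : ℤ) : (gluedComplex k j q τ hjq).d s (s + 1) = gluedD k j q τ hjq s :=
  CochainComplex.of_d _ _ _

lemma mem_ker_gluedComplex_d_iff (hj : ∀ s, Function.Injective (j s))
    (hk : ∀ s, Function.Injective (k s)) (s : ℤ) (y : gluedX q τ s) :
    y ∈ LinearMap.ker ((gluedComplex k j q τ hjq).d s (s + 1)).hom ↔ y.1.2 = 0 := by
  rw [gluedComplex_d]
  constructor
  · intro h
    have : (gluedD k j q τ hjq s y).1 = 0 := congrArg Subtype.val h
    rw [gluedD_apply] at this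
    refine hk _ (hj _ ?_)
    rw [map_zero, map_zero]
    exact congrArg Prod.fst this
  · intro h
    refine Subtype.ext ?_
    refine (gluedD_apply k j q τ hjq s y).trans ?_
    rw [h, map_zero, map_zero]
    rfl

/-- The cocycles of the glued complex attached to the elements of `Z s`. -/
def gluedCocycle (hj : ∀ s, Function.Injective (j s)) (hk : ∀ s, Function.Injective (k s))
    (s : ℤ) : Z s →ₗ[R] LinearMap.ker ((gluedComplex k j q τ hjq).d s (s + 1)).hom :=
  LinearMap.codRestrict _ (LinearMap.codRestrict (LinearMap.eqLocus
    ((q s).hom ∘ₗ LinearMap.fst R (E s) (B (s + 1)))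
    ((τ s).hom ∘ₗ LinearMap.snd R (E s) (B (s + 1)))) (LinearMap.prod (j s).hom 0) fun z => by
      change q s (j s z) = τ s 0
      rw [map_zero]
      exact congr($(hjq s) z)) fun z =>
        (mem_ker_gluedComplex_d_iff k j q τ hjq hj hk s _).2 rfl

variable (hj : ∀ s, Function.Injective (j s)) (hk : ∀ s, Function.Injective (k s))

/-- The degree-$s$ term is an extension of $B_{s+1}$ by $Z_s$, pulled back from $E_s\to N_s$, and
the differential is the projection to $B_{s+1}$ followed by its inclusion into $Z_{s+1}$. So $Z_s$
is the module of cocycles and $B_s$ that of coboundaries. -/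
lemma shortExact_homology_gluedComplex (hq : ∀ s, Function.Surjective (q s))
    (hex : ∀ s (x : E s), q s x = 0 → ∃ z, j s z = x) (s : ℤ) :
    ∃ w : k s ≫ ModuleCat.ofHom (homologyClass (gluedComplex k j q τ hjq) s ∘ₗ
      gluedCocycle k j q τ hjq hj hk s) = 0, (ShortComplex.mk _ _ w).ShortExact := by
  obtain ⟨s, rfl⟩ : ∃ t, s = t + 1 := ⟨s - 1, by simp⟩
  have key (z : Z (s + 1)) : homologyClass (gluedComplex k j q τ hjq) (s + 1)
      (gluedCocycle k j q τ hjq hj hk (s + 1) z) = 0 ↔ ∃ b, k (s + 1) b = z := by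
    rw [homologyClass_succ_eq_zero_iff, gluedComplex_d]
    constructor
    · rintro ⟨w, hw⟩
      refine ⟨w.1.2, hj _ ?_⟩
      exact congrArg (fun y : gluedX q τ (s + 1) => y.1.1) hw
    · rintro ⟨b, rfl⟩
      -- Surjectivity of $q$ completes every $b$ to an element of the pullback, so all of $B_{s+1}$
      -- occurs as coboundaries.
      obtain ⟨e, he⟩ := hq s (τ s b)
      exact ⟨⟨(e, b), he⟩, rfl⟩
  refine ⟨?_, ?_⟩
  · ext b
    exact (key _).2 ⟨b, rfl⟩
  · refine { exact := ?_, mono_f := (ModuleCat.mono_iff_injective _).2 (hk _), epi_g := ?_ }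
    · rw [ShortComplex.moduleCat_exact_iff]
      exact fun z hz => (key z).1 hz
    · refine (ModuleCat.epi_iff_surjective _).2 fun x => ?_
      obtain ⟨⟨y, hy⟩, rfl⟩ := homologyClass_surjective _ _ x
      change gluedX q τ (s + 1) at y
      have hy2 := (mem_ker_gluedComplex_d_iff k j q τ hjq hj hk _ y).1 hy
      obtain ⟨z, hz⟩ := hex (s + 1) y.1.1 (by
        refine (show q (s + 1) y.1.1 = τ (s + 1) y.1.2 from y.2).trans ?_
        rw [hy2, map_zero])
      refine ⟨z, congrArg (homologyClass _ (s + 1)) (Subtype.ext (Subtype.ext ?_))⟩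
      exact Prod.ext hz hy2.symm

lemma exists_hom_gluedComplex {X : CochainComplex (ModuleCat.{u} R) ℤ} (ε : ∀ s, X.X s ⟶ E s)
    (β : ∀ s, X.X s ⟶ B (s + 1)) (hε : ∀ s, ε s ≫ q s = β s ≫ τ s)
    (hβ : ∀ s, X.d s (s + 1) ≫ β (s + 1) = 0)
    (hβ' : ∀ s, X.d s (s + 1) ≫ ε (s + 1) = β s ≫ k (s + 1) ≫ j (s + 1)) :
    ∃ φ : X ⟶ gluedComplex k j q τ hjq, ∀ s x
      (hx : x ∈ LinearMap.ker (X.d s (s + 1)).hom) (z : Z s),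
      j s z = ε s x → β s x = 0 → HomologicalComplex.homologyMap φ s (homologyClass X s ⟨x, hx⟩) =
        homologyClass _ s (gluedCocycle k j q τ hjq hj hk s z) := by
  let f (s : ℤ) : X.X s ⟶ gluedX q τ s := ModuleCat.ofHom (LinearMap.codRestrict _
    (LinearMap.prod (ε s).hom (β s).hom) fun x => congr($(hε s) x))
  have hf (s : ℤ) (x : X.X s) : (f s x).1 = (ε s x, β s x) := rfl
  refine ⟨{ f := f
            comm' := fun i l hil => ?_ }, fun s x hx z hz hz' => ?_⟩
  · obtain rfl : i + 1 = l := hil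
    rw [gluedComplex_d]
    ext x
    refine Subtype.ext ?_
    refine (gluedD_apply k j q τ hjq i (f i x)).trans (Eq.trans ?_ (hf _ _).symm)
    exact Prod.ext congr($((hβ' i).symm) x) congr($((hβ i).symm) x)
  · rw [homologyMap_homologyClass]
    refine congrArg (homologyClass _ s) (Subtype.ext (Subtype.ext ?_))
    exact Prod.ext hz.symm hz'

end GluedComplex

/-! ### Approximating a complex by one with homology in the right class. -/

section RightApproximation

variable {R : Type u} [Ring R] {A B : ObjectProperty (ModuleCat.{u} R)}

namespace IsCompleteHereditaryCotorsionPair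

/-- A monomorphism embeds into a monomorphism between modules in the right class, with
cokernels in the left class. -/
lemma exists_special_embedding (h : IsCompleteHereditaryCotorsionPair A B)
    {M Z : ModuleCat.{u} R} (i : M ⟶ Z) (hi : Function.Injective i) :
    ∃ (M' Z' W : ModuleCat.{u} R) (α : M ⟶ M') (k : M' ⟶ Z') (l : Z ⟶ Z') (p : Z' ⟶ W),
      B M' ∧ B Z' ∧ A W ∧ α ≫ k = i ≫ l ∧ Function.Injective k ∧ Function.Surjective p ∧
      (∀ z, p z = 0 ↔ ∃ m y, k m + l y = z) ∧ (∀ m y, k m = l y → ∃ c, i c = y) ∧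
      ∀ (N : ModuleCat.{u} R) (f : M ⟶ N), B N → ∃ g : M' ⟶ N, α ≫ g = f := by
  obtain ⟨M', V, α, v, hv, hS, hV, hM'⟩ := h.enough_right M
  -- The quotient $P$ by this antidiagonal image is the pushout of $M'$ and $Z$ over $M$. A second
  -- special embedding, of $P$ into $Z'$, makes the cokernel $W$ of the whole construction lie in
  -- $\mathsf A$.
  let U : Submodule R (M' × Z) := LinearMap.range (LinearMap.prod α.hom (-i.hom))
  let P := ModuleCat.of R ((M' × Z) ⧸ U)
  obtain ⟨Z', W, j, p, hp, hS', hW, hZ'⟩ := h.enough_right P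
  have hj : Function.Injective j := (ModuleCat.mono_iff_injective _).1 hS'.mono_f
  let a : M' ⟶ P := ModuleCat.ofHom (U.mkQ ∘ₗ LinearMap.inl R M' Z)
  let b : Z ⟶ P := ModuleCat.ofHom (U.mkQ ∘ₗ LinearMap.inr R M' Z)
  have hab (m : M') (y : Z) : a m = b y ↔ ∃ c, α c = m ∧ i c = y := by
    refine (Submodule.Quotient.eq U).trans ?_
    constructor
    · rintro ⟨c, hc⟩
      refine ⟨c, ?_, ?_⟩
      · simpa using congrArg Prod.fst hc
      · simpa using congrArg Prod.snd hc
    · rintro ⟨c, rfl, rfl⟩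
      exact ⟨c, Prod.ext (by simp) (by simp)⟩
  refine ⟨M', Z', W, α, a ≫ j, b ≫ j, p, hM', hZ', hW, ?_, ?_, ?_, fun z => ?_, fun m y hmy => ?_,
    fun N f hN => exists_extension_of_subsingleton_ext hS (h.subsingleton_ext hV hN) f⟩
  · rw [← Category.assoc, ← Category.assoc]
    congr 1
    ext c
    exact (hab _ _).2 ⟨c, rfl, rfl⟩
  · refine hj.comp ((injective_iff_map_eq_zero a.hom).2 fun m hm => ?_)
    obtain ⟨c, rfl, hc⟩ := (hab m 0).1 (by rw [map_zero]; exact hm)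
    obtain rfl : c = 0 := hi (by rw [hc, map_zero])
    exact map_zero _
  · exact (ModuleCat.epi_iff_surjective _).1 hS'.epi_g
  · constructor
    · intro hz
      obtain ⟨x, rfl⟩ := (ShortComplex.moduleCat_exact_iff _).1 hS'.exact z hz
      obtain ⟨⟨m, y⟩, rfl⟩ := U.mkQ_surjective x
      refine ⟨m, y, ?_⟩
      change j (a m) + j (b y) = j _
      rw [← map_add]
      congr 1
      change U.mkQ _ + U.mkQ _ = _
      rw [← map_add]
      simp
    · rintro ⟨m, y, rfl⟩
      change p (j (a m) + j (b y)) = 0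
      rw [← map_add]
      exact congr($hp _)
  · obtain ⟨c, -, hc⟩ := (hab m y).1 (hj hmy)
    exact ⟨c, hc⟩

/-- Every complex embeds, on homology, into a complex with homology in the right class, with
cokernels in the left class. -/
lemma exists_right_approximation (h : IsCompleteHereditaryCotorsionPair A B)
    (X : CochainComplex (ModuleCat.{u} R) ℤ) :
    ∃ (Y : CochainComplex (ModuleCat.{u} R) ℤ) (φ : X ⟶ Y), ∀ s, B (Y.homology s) ∧
      ∃ (W : ModuleCat.{u} R) (p : Y.homology s ⟶ W)
        (w : HomologicalComplex.homologyMap φ s ≫ p = 0),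
        (ShortComplex.mk _ _ w).ShortExact ∧ A W := by
  have hle (s : ℤ) : LinearMap.range (X.d (s - 1) s).hom ≤ LinearMap.ker (X.d s (s + 1)).hom := by
    rintro _ ⟨x, rfl⟩
    exact congr($(X.d_comp_d (s - 1) s (s + 1)) x)
  let i (s : ℤ) : ModuleCat.of R (LinearMap.range (X.d (s - 1) s).hom) ⟶
    ModuleCat.of R (LinearMap.ker (X.d s (s + 1)).hom) :=
      ModuleCat.ofHom (Submodule.inclusion (hle s))
  have hi (s : ℤ) : Function.Injective (i s) := Submodule.inclusion_injective (hle s)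
  -- The construction is applied to the inclusion of coboundaries in cocycles of $X$. The new
  -- homology will be $Z_s/M_s$, which contains $H^s(X)$ with quotient $W_s$.
  choose M Z W α k l p hM hZ hW hαk hk hp hpz hkl hext using
    fun s => h.exists_special_embedding (i s) (hi s)
  obtain ⟨E, j, hE, hjm⟩ : ∃ (E : ℤ → ModuleCat.{u} R) (j : ∀ s, Z s ⟶ E s),
      (∀ s, Injective (E s)) ∧ ∀ s, Mono (j s) :=
    ⟨fun s => Injective.under (Z s), fun s => Injective.ι _, inferInstance, inferInstance⟩
  have hj (s : ℤ) : Function.Injective (j s) := (ModuleCat.mono_iff_injective _).1 (hjm s)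
  obtain ⟨N, q, hjq, hS⟩ : ∃ (N : ℤ → ModuleCat.{u} R) (q : ∀ s, E s ⟶ N s)
      (hjq : ∀ s, j s ≫ q s = 0), ∀ s, (ShortComplex.mk _ _ (hjq s)).ShortExact :=
    ⟨fun s => cokernel (j s), fun s => cokernel.π _, fun s => cokernel.condition _,
      fun s => shortExact_cokernel _⟩
  have hN (s : ℤ) : B (N s) := h.hereditary_right _ (hS s) (hZ s) (h.right_of_injective (E s))
  have hq (s : ℤ) : Function.Surjective (q s) := (ModuleCat.epi_iff_surjective _).1 (hS s).epi_g
  have hex (s : ℤ) (x : E s) (hx : q s x = 0) : ∃ z, j s z = x :=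
    (ShortComplex.moduleCat_exact_iff _).1 (hS s).exact x hx
  have hε (s : ℤ) : ∃ ε : X.X s ⟶ E s,
      ModuleCat.ofHom (LinearMap.ker (X.d s (s + 1)).hom).subtype ≫ ε = l s ≫ j s :=
    exists_extension_of_injective _ _ fun x hx => by
      obtain rfl : x = 0 := Subtype.ext hx
      exact map_zero _
  choose ε hε using hε
  let b (s : ℤ) : X.X s ⟶ ModuleCat.of R (LinearMap.range (X.d (s + 1 - 1) (s + 1)).hom) :=
    ModuleCat.ofHom (LinearMap.codRestrict _ (X.d s (s + 1)).hom
      (d_mem_range X s (s + 1 - 1) (s + 1) (by simp)))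
  have hb (s : ℤ) (x : X.X s) : (b s x).1 = X.d s (s + 1) x := rfl
  have hbs (s : ℤ) : Function.Surjective (b s) := by
    rintro ⟨y, hy⟩
    obtain ⟨x, rfl⟩ := hy
    obtain ⟨x', hx'⟩ := d_mem_range X (s + 1 - 1) s (s + 1) (by simp) x
    exact ⟨x', Subtype.ext hx'⟩
  have hεl (s : ℤ) (x : X.X s) (hx : x ∈ LinearMap.ker (X.d s (s + 1)).hom) :
      j s (l s ⟨x, hx⟩) = ε s x := congr($((hε s).symm) ⟨x, hx⟩)
  -- Each $X^s$ is an extension of its coboundaries in degree $s+1$ by its cocycles. Pushed out to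
  -- $Z_s$, this extension is classified by a map $\sigma$ from those coboundaries to $N_s=E_s/Z_s$.
  have hσ (s : ℤ) : ∃ σ, b s ≫ σ = ε s ≫ q s :=
    exists_factorization_of_surjective _ (hbs s) _ fun x hx => by
      have hx' : x ∈ LinearMap.ker (X.d s (s + 1)).hom := congrArg Subtype.val hx
      refine (congrArg (q s) (hεl s x hx').symm).trans ?_
      exact congr($(hjq s) _)
  choose σ hσ using hσ
  -- Since $N_s\in\mathsf B$, the classifying map extends to $M_{s+1}$. The extended map supplies
  -- the gluing data for which $X$ maps to the glued complex.
  choose τ hτ using fun s => hext (s + 1) (N s) (σ s) (hN s)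
  obtain ⟨φ, hφ⟩ := exists_hom_gluedComplex k j q τ hjq hj hk ε (fun s => b s ≫ α (s + 1))
    (fun s => by rw [Category.assoc, hτ, hσ]) (fun s => by
      have : X.d s (s + 1) ≫ b (s + 1) = 0 := by
        ext x
        exact congr($(X.d_comp_d s (s + 1) (s + 1 + 1)) x)
      rw [← Category.assoc, this, zero_comp]) (fun s => by
      rw [Category.assoc, ← Category.assoc (α _), hαk]
      ext x
      exact (hεl (s + 1) (X.d s (s + 1) x)
        congr($(X.d_comp_d s (s + 1) (s + 1 + 1)) x)).symm)
  refine ⟨_, φ, fun s => ?_⟩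
  obtain ⟨hw, hY⟩ := shortExact_homology_gluedComplex k j q τ hjq hj hk hq hex s
  let c : Z s ⟶ (gluedComplex k j q τ hjq).homology s := ModuleCat.ofHom
    (homologyClass (gluedComplex k j q τ hjq) s ∘ₗ gluedCocycle k j q τ hjq hj hk s)
  have hc : Function.Surjective c := (ModuleCat.epi_iff_surjective _).1 hY.epi_g
  have hc0 (z : Z s) (hz : c z = 0) : ∃ m, k s m = z :=
    (ShortComplex.moduleCat_exact_iff _).1 hY.exact z hz
  have hck (m : M s) : c (k s m) = 0 := congr($hw m)
  have hφ' (x : X.X s) (hx : x ∈ LinearMap.ker (X.d s (s + 1)).hom) :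
      HomologicalComplex.homologyMap φ s (homologyClass X s ⟨x, hx⟩) = c (l s ⟨x, hx⟩) := by
    refine hφ s x hx _ (hεl s x hx) ?_
    have : b s x = 0 := Subtype.ext hx
    exact (congrArg (α (s + 1)) this).trans (map_zero _)
  refine ⟨h.hereditary_right _ hY (hM s) (hZ s), W s, ?_⟩
  obtain ⟨p', hp'⟩ := exists_factorization_of_surjective c hc (p s) fun z hz => by
    obtain ⟨m, rfl⟩ := hc0 z hz
    exact (hpz s _).2 ⟨m, 0, by simp⟩
  have hp'' (z : Z s) : p' (c z) = p s z := congr($hp' z)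
  have hzero : HomologicalComplex.homologyMap φ s ≫ p' = 0 := by
    ext y
    obtain ⟨⟨x, hx⟩, rfl⟩ := homologyClass_surjective _ _ y
    change p' (HomologicalComplex.homologyMap φ s _) = 0
    rw [hφ', hp'']
    exact (hpz s _).2 ⟨0, ⟨x, hx⟩, by simp⟩
  refine ⟨p', hzero, { exact := ?_, mono_f := ?_, epi_g := ?_ }, hW s⟩
  · rw [ShortComplex.moduleCat_exact_iff]
    intro y hy
    obtain ⟨z, rfl⟩ := hc y
    obtain ⟨m, ⟨x, hx⟩, rfl⟩ := (hpz s z).1 ((hp'' z).symm.trans hy)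
    refine ⟨homologyClass X s ⟨x, hx⟩, (hφ' x hx).trans ?_⟩
    rw [map_add, hck, zero_add]
  · refine (ModuleCat.mono_iff_injective _).2 ((injective_iff_map_eq_zero _).2 fun y hy => ?_)
    obtain ⟨⟨x, hx⟩, rfl⟩ := homologyClass_surjective _ _ y
    obtain ⟨m, hm⟩ := hc0 _ ((hφ' x hx).symm.trans hy)
    -- Inside the pushout the enlarged coboundaries meet the old cocycles only in old coboundaries,
    -- so no homology of $X$ is lost.
    obtain ⟨⟨y, w, hw⟩, hy⟩ := hkl s m _ hm
    refine (homologyClass_eq_zero_iff _ _ _).2 ⟨w, ?_⟩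
    exact hw.trans (congrArg Subtype.val hy)
  · refine (ModuleCat.epi_iff_surjective _).2 fun y => ?_
    obtain ⟨z, rfl⟩ := hp s y
    exact ⟨c z, hp'' z⟩

end IsCompleteHereditaryCotorsionPair

end RightApproximation

/-! ### The cotorsion pair in $\mathrm{D}(R)$. -/

section Forward

open DerivedCategory

variable {R : Type u} [Ring R]

lemma nonempty_iso_of_surjective {Y M N : ModuleCat.{u} R} (f : Y ⟶ M) (g : Y ⟶ N)
    (hf : Function.Surjective f) (hg : Function.Surjective g) (h : ∀ y, f y = 0 ↔ g y = 0) :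
    Nonempty (M ≅ N) := by
  have e : LinearMap.ker f.hom = LinearMap.ker g.hom := Submodule.ext h
  exact ⟨((f.hom.quotKerEquivOfSurjective hf).symm.trans ((Submodule.quotEquivOfEq _ _ e).trans
    (g.hom.quotKerEquivOfSurjective hg))).toModuleIso⟩

variable [HasDerivedCategory.{w} (ModuleCat.{u} R)] {A B : ObjectProperty (ModuleCat.{u} R)}

namespace IsCompleteHereditaryCotorsionPair

lemma exists_ghostTriangle_right (h : IsCompleteHereditaryCotorsionPair A B)
    (X : DerivedCategory (ModuleCat.{u} R)) :
    ∃ (Y C : DerivedCategory (ModuleCat.{u} R)) (f : X ⟶ Y) (g : Y ⟶ C)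
      (v : C ⟶ X⟦(1 : ℤ)⟧), ghostTriangles R (Triangle.mk f g v) ∧
        (∀ s, A ((homologyModule s).obj C)) ∧ ∀ s, B ((homologyModule s).obj Y) := by
  obtain ⟨Y, φ, hφ⟩ := h.exists_right_approximation (Q.objPreimage X)
  let f : X ⟶ Q.obj Y := (Q.objObjPreimageIso X).inv ≫ Q.map φ
  obtain ⟨C, g, v, ht⟩ := distinguished_cocone_triangle f
  let e (s : ℤ) : (homologyModule s).obj X ≅ (Q.objPreimage X).homology s :=
    (homologyModule s).mapIso (Q.objObjPreimageIso X).symm ≪≫ homologyQIso _ s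
  have hf (s : ℤ) : (homologyModule s).map f = (e s).hom ≫
      HomologicalComplex.homologyMap φ s ≫ (homologyQIso Y s).inv := by
    rw [Functor.map_comp, homologyFunctor_map_Q_map]
    simp [e]
  have hmono (s : ℤ) : Mono ((homologyFunctor (ModuleCat.{u} R) s).map f) := by
    obtain ⟨-, W, p, w, hS, -⟩ := hφ s
    have : Mono (HomologicalComplex.homologyMap φ s) := hS.mono_f
    have := hf s
    rw [this]
    infer_instance
  have hepi := (forall_epi_homology_iff_forall_mono ht).2 hmono
  refine ⟨Q.obj Y, C, f, g, v, ghostTriangles_iff.2 ⟨ht, hepi⟩, fun s => ?_, fun s =>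
    h.right_of_iso (homologyQIso Y s).symm (hφ s).1⟩
  obtain ⟨-, W, p, w, hS, hW⟩ := hφ s
  have hS' := homology_shortExact ht hepi s
  obtain ⟨i⟩ := nonempty_iso_of_surjective ((homologyQIso Y s).hom ≫ p) ((homologyModule s).map g)
    (((ModuleCat.epi_iff_surjective _).1 hS.epi_g).comp
      (homologyQIso Y s).toLinearEquiv.surjective)
    ((ModuleCat.epi_iff_surjective _).1 hS'.epi_g) fun y => by
      constructor
      · intro hy
        obtain ⟨x, hx⟩ := (ShortComplex.moduleCat_exact_iff _).1 hS.exact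
          ((homologyQIso Y s).hom y) hy
        have : (homologyModule s).map f ((e s).inv x) = y := by
          rw [hf]
          change (homologyQIso Y s).inv (HomologicalComplex.homologyMap φ s
            ((e s).hom ((e s).inv x))) = y
          rw [Iso.inv_hom_id_apply]
          refine (congrArg (homologyQIso Y s).inv hx).trans ?_
          rw [Iso.hom_inv_id_apply]
        rw [← this]
        rw [← homologyModule_map_comp_apply, show f ≫ g = 0 from comp_distTriang_mor_zero₁₂ _ ht,
          homologyModule_map_zero_apply]
      · intro hy
        obtain ⟨x, hx⟩ := (ShortComplex.moduleCat_exact_iff _).1 hS'.exact y hy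
        have hx' : (homologyModule s).map f x = y := hx
        rw [← hx', hf]
        change p ((homologyQIso Y s).hom ((homologyQIso Y s).inv
          (HomologicalComplex.homologyMap φ s ((e s).hom x)))) = 0
        rw [Iso.inv_hom_id_apply]
        exact congr($w _)
  exact h.left_of_iso i hW

/-- This is Salce's argument. Take a ghost triangle $K\to P\to X$ with $P$ homology-free,
approximate $K$ on the right by $K\to Y\to D$, and push the first triangle out along $K\to Y$ to get
$Y\to C\to X$. Homology of $C$ is an extension of that of $D$ by the projective homology of $P$,
hence lies in $\mathsf A$. -/
lemma exists_ghostTriangle_left (h : IsCompleteHereditaryCotorsionPair A B)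
    (X : DerivedCategory (ModuleCat.{u} R)) :
    ∃ (Y C : DerivedCategory (ModuleCat.{u} R)) (f : Y ⟶ C) (g : C ⟶ X)
      (v : X ⟶ Y⟦(1 : ℤ)⟧), ghostTriangles R (Triangle.mk f g v) ∧
        (∀ s, A ((homologyModule s).obj C)) ∧ ∀ s, B ((homologyModule s).obj Y) := by
  obtain ⟨K, P, ι, π, δ, hP, ht⟩ := exists_ghostTriangle_free X
  obtain ⟨Y, D, κ, γ, v, ht', hD, hY⟩ := h.exists_ghostTriangle_right K
  rw [ghostTriangles_iff] at ht ht'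
  -- The pushout is defined by its connecting morphism $\delta$ followed by $\kappa[1]$; as $\delta$
  -- is zero on homology, the new triangle is again a ghost triangle.
  obtain ⟨C, f, g, ht''⟩ := distinguished_cocone_triangle₂ (δ ≫ κ⟦(1 : ℤ)⟧')
  obtain ⟨m, hm₁, hm₂⟩ : ∃ m : P ⟶ C, ι ≫ m = κ ≫ f ∧ π ≫ 𝟙 X = m ≫ g :=
    complete_distinguished_triangle_morphism₂ _ _ ht.1 ht'' κ (𝟙 X)
      (Category.id_comp _).symm
  rw [Category.comp_id] at hm₂
  have hδ := (forall_epi_homology_iff_mor₃ ht.1).1 ht.2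
  have hepi := (forall_epi_homology_iff_mor₃ ht'').2 fun s => by
    change (homologyModule s).map (δ ≫ κ⟦(1 : ℤ)⟧') = 0
    rw [Functor.map_comp, show (homologyModule s).map δ = 0 from hδ s, zero_comp]
  refine ⟨Y, C, f, g, _, ghostTriangles_iff.2 ⟨ht'', hepi⟩, fun s => ?_, hY⟩
  have hS := homology_shortExact ht.1 ht.2 s
  have hS' := homology_shortExact ht'.1 ht'.2 s
  have hS'' := homology_shortExact ht'' hepi s
  have hι : Function.Injective ((homologyModule s).map ι) :=
    (ModuleCat.mono_iff_injective _).1 hS.mono_f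
  have hκ : Function.Injective ((homologyModule s).map κ) :=
    (ModuleCat.mono_iff_injective _).1 hS'.mono_f
  have hf : Function.Injective ((homologyModule s).map f) :=
    (ModuleCat.mono_iff_injective _).1 hS''.mono_f
  have hπ : Function.Surjective ((homologyModule s).map π) :=
    (ModuleCat.epi_iff_surjective _).1 hS.epi_g
  have hγ : Function.Surjective ((homologyModule s).map γ) :=
    (ModuleCat.epi_iff_surjective _).1 hS'.epi_g
  have hm₁' (k) : (homologyModule s).map m ((homologyModule s).map ι k) =
      (homologyModule s).map f ((homologyModule s).map κ k) := by
    rw [← homologyModule_map_comp_apply, hm₁, homologyModule_map_comp_apply]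
  have hm₂' (x) : (homologyModule s).map g ((homologyModule s).map m x) =
      (homologyModule s).map π x := by
    rw [← homologyModule_map_comp_apply, ← hm₂]
  have hfg (y) : (homologyModule s).map g ((homologyModule s).map f y) = 0 := by
    rw [← homologyModule_map_comp_apply, show f ≫ g = 0 from comp_distTriang_mor_zero₁₂ _ ht'',
      homologyModule_map_zero_apply]
  have hκγ (y) : (homologyModule s).map γ ((homologyModule s).map κ y) = 0 := by
    rw [← homologyModule_map_comp_apply, show κ ≫ γ = 0 from comp_distTriang_mor_zero₁₂ _ ht'.1,
      homologyModule_map_zero_apply]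
  have : Mono ((homologyModule s).map m) := by
    refine (ModuleCat.mono_iff_injective _).2 ((injective_iff_map_eq_zero _).2 fun x hx => ?_)
    obtain ⟨k, rfl⟩ : ∃ k, (homologyModule s).map ι k = x :=
      exists_homology_eq_of_distTriang ht.1 s x ((hm₂' x).symm.trans
        ((congrArg _ hx).trans (map_zero _)))
    have hk : (homologyModule s).map f ((homologyModule s).map κ k) = 0 := (hm₁' k).symm.trans hx
    obtain rfl : k = 0 := hκ ((hf (hk.trans (map_zero _).symm)).trans (map_zero _).symm)
    exact map_zero _
  have hcoker (c) : cokernel.π ((homologyModule s).map m) c = 0 ↔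
      ∃ x, (homologyModule s).map m x = c := by
    refine ⟨fun hc => (ShortComplex.moduleCat_exact_iff _).1 (shortExact_cokernel _).exact c hc, ?_⟩
    rintro ⟨x, rfl⟩
    exact congr($(cokernel.condition ((homologyModule s).map m)) x)
  -- The homology of $D$ and the cokernel of $H^s(P)\to H^s(C)$ are quotients of $H^s(Y)$ by the
  -- same submodule, the image of $H^s(K)$.
  obtain ⟨i⟩ := nonempty_iso_of_surjective ((homologyModule s).map γ)
    ((homologyModule s).map f ≫ cokernel.π ((homologyModule s).map m)) hγ (fun z => by
      obtain ⟨c, rfl⟩ := (ModuleCat.epi_iff_surjective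
        (cokernel.π ((homologyModule s).map m))).1 inferInstance z
      obtain ⟨x, hx⟩ := hπ ((homologyModule s).map g c)
      obtain ⟨y, hy⟩ : ∃ y, (homologyModule s).map f y = c - (homologyModule s).map m x :=
        exists_homology_eq_of_distTriang ht'' s _ (by
          change (homologyModule s).map g _ = 0
          rw [map_sub, hm₂', hx, sub_self])
      refine ⟨y, ?_⟩
      change cokernel.π ((homologyModule s).map m) ((homologyModule s).map f y) = _
      rw [hy, map_sub, (hcoker _).2 ⟨x, rfl⟩, sub_zero]) fun y => by
      change _ ↔ cokernel.π ((homologyModule s).map m) ((homologyModule s).map f y) = 0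
      rw [hcoker]
      constructor
      · intro hy
        obtain ⟨k, rfl⟩ : ∃ k, (homologyModule s).map κ k = y :=
          exists_homology_eq_of_distTriang ht'.1 s y hy
        exact ⟨_, hm₁' k⟩
      · rintro ⟨x, hx⟩
        obtain ⟨k, rfl⟩ : ∃ k, (homologyModule s).map ι k = x :=
          exists_homology_eq_of_distTriang ht.1 s x ((hm₂' x).symm.trans
            ((congrArg _ hx).trans (hfg y)))
        rw [← hf ((hm₁' k).symm.trans hx), hκγ]
  have := hP.projective s
  exact h.left_of_shortExact (shortExact_cokernel ((homologyModule s).map m))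
    (h.left_of_projective ((homologyModule s).obj P)) (h.left_of_iso i (hD s))

/-- The homology of a complex concentrated in one degree, in that degree. -/
noncomputable def _root_.homologySingleIso (M : ModuleCat.{u} R) (s : ℤ) :
    (homologyModule s).obj (Q.obj ((HomologicalComplex.single _ (.up ℤ) s).obj M)) ≅ M :=
  homologyQIso _ s ≪≫ HomologicalComplex.singleObjHomologySelfIso (.up ℤ) s M

/-- With the classes and $\xi xt^1_\xi$ both described on homology, the axioms other than
completeness are checked in each degree. Complexes concentrated in degree $s$ isolate the condition
on the $s$-th homology. -/
lemma isXiCompleteHereditaryCotorsionPair (h : IsCompleteHereditaryCotorsionPair A B) :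
    IsXiCompleteHereditaryCotorsionPair (ghostTriangles R) (projClass A) (injClass B) where
  rightPerp_eq := by
    ext U
    rw [h.injClass_iff]
    constructor
    · intro hU s
      rw [← h.rightPerp_eq]
      intro N hN
      exact subsingleton_ext_of_iso (homologySingleIso N s) ((xiExtOneVanishes_iff _ _).1
        (hU _ ((h.projClass_iff _).2 (h.left_homology_single hN s))) s)
    · intro hU X hX
      exact (xiExtOneVanishes_iff _ _).2 fun s =>
        h.subsingleton_ext ((h.projClass_iff _).1 hX s) (hU s)
  leftPerp_eq := by
    ext V
    rw [h.projClass_iff]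
    constructor
    · intro hV s
      rw [← h.leftPerp_eq]
      intro N hN
      exact rightPerp_of_retract (fun M => M = (homologyModule s).obj V)
        (homologySingleIso N s).symm.retract (by
          rintro _ rfl
          exact (xiExtOneVanishes_iff _ _).1
            (hV _ ((h.injClass_iff _).2 (h.right_homology_single hN s))) s) _ rfl
    · intro hV Y hY
      exact (xiExtOneVanishes_iff _ _).2 fun s =>
        h.subsingleton_ext (hV s) ((h.injClass_iff _).1 hY s)
  enough_left X := by
    obtain ⟨Y, C, f, g, v, ht, hC, hY⟩ := h.exists_ghostTriangle_left X
    exact ⟨Y, C, f, g, v, ht, (h.projClass_iff _).2 hC, (h.injClass_iff _).2 hY⟩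
  enough_right X := by
    obtain ⟨Y, C, f, g, v, ht, hC, hY⟩ := h.exists_ghostTriangle_right X
    exact ⟨Y, C, f, g, v, ht, (h.projClass_iff _).2 hC, (h.injClass_iff _).2 hY⟩
  hereditary_left t ht h₂ h₃ := by
    rw [ghostTriangles_iff] at ht
    rw [h.projClass_iff] at h₂ h₃ ⊢
    exact fun s => h.hereditary_left _ (homology_shortExact ht.1 ht.2 s) (h₂ s) (h₃ s)
  hereditary_right t ht h₁ h₂ := by
    rw [ghostTriangles_iff] at ht
    rw [h.injClass_iff] at h₁ h₂ ⊢
    exact fun s => h.hereditary_right _ (homology_shortExact ht.1 ht.2 s) (h₁ s) (h₂ s)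

end IsCompleteHereditaryCotorsionPair

end Forward

/-! ### Shifts, stalk complexes and the cotorsion pair they induce. -/

section Shift

open DerivedCategory

variable {R : Type u} [Ring R]

lemma cokernel_π_eq_zero_iff {M N : ModuleCat.{u} R} (f : M ⟶ N) (y : N) :
    cokernel.π f y = 0 ↔ y ∈ LinearMap.range f.hom := by
  constructor
  · exact fun hy => (ShortComplex.moduleCat_exact_iff _).1 (ShortComplex.exact_of_g_is_cokernel
      (ShortComplex.mk _ _ (cokernel.condition f)) (cokernelIsCokernel f)) y hy
  · rintro ⟨x, rfl⟩
    exact congr($(cokernel.condition f) x)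

lemma nonempty_cokernel_shift_iso (P : CochainComplex (ModuleCat.{u} R) ℤ) (n s : ℤ) :
    Nonempty (cokernel (P.d (s + n - 1) (s + n)) ≅ cokernel ((P⟦n⟧).d (s - 1) s)) := by
  have hsurj : Function.Surjective (cokernel.π ((P⟦n⟧).d (s - 1) s)) :=
    (ModuleCat.epi_iff_surjective _).1 inferInstance
  refine nonempty_iso_of_surjective (Y := P.X (s + n)) (cokernel.π (P.d (s + n - 1) (s + n)))
    (cokernel.π ((P⟦n⟧).d (s - 1) s)) ((ModuleCat.epi_iff_surjective _).1 inferInstance)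
    hsurj fun y => ?_
  rw [cokernel_π_eq_zero_iff]
  refine Iff.trans ?_ (cokernel_π_eq_zero_iff ((P⟦n⟧).d (s - 1) s) y).symm
  rw [CochainComplex.shiftFunctor_obj_d']
  -- The indices $s+n-1$ and $s-1+n$ agree, but not by definition. The sign in the shifted
  -- differential, treated afterwards, does not change its range.
  have key (y : P.X (s + n)) : y ∈ LinearMap.range (P.d (s + n - 1) (s + n)).hom ↔
      ∃ x : P.X (s - 1 + n), P.d (s - 1 + n) (s + n) x = y := by
    constructor
    · rintro ⟨x, rfl⟩
      exact d_mem_range P _ _ _ (by lia) x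
    · rintro ⟨x, rfl⟩
      exact d_mem_range P _ _ _ (by lia) x
  rw [key]
  constructor
  · rintro ⟨x, rfl⟩
    obtain hn | hn := Int.units_eq_one_or n.negOnePow
    · exact ⟨x, by rw [hn, one_smul]; rfl⟩
    · exact ⟨-x, by rw [hn, Units.neg_smul, one_smul]; exact (map_neg _ _).trans (neg_neg _)⟩
  · rintro ⟨x, rfl⟩
    obtain hn | hn := Int.units_eq_one_or n.negOnePow
    · exact ⟨x, by rw [hn, one_smul]; rfl⟩
    · exact ⟨-x, by rw [hn, Units.neg_smul, one_smul]; exact map_neg _ _⟩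

variable [HasDerivedCategory.{w} (ModuleCat.{u} R)]

/-- Shift stability is what later separates degrees: $\xi xt^1_\xi$ itself only compares homology
modules of equal degree. -/
lemma projClass_shift {A : ObjectProperty (ModuleCat.{u} R)} [A.IsClosedUnderIsomorphisms]
    {Y : DerivedCategory (ModuleCat.{u} R)} (hY : projClass A Y) (n : ℤ) :
    projClass A (Y⟦n⟧) := by
  obtain ⟨K, P, f, ⟨e⟩, hP, hf, hA⟩ := hY
  have := hP.isKProjective
  have hp (i : ℤ) : Projective ((P⟦n⟧).X i) := hP.projective (i + n)
  refine ⟨P⟦n⟧, P⟦n⟧, 𝟙 _, ⟨(Q.commShiftIso n).app P ≪≫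
    (shiftFunctor _ n).mapIso (asIso (Q.map f) ≪≫ e)⟩,
    isSemiProjective_of_isKProjective _, inferInstance, fun s => ?_⟩
  obtain ⟨i⟩ := nonempty_cokernel_shift_iso P n s
  exact A.prop_of_iso i (hA _)

end Shift

section Backward

open DerivedCategory

variable {R : Type u} [Ring R]

lemma subsingleton_ext_of_isos {X X' Y Y' : ModuleCat.{u} R} (e : X ≅ X') (e' : Y ≅ Y')
    (h : Subsingleton (Abelian.Ext X Y 1)) : Subsingleton (Abelian.Ext X' Y' 1) :=
  subsingleton_ext_of_iso e (rightPerp_of_retract (fun N => N = X) e'.symm.retract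
    (by rintro _ rfl; exact h) X rfl)

variable [HasDerivedCategory.{w} (ModuleCat.{u} R)]

/-- A module, as an object of `D(R)` concentrated in degree zero. -/
noncomputable abbrev stalk (M : ModuleCat.{u} R) : DerivedCategory (ModuleCat.{u} R) :=
  Q.obj ((HomologicalComplex.single _ (.up ℤ) 0).obj M)

lemma isZero_homology_stalk (M : ModuleCat.{u} R) {s : ℤ} (hs : s ≠ 0) :
    IsZero ((homologyModule s).obj (stalk M)) :=
  (HomologicalComplex.isZero_single_obj_homology (.up ℤ) 0 M s hs).of_iso (homologyQIso _ s)

lemma exists_ghostTriangle_stalk {S : ShortComplex (ModuleCat.{u} R)} (hS : S.ShortExact) :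
    ∃ t, ghostTriangles R t ∧ t.obj₁ = stalk S.X₁ ∧ t.obj₂ = stalk S.X₂ ∧
      t.obj₃ = stalk S.X₃ := by
  refine ⟨_, ghostTriangles_iff.2 ⟨triangleOfSES_distinguished
    (hS.map_of_exact (HomologicalComplex.single _ (.up ℤ) 0)), fun s => ?_⟩, rfl, rfl, rfl⟩
  change Epi ((homologyFunctor _ s).map (Q.map ((HomologicalComplex.single _ (.up ℤ) 0).map S.g)))
  have hg : Epi (((HomologicalComplex.single (ModuleCat.{u} R) (.up ℤ) 0).map S.g).f s) := by
    have : Epi ((HomologicalComplex.single (ModuleCat.{u} R) (.up ℤ) 0).map S.g) :=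
      (hS.map_of_exact (HomologicalComplex.single (ModuleCat.{u} R) (.up ℤ) 0)).epi_g
    infer_instance
  have : Epi (HomologicalComplex.homologyMap
      ((HomologicalComplex.single (ModuleCat.{u} R) (.up ℤ) 0).map S.g) s) := by
    refine (ModuleCat.epi_iff_surjective _).2 fun y => ?_
    obtain ⟨⟨z, hz⟩, rfl⟩ := homologyClass_surjective _ _ y
    obtain ⟨x, hx⟩ := (ModuleCat.epi_iff_surjective _).1 hg z
    refine ⟨homologyClass _ s ⟨x, by simp⟩, (homologyMap_homologyClass _ _ _).trans ?_⟩
    exact congrArg _ (Subtype.ext hx)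
  rw [homologyFunctor_map_Q_map]
  infer_instance

namespace IsXiCompleteHereditaryCotorsionPair

variable {𝒜 ℬ : ObjectProperty (DerivedCategory (ModuleCat.{u} R))}

lemma left_iff (H : IsXiCompleteHereditaryCotorsionPair (ghostTriangles R) 𝒜 ℬ)
    (V : DerivedCategory (ModuleCat.{u} R)) :
    𝒜 V ↔ ∀ U, ℬ U → ∀ s, Subsingleton (Abelian.Ext ((homologyModule s).obj V)
      ((homologyModule s).obj U) 1) := by
  nth_rw 1 [← H.leftPerp_eq]
  exact forall₂_congr fun U _ => xiExtOneVanishes_iff V U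

lemma right_iff (H : IsXiCompleteHereditaryCotorsionPair (ghostTriangles R) 𝒜 ℬ)
    (U : DerivedCategory (ModuleCat.{u} R)) :
    ℬ U ↔ ∀ V, 𝒜 V → ∀ s, Subsingleton (Abelian.Ext ((homologyModule s).obj V)
      ((homologyModule s).obj U) 1) := by
  nth_rw 1 [← H.rightPerp_eq]
  exact forall₂_congr fun V _ => xiExtOneVanishes_iff V U

/-- Shifting $V$ by $s-t$ moves its homology from degree $s$ to degree $t$, where it can be compared
with that of $U$. -/
lemma subsingleton_ext (H : IsXiCompleteHereditaryCotorsionPair (ghostTriangles R) 𝒜 ℬ)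
    (hs : ∀ V (n : ℤ), 𝒜 V → 𝒜 (V⟦n⟧)) {V U : DerivedCategory (ModuleCat.{u} R)}
    (hV : 𝒜 V) (hU : ℬ U) (s t : ℤ) :
    Subsingleton (Abelian.Ext ((homologyModule s).obj V) ((homologyModule t).obj U) 1) :=
  subsingleton_ext_of_iso (homologyShiftIso V (s - t) t s (by lia))
    ((H.left_iff _).1 (hs V (s - t) hV) U hU t)

/-- A stalk complex has zero homology outside degree zero, so only one degree imposes a condition;
shift stability spreads that condition over all degrees of $U$. -/
lemma left_stalk_iff (H : IsXiCompleteHereditaryCotorsionPair (ghostTriangles R) 𝒜 ℬ)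
    (hs : ∀ V (n : ℤ), 𝒜 V → 𝒜 (V⟦n⟧)) (M : ModuleCat.{u} R) :
    𝒜 (stalk M) ↔
      ∀ U, ℬ U → ∀ t, Subsingleton (Abelian.Ext M ((homologyModule t).obj U) 1) := by
  refine ⟨fun hM U hU t => subsingleton_ext_of_iso (homologySingleIso M 0)
    (H.subsingleton_ext hs hM hU 0 t), fun h => (H.left_iff _).2 fun U hU s => ?_⟩
  by_cases hs0 : s = 0
  · subst hs0
    exact subsingleton_ext_of_iso (homologySingleIso M 0).symm (h U hU 0)
  · have := (isZero_homology_stalk M hs0).projective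
    exact Abelian.Ext.subsingleton_of_projective _ _ _

lemma right_stalk_iff (H : IsXiCompleteHereditaryCotorsionPair (ghostTriangles R) 𝒜 ℬ)
    (hs : ∀ V (n : ℤ), 𝒜 V → 𝒜 (V⟦n⟧)) (N : ModuleCat.{u} R) :
    ℬ (stalk N) ↔
      ∀ V, 𝒜 V → ∀ t, Subsingleton (Abelian.Ext ((homologyModule t).obj V) N 1) := by
  refine ⟨fun hN V hV t => subsingleton_ext_of_isos (Iso.refl _) (homologySingleIso N 0)
    (H.subsingleton_ext hs hV hN t 0), fun h => (H.right_iff _).2 fun V hV s => ?_⟩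
  by_cases hs0 : s = 0
  · subst hs0
    exact subsingleton_ext_of_isos (Iso.refl _) (homologySingleIso N 0).symm (h V hV 0)
  · have := (isZero_homology_stalk N hs0).injective
    exact Abelian.Ext.subsingleton_of_injective _ _ _

/-- Both sides say that $\mathrm{Ext}^1$ vanishes from the homology of $V$ to that of every object
of $\mathcal B$, because equality of degrees no longer matters. -/
lemma left_iff_homology (H : IsXiCompleteHereditaryCotorsionPair (ghostTriangles R) 𝒜 ℬ)
    (hs : ∀ V (n : ℤ), 𝒜 V → 𝒜 (V⟦n⟧)) (V : DerivedCategory (ModuleCat.{u} R)) :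
    𝒜 V ↔ ∀ s, 𝒜 (stalk ((homologyModule s).obj V)) := by
  refine ⟨fun hV s => (H.left_stalk_iff hs _).2 fun U hU t => H.subsingleton_ext hs hV hU s t,
    fun h => (H.left_iff _).2 fun U hU s => (H.left_stalk_iff hs _).1 (h s) U hU s⟩

lemma right_iff_homology (H : IsXiCompleteHereditaryCotorsionPair (ghostTriangles R) 𝒜 ℬ)
    (hs : ∀ V (n : ℤ), 𝒜 V → 𝒜 (V⟦n⟧)) (U : DerivedCategory (ModuleCat.{u} R)) :
    ℬ U ↔ ∀ s, ℬ (stalk ((homologyModule s).obj U)) := by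
  refine ⟨fun hU s => (H.right_stalk_iff hs _).2 fun V hV t => H.subsingleton_ext hs hV hU t s,
    fun h => (H.right_iff _).2 fun V hV s => (H.right_stalk_iff hs _).1 (h s) V hV s⟩

/-- The modules whose stalk complexes belong to the two classes form a complete hereditary
cotorsion pair. -/
theorem isCompleteHereditaryCotorsionPair_stalk
    (H : IsXiCompleteHereditaryCotorsionPair (ghostTriangles R) 𝒜 ℬ)
    (hs : ∀ V (n : ℤ), 𝒜 V → 𝒜 (V⟦n⟧)) :
    IsCompleteHereditaryCotorsionPair (fun M : ModuleCat.{u} R => 𝒜 (stalk M))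
      (fun M => ℬ (stalk M)) where
  rightPerp_eq := by
    ext N
    rw [H.right_stalk_iff hs]
    exact ⟨fun h V hV t => h _ ((H.left_iff_homology hs V).1 hV t), fun h M hM =>
      subsingleton_ext_of_iso (homologySingleIso M 0) (h _ hM 0)⟩
  leftPerp_eq := by
    ext M
    rw [H.left_stalk_iff hs]
    exact ⟨fun h U hU t => h _ ((H.right_iff_homology hs U).1 hU t), fun h N hN =>
      subsingleton_ext_of_isos (Iso.refl _) (homologySingleIso N 0) (h _ hN 0)⟩
  enough_left M := by
    obtain ⟨U, V, f, g, v, ht, hV, hU⟩ := H.enough_left (stalk M)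
    rw [ghostTriangles_iff] at ht
    have hS := homology_shortExact ht.1 ht.2 0
    have hfg : (homologyModule 0).map f ≫ (homologyModule 0).map g = 0 := by
      rw [← Functor.map_comp, show f ≫ g = 0 from comp_distTriang_mor_zero₁₂ _ ht.1,
        Functor.map_zero]
    refine ⟨(homologyModule 0).obj U, (homologyModule 0).obj V, (homologyModule 0).map f,
      (homologyModule 0).map g ≫ (homologySingleIso M 0).hom,
      by rw [← Category.assoc, hfg, zero_comp], ?_, (H.left_iff_homology hs V).1 hV 0,
      (H.right_iff_homology hs U).1 hU 0⟩
    exact ShortComplex.shortExact_of_iso (S₁ := ShortComplex.mk _ _ hfg)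
      (ShortComplex.isoMk (Iso.refl _) (Iso.refl _) (homologySingleIso M 0)) hS
  enough_right M := by
    obtain ⟨U, V, f, g, v, ht, hV, hU⟩ := H.enough_right (stalk M)
    rw [ghostTriangles_iff] at ht
    have hS := homology_shortExact ht.1 ht.2 0
    have hfg : (homologyModule 0).map f ≫ (homologyModule 0).map g = 0 := by
      rw [← Functor.map_comp, show f ≫ g = 0 from comp_distTriang_mor_zero₁₂ _ ht.1,
        Functor.map_zero]
    refine ⟨(homologyModule 0).obj U, (homologyModule 0).obj V,
      (homologySingleIso M 0).inv ≫ (homologyModule 0).map f, (homologyModule 0).map g,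
      by rw [Category.assoc, hfg, comp_zero], ?_, (H.left_iff_homology hs V).1 hV 0,
      (H.right_iff_homology hs U).1 hU 0⟩
    exact ShortComplex.shortExact_of_iso (S₁ := ShortComplex.mk _ _ hfg)
      (ShortComplex.isoMk (homologySingleIso M 0) (Iso.refl _) (Iso.refl _)
        ((Iso.hom_inv_id_assoc _ _).trans (Category.comp_id _).symm)) hS
  hereditary_left S hS h₂ h₃ := by
    obtain ⟨t, ht, e₁, e₂, e₃⟩ := exists_ghostTriangle_stalk hS
    exact e₁ ▸ H.hereditary_left t ht (e₂ ▸ h₂) (e₃ ▸ h₃)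
  hereditary_right S hS h₁ h₂ := by
    obtain ⟨t, ht, e₁, e₂, e₃⟩ := exists_ghostTriangle_stalk hS
    exact e₃ ▸ H.hereditary_right t ht (e₁ ▸ h₁) (e₂ ▸ h₂)

end IsXiCompleteHereditaryCotorsionPair

end Backward

/-! ### Recovering the module classes from stalk complexes. -/

section Presentation

open DerivedCategory HomologicalComplex

variable {R : Type u} [Ring R] [HasDerivedCategory.{w} (ModuleCat.{u} R)]
  {A B : ObjectProperty (ModuleCat.{u} R)}

/-- A semi-projective resolution $P$ of the stalk is represented by a quasi-isomorphism to it. The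
inclusion of $H^0(P)\cong M$ into the cokernel in degree zero is split by the map this
quasi-isomorphism induces on cokernels, so $M$ is a retract of a module in the class. -/
lemma prop_of_projClass_stalk [A.IsStableUnderRetracts] {M : ModuleCat.{u} R}
    (hM : projClass A (stalk M)) : A M := by
  obtain ⟨K, P, f, ⟨e⟩, hP, hf, hA⟩ := hM
  have := hP.isKProjective
  obtain ⟨F, hF⟩ := exists_Q_map_eq_of_isKProjective P _ (Q.map f ≫ e.hom)
  have : IsIso (Q.map F) := by rw [hF]; infer_instance
  have : QuasiIso F := (isIso_Q_map_iff_quasiIso _ _).1 this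
  have r : Retract M (P.opcycles 0) :=
    { i := (singleObjHomologySelfIso (.up ℤ) 0 M).inv ≫ inv (homologyMap F 0) ≫ P.homologyι 0
      r := opcyclesMap F 0 ≫ (singleObjOpcyclesSelfIso (.up ℤ) 0 M).inv
      retract := by
        simp only [Category.assoc]
        rw [← homologyι_naturality_assoc, IsIso.inv_hom_id_assoc,
          homologyι_singleObjOpcyclesSelfIso_inv, Iso.inv_hom_id] }
  exact A.prop_of_retract r (A.prop_of_iso (opcyclesIsoCokernel P 0).symm (hA 0))

/-- Dually, $N$ is a retract of the cocycles of the resolution in degree zero: the map from the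
stalk to these cocycles is split by their projection onto $H^0(I)\cong N$. -/
lemma prop_of_injClass_stalk [B.IsStableUnderRetracts] {N : ModuleCat.{u} R}
    (hN : injClass B (stalk N)) : B N := by
  obtain ⟨K, I, f, ⟨e⟩, hI, hf, hB⟩ := hN
  have := hI.isKInjective
  obtain ⟨F, hF⟩ := exists_Q_map_eq_of_isKInjective _ I (e.inv ≫ Q.map f)
  have : IsIso (Q.map F) := by rw [hF]; infer_instance
  have : QuasiIso F := (isIso_Q_map_iff_quasiIso _ _).1 this
  have r : Retract N (I.cycles 0) :=
    { i := (singleObjCyclesSelfIso (.up ℤ) 0 N).inv ≫ cyclesMap F 0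
      r := I.homologyπ 0 ≫ inv (homologyMap F 0) ≫ (singleObjHomologySelfIso (.up ℤ) 0 N).hom
      retract := by
        simp only [Category.assoc]
        rw [← homologyπ_naturality_assoc, IsIso.hom_inv_id_assoc,
          homologyπ_singleObjHomologySelfIso_hom, Iso.inv_hom_id] }
  exact B.prop_of_retract r (B.prop_of_iso (cyclesIsoKernel I 0).symm (hB 0))

/-- The complex is a projective presentation of $M$ in degrees $-1$ and $0$. A full resolution would
have syzygies as cokernels, and these are not known to lie in $\mathsf A$; the two-term complex has
only $M$ and projective modules as cokernels. Its homology in degree $-1$ is harmless. -/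
lemma exists_projClass_of_projective_le [A.IsClosedUnderIsomorphisms]
    (hA : ∀ P, Projective P → A P) {M : ModuleCat.{u} R} (hM : A M) :
    ∃ K : CochainComplex (ModuleCat.{u} R) ℤ,
      projClass A (Q.obj K) ∧ Nonempty (K.homology 0 ≅ M) := by
  let p := Projective.π M
  have hrel : (ComplexShape.up ℤ).Rel (0 - 1) 0 := by simp
  have hne : (0 - 1 : ℤ) ≠ 0 := by simp
  let K : CochainComplex (ModuleCat.{u} R) ℤ := double (Projective.d p) hrel
  have hX (n : ℤ) : Projective (K.X n) := by
    by_cases h₀ : n = 0 - 1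
    · subst h₀
      exact Projective.of_iso (doubleXIso₀ (Projective.d p) hrel).symm inferInstance
    by_cases h₁ : n = 0
    · subst h₁
      exact Projective.of_iso (doubleXIso₁ (Projective.d p) hrel hne).symm inferInstance
    · exact (isZero_double_X _ hrel n h₀ h₁).projective
  have : K.IsStrictlyLE 0 := (CochainComplex.isStrictlyLE_iff _ _).2 fun i hi =>
    isZero_double_X _ hrel i (by lia) (by lia)
  have := CochainComplex.isKProjective_of_projective K 0
  have i₀ : cokernel (K.d (0 - 1) 0) ≅ M :=
    cokernel.mapIso _ (Projective.d p) (doubleXIso₀ (Projective.d p) hrel)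
      (doubleXIso₁ (Projective.d p) hrel hne)
      (by rw [double_d _ hrel hne, Category.assoc, Category.assoc, Iso.inv_hom_id,
        Category.comp_id]) ≪≫
    (cokernelIsCokernel _).coconePointUniqueUpToIso (exact_d_f p).gIsCokernel
  refine ⟨K, ⟨K, K, 𝟙 K, ⟨Iso.refl _⟩, isSemiProjective_of_isKProjective K, inferInstance,
    fun s => ?_⟩, ⟨K.isoHomologyι 0 1 (by simp) (double_d_eq_zero₀ _ _ _ _ (by simp)) ≪≫
      opcyclesIsoCokernel K 0 ≪≫ i₀⟩⟩
  by_cases hs : s = 0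
  · subst hs
    exact A.prop_of_iso i₀.symm hM
  · exact A.prop_of_iso (cokernelIsoOfEq (double_d_eq_zero₁ _ _ _ _ hs) ≪≫
      cokernelZeroIsoTarget).symm (hA _ (hX s))

lemma exists_injClass_of_injective_le [B.IsClosedUnderIsomorphisms]
    (hB : ∀ I, Injective I → B I) {N : ModuleCat.{u} R} (hN : B N) :
    ∃ K : CochainComplex (ModuleCat.{u} R) ℤ,
      injClass B (Q.obj K) ∧ Nonempty (K.homology 0 ≅ N) := by
  let p := Injective.ι N
  have hrel : (ComplexShape.up ℤ).Rel 0 (0 + 1) := by simp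
  have hne : (0 : ℤ) ≠ 0 + 1 := by simp
  let K : CochainComplex (ModuleCat.{u} R) ℤ := double (Injective.d p) hrel
  have hX (n : ℤ) : Injective (K.X n) := by
    by_cases h₀ : n = 0
    · subst h₀
      exact Injective.of_iso (doubleXIso₀ (Injective.d p) hrel).symm inferInstance
    by_cases h₁ : n = 0 + 1
    · subst h₁
      exact Injective.of_iso (doubleXIso₁ (Injective.d p) hrel hne).symm inferInstance
    · exact (isZero_double_X _ hrel n h₀ h₁).injective
  have : K.IsStrictlyGE 0 := (CochainComplex.isStrictlyGE_iff _ _).2 fun i hi =>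
    isZero_double_X _ hrel i (by lia) (by lia)
  have := CochainComplex.isKInjective_of_injective K 0
  have i₀ : kernel (K.d 0 (0 + 1)) ≅ N :=
    kernel.mapIso _ (Injective.d p) (doubleXIso₀ (Injective.d p) hrel)
      (doubleXIso₁ (Injective.d p) hrel hne)
      (by rw [double_d _ hrel hne, Category.assoc, Category.assoc, Iso.inv_hom_id,
        Category.comp_id]) ≪≫
    (kernelIsKernel _).conePointUniqueUpToIso (exact_f_d p).fIsKernel
  refine ⟨K, ⟨K, K, 𝟙 K, ⟨Iso.refl _⟩, isSemiInjective_of_isKInjective K, inferInstance,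
    fun s => ?_⟩, ⟨(K.isoHomologyπ (0 - 1) 0 (by simp)
      (double_d_eq_zero₀ _ _ _ _ (by simp))).symm ≪≫ cyclesIsoKernel K 0 ≪≫ i₀⟩⟩
  by_cases hs : s = 0
  · subst hs
    exact B.prop_of_iso i₀.symm hN
  · exact B.prop_of_iso (kernelIsoOfEq (double_d_eq_zero₀ _ _ _ _ hs) ≪≫
      kernelZeroIsoSource).symm (hB _ (hX s))

/-- The modules with stalks in the two classes already form a cotorsion pair, so it remains to
identify them. This pair contains all projectives on the left and all injectives on the right, and
the retract arguments carry these into $\mathsf A$ and $\mathsf B$. The two-term complexes are then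
available, and membership passes from such a complex to the stalk of its homology in degree zero. -/
lemma IsXiCompleteHereditaryCotorsionPair.isCompleteHereditaryCotorsionPair
    [A.IsStableUnderRetracts] [B.IsStableUnderRetracts]
    (H : IsXiCompleteHereditaryCotorsionPair (ghostTriangles R) (projClass A) (injClass B)) :
    IsCompleteHereditaryCotorsionPair A B := by
  have hs (V : DerivedCategory (ModuleCat.{u} R)) (n : ℤ) (hV : projClass A V) :
      projClass A (V⟦n⟧) := projClass_shift hV n
  have h := H.isCompleteHereditaryCotorsionPair_stalk hs
  have hA : (fun M => projClass A (stalk M)) = A := by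
    ext M
    refine ⟨prop_of_projClass_stalk, fun hM => ?_⟩
    obtain ⟨K, hK, ⟨e⟩⟩ := exists_projClass_of_projective_le
      (fun P _ => prop_of_projClass_stalk (h.left_of_projective P)) hM
    exact h.left_of_iso (homologyQIso K 0 ≪≫ e) ((H.left_iff_homology hs _).1 hK 0)
  have hB : (fun M => injClass B (stalk M)) = B := by
    ext M
    refine ⟨prop_of_injClass_stalk, fun hM => ?_⟩
    obtain ⟨K, hK, ⟨e⟩⟩ := exists_injClass_of_injective_le
      (fun I _ => prop_of_injClass_stalk (h.right_of_injective I)) hM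
    exact h.right_of_iso (homologyQIso K 0 ≪≫ e) ((H.right_iff_homology hs _).1 hK 0)
  rwa [hA, hB] at h

end Presentation

theorem theorem2p5 {R : Type u} [Ring R] [HasDerivedCategory.{w} (ModuleCat.{u} R)]
    (A B : ObjectProperty (ModuleCat.{u} R))
    [A.IsStableUnderRetracts] [B.IsStableUnderRetracts] :
    IsCompleteHereditaryCotorsionPair A B ↔
      IsXiCompleteHereditaryCotorsionPair (ghostTriangles R) (projClass A) (injClass B) := by
  exact ⟨fun h => h.isXiCompleteHereditaryCotorsionPair,
    fun H => H.isCompleteHereditaryCotorsionPair⟩
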